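/- All graphs are finite and simple. An end-vertex of a graph $H$ is a vertex of degree $1$ in $H$, and an induced copy of $H$ in $G$ is an induced subgraph of $G$ isomorphic to $H$. Let $P_6$ be the path on $6$ vertices; let $N$ (the net) be the graph obtained from a triangle by attaching one pendant edge at each of its three vertices; and let $W$ (the wounded) be the graph obtained from a triangle $xyz$ by attaching a pendant edge at $y$ and a pendant path with two edges at $z$. (So $P_6$ and $W$ have two end-vertices, and $N$ has three.) A graph is claw-free if it has no induced copy of $K_{1,3}$; it is $2$-connected if it has at least three vertices and is connected and remains connected after the deletion of any one vertex; it is hamiltonian if it has a cycle through all of its vertices. Let $H$ be one of $P_6$, $N$, $W$, and let $G$ be a $2$-connected claw-free graph on $n$ vertices. If every vertex $v$ of $G$ that is an end-vertex of an induced copy of $H$ in $G$ satisfies $d_G(v)\ge (n+3)/3$, then $G$ is hamiltonian. -/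

import Mathlib

/-- `G` is `k`-connected: it has more than `k` vertices, and it stays connected after the deletion
of any set of fewer than `k` vertices. -/
def IsKConnected {V : Type*} [Fintype V] (G : SimpleGraph V) (k : ℕ) : Prop :=
  k < Fintype.card V ∧
    ∀ S : Finset V, S.card < k → (G.induce {v : V | v ∉ S}).Connected

/-- The claw `K_{1,3}`: the star with centre `0` and the three end-vertices `1, 2, 3`. -/
def clawGraph : SimpleGraph (Fin 4) := SimpleGraph.starGraph 0

/-- `G` contains no induced copy of the claw. -/
def IsClawFree {V : Type*} (G : SimpleGraph V) : Prop :=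
  ¬ clawGraph.IsIndContained G

/-- The net `N`: the triangle `0, 1, 2` with three disjoint pendant edges `03`, `14`, `25`. -/
def netGraph : SimpleGraph (Fin 6) :=
  SimpleGraph.fromEdgeSet {s(0, 1), s(0, 2), s(1, 2), s(0, 3), s(1, 4), s(2, 5)}

/-- The wounded `W`: the triangle `0, 1, 2` with a pendant edge `13` at `1` and a pendant path
`2, 4, 5` with two edges at `2`. -/
def woundedGraph : SimpleGraph (Fin 6) :=
  SimpleGraph.fromEdgeSet {s(0, 1), s(0, 2), s(1, 2), s(1, 3), s(2, 4), s(4, 5)}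

/-- `u` is an end-vertex of `H`: a vertex with exactly one neighbour in `H`. -/
def IsEndVertex {W : Type*} (H : SimpleGraph W) (u : W) : Prop :=
  ∃! w : W, H.Adj u w

/-- `v` is an end-vertex of some induced copy of `H` in `G`. -/
def IsEndVertexOfInducedCopy {W V : Type*} (H : SimpleGraph W) (G : SimpleGraph V) (v : V) :
    Prop :=
  ∃ (f : H ↪g G) (u : W), IsEndVertex H u ∧ f u = v

/-- The condition `Φ(H, k)` on a graph `G` with `n` vertices: every vertex of `G` that is an
end-vertex of an induced copy of `H` in `G` has degree at least `(n + k) / 3` in `G`. -/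
def SatisfiesPhi {W V : Type*} [Fintype V] (H : SimpleGraph W) (k : ℤ) (G : SimpleGraph V)
    [DecidableRel G.Adj] : Prop :=
  ∀ v : V, IsEndVertexOfInducedCopy H G v → ((Fintype.card V : ℚ) + k) / 3 ≤ G.degree v

/-! The proof passes to a closure of `G` in which hamiltonicity is a question about closed trails in
a root graph, and sets the degree condition against what a missing trail leaves behind.

Closure. If the neighbourhood of `x` contains an induced path on three vertices, turning the closed
neighbourhood of `x` into a clique keeps the graph claw-free, and the result is hamiltonian only if
the original graph is (`hasHamCyc_of_completion`). Iterating gives a claw-free, diamond-free graph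
`D` containing `G`. Every vertex of `D` lies in exactly two nodes, a node being a maximal clique or
the singleton of a simplicial vertex. So `D` is the line graph of `nodeGraph D`, and a suitable
dominating closed trail there yields a Hamiltonian cycle of `D`.

Trail or theta. Cycles of heaviest weight in the blocks of the root graph either glue to such a
trail, or one of them has an ear. An ear yields two branch nodes `A`, `B` joined by three disjoint
legs, each having at least two nodes or a single node with a neighbour outside
(`theta_or_of_twoEdgeConn`, `exists_theta_of_not_hasHamCyc`). Around each branch node this shows an
induced net of `D` (`Spider.isNet`).

Lifting. Induced paths and nets of `D` survive the undoing of a completion: at worst the hub is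
inserted, and the outer ends stay fixed (`IndPath.lift`, `IsNet.lift`). Hubs are simplicial in `D`,
which controls the nodes that contain them. So copies of the forbidden graphs appear in `G` itself
and provide heavy vertices at known places.

Counting. If `D` is not hamiltonian, it has no three pairwise nonadjacent heavy vertices
(`not_three_heavy`): in the only case that the degree sum permits, the pairwise common neighbours
form a dominating hexagon. For the path, the three outer vertices of one net are all heavy, a
contradiction. For the net and the wounded, each branch node gives three heavy vertices that are
independent in `G`; they must lie in the cliques `A` and `B`, and double counting the edges of `G`
at these six vertices refutes that (`Spider.false_of_heavy`). -/

open List in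
theorem List.IsRotated.exists_append {α : Type*} {l l' : List α} (h : l ~r l') :
    ∃ s t, l = s ++ t ∧ l' = t ++ s := by
  obtain ⟨n, hn⟩ := h
  refine ⟨l.take (n % l.length), l.drop (n % l.length), (List.take_append_drop _ _).symm, ?_⟩
  rw [← hn, List.rotate_eq_drop_append_take_mod]

open List in
theorem List.exists_isRotated_cons {α : Type*} {l : List α} {a : α} (h : a ∈ l) :
    ∃ m, l ~r a :: m := by
  obtain ⟨s, t, rfl⟩ := List.append_of_mem h
  exact ⟨t ++ s, by simpa using (List.isRotated_append (l := s) (l' := a :: t))⟩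

/-! ### Cycles as cyclic lists: insertion, domination and merging. -/

namespace ClawFree

variable {V : Type*}

/-- `l` lists the vertices of a cycle of `G` in cyclic order. -/
def IsCyc (G : SimpleGraph V) (l : List V) : Prop :=
  l.Nodup ∧ 3 ≤ l.length ∧ Cycle.Chain G.Adj (l : Cycle V)

/-- `q` follows `p` in the cyclic list `l`. -/
def ConsecIn (l : List V) (p q : V) : Prop := ∃ m, l ~r p :: q :: m

/-- `G` has a cycle through all vertices. -/
def HasHamCyc (G : SimpleGraph V) : Prop := ∃ l, IsCyc G l ∧ ∀ v, v ∈ l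

open List

theorem IsCyc.rotated {G : SimpleGraph V} {l l' : List V} (h : IsCyc G l) (hr : l ~r l') :
    IsCyc G l' := by
  refine ⟨hr.nodup_iff.1 h.1, hr.perm.length_eq ▸ h.2.1, ?_⟩
  rw [← Cycle.coe_eq_coe.2 hr]
  exact h.2.2

theorem ConsecIn.rotated {l l' : List V} {p q : V} (h : ConsecIn l p q) (hr : l ~r l') :
    ConsecIn l' p q := by
  obtain ⟨m, hm⟩ := h
  exact ⟨m, hr.symm.trans hm⟩

theorem isCyc_iff_of_cons {G : SimpleGraph V} {a : V} {l : List V} :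
    IsCyc G (a :: l) ↔
      (a :: l).Nodup ∧ 3 ≤ (a :: l).length ∧ List.IsChain G.Adj (a :: (l ++ [a])) := by
  rw [IsCyc, Cycle.chain_coe_cons]

theorem IsCyc.adj {G : SimpleGraph V} {l : List V} (h : IsCyc G l) {p q : V}
    (hpq : ConsecIn l p q) : G.Adj p q := by
  obtain ⟨m, hm⟩ := hpq
  have := (isCyc_iff_of_cons.1 (h.rotated hm)).2.2
  simp only [List.cons_append, List.isChain_cons_cons] at this
  exact this.1

theorem ConsecIn.mem {l : List V} {p q : V} (h : ConsecIn l p q) : p ∈ l ∧ q ∈ l := by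
  obtain ⟨m, hm⟩ := h
  simp [hm.mem_iff]

/-- Inserting a list between two consecutive entries keeps the other consecutive pairs. -/
theorem ConsecIn.insert {p q p' q' : V} {m w : List V} (h : ConsecIn (p :: q :: m) p' q') :
    (p' = p ∧ q' = q) ∨ ConsecIn (p :: (w ++ q :: m)) p' q' := by
  obtain ⟨m', hm⟩ := h
  obtain ⟨s, t, h1, h2⟩ := hm.exists_append
  rcases s with _ | ⟨p1, _ | ⟨q1, s⟩⟩
  · simp only [List.nil_append, List.append_nil] at h1 h2
    rw [← h1] at h2
    simp only [List.cons.injEq] at h2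
    exact Or.inl ⟨h2.1, h2.2.1⟩
  · simp only [List.cons_append, List.nil_append, List.cons.injEq] at h1
    obtain ⟨rfl, rfl⟩ := h1
    right
    rcases m with _ | ⟨b, m⟩
    · simp only [List.cons_append, List.nil_append, List.cons.injEq] at h2
      obtain ⟨rfl, rfl, rfl⟩ := h2
      refine ⟨w, ?_⟩
      have := List.isRotated_append (l := q' :: w) (l' := [p'])
      simpa using this
    · simp only [List.cons_append, List.cons.injEq] at h2
      obtain ⟨rfl, rfl, rfl⟩ := h2
      refine ⟨m ++ p :: w, ?_⟩
      have := List.isRotated_append (l := p :: w) (l' := p' :: q' :: m)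
      simpa using this
  · simp only [List.cons_append, List.cons.injEq] at h1
    obtain ⟨rfl, rfl, rfl⟩ := h1
    rcases t with _ | ⟨a, _ | ⟨b, t⟩⟩
    · simp only [List.nil_append, List.cons.injEq] at h2
      exact Or.inl ⟨h2.1, h2.2.1⟩
    · simp only [List.cons_append, List.nil_append, List.cons.injEq] at h2
      obtain ⟨rfl, rfl, rfl⟩ := h2
      refine Or.inr ⟨w ++ q :: s, ?_⟩
      have := List.isRotated_append (l := q' :: (w ++ q :: s)) (l' := [p'])
      simpa using this
    · simp only [List.cons_append, List.cons.injEq] at h2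
      obtain ⟨rfl, rfl, rfl⟩ := h2
      refine Or.inr ⟨t ++ p :: (w ++ q :: s), ?_⟩
      have := List.isRotated_append (l := p :: (w ++ q :: s)) (l' := p' :: q' :: t)
      simpa using this

theorem IsCyc.insert {G : SimpleGraph V} {p q : V} {m w : List V} (h : IsCyc G (p :: q :: m))
    (hw : w.Nodup) (hd : ∀ v ∈ w, v ∉ p :: q :: m) (hc : List.IsChain G.Adj (p :: (w ++ [q]))) :
    IsCyc G (p :: (w ++ q :: m)) := by
  rw [isCyc_iff_of_cons] at h ⊢
  obtain ⟨h1, h2, h3⟩ := h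
  refine ⟨?_, ?_, ?_⟩
  · have : (p :: (w ++ q :: m)).Perm (w ++ (p :: q :: m)) := by
      exact (List.perm_middle (l₁ := w) (l₂ := q :: m) (a := p)).symm
    rw [this.nodup_iff, List.nodup_append]
    refine ⟨hw, h1, ?_⟩
    rintro a ha b hb rfl
    exact hd a ha hb
  · simp at h2 ⊢; omega
  · simp only [List.cons_append, List.isChain_cons_cons] at h3
    have := (List.isChain_cons_split (R := G.Adj) (a := p) (l₁ := w) (c := q) (l₂ := m ++ [p])).2
      ⟨hc, h3.2⟩
    simpa using this

/-- `D` has no induced diamond: neighbourhoods are disjoint unions of cliques. -/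
def DiamondFree (D : SimpleGraph V) : Prop :=
  ∀ v a b c, D.Adj v a → D.Adj v b → D.Adj v c → D.Adj a b → D.Adj b c → a ≠ c → D.Adj a c

/-- Missing vertices are inserted one at a time between the pair they see. If another missing vertex
`z` relied on the pair that `y` has just split, diamond-freeness makes `z` adjacent to `y`, so a new
consecutive pair serves `z`. -/
theorem hasHamCyc_of_dominating [Finite V] {D : SimpleGraph V} (hD : DiamondFree D)
    {l : List V} (hl : IsCyc D l)
    (hdom : ∀ y, y ∉ l → ∃ p q, ConsecIn l p q ∧ D.Adj y p ∧ D.Adj y q) : HasHamCyc D := by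
  classical
  have := Fintype.ofFinite V
  induction hk : Fintype.card V - l.length using Nat.strong_induction_on generalizing l with
  | _ k ih =>
  by_cases hall : ∀ v, v ∈ l
  · exact ⟨l, hl, hall⟩
  push Not at hall
  obtain ⟨y, hy⟩ := hall
  obtain ⟨p, q, ⟨m, hm⟩, hp, hq⟩ := hdom y hy
  have hl' := hl.rotated hm
  have hpq : D.Adj p q := hl'.adj ⟨m, List.IsRotated.refl _⟩
  have hy' : y ∉ p :: q :: m := fun h => hy (hm.mem_iff.2 h)
  have hnew : IsCyc D (p :: ([y] ++ q :: m)) :=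
    hl'.insert (by simp) (by simpa using hy') (by simp [hp.symm, hq])
  have hlen : (p :: ([y] ++ q :: m)).length = l.length + 1 := by
    rw [hm.perm.length_eq]; simp
  have hle : (p :: ([y] ++ q :: m)).length ≤ Fintype.card V := hnew.1.length_le_card
  refine ih _ ?_ hnew ?_ rfl
  · omega
  · intro z hz
    have hzl : z ∉ l := by
      rw [hm.mem_iff]
      simp only [List.mem_cons, List.cons_append, List.nil_append] at hz ⊢
      tauto
    have hzy : z ≠ y := by
      rintro rfl
      simp at hz
    obtain ⟨p', q', hc, h1, h2⟩ := hdom z hzl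
    rcases (hc.rotated hm).insert (w := [y]) with ⟨rfl, rfl⟩ | h
    · exact ⟨p', y, ⟨q' :: m, List.IsRotated.refl _⟩, h1,
        hD p' z q' y h1.symm hpq hp.symm h2 hq.symm hzy⟩
    · exact ⟨p', q', h, h1, h2⟩

theorem exists_walk_support_eq {G : SimpleGraph V} {a b : V} {l : List V}
    (h : List.IsChain G.Adj (a :: l ++ [b])) : ∃ w : G.Walk a b, w.support = a :: l ++ [b] := by
  induction l generalizing a with
  | nil =>
    have hab : G.Adj a b := by simpa using h
    exact ⟨.cons hab .nil, by simp⟩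
  | cons c l ih =>
    simp only [List.cons_append, List.isChain_cons_cons] at h
    obtain ⟨w, hw⟩ := ih h.2
    exact ⟨.cons h.1 w, by simp [hw]⟩

theorem HasHamCyc.isHamiltonian [Fintype V] [DecidableEq V] {G : SimpleGraph V}
    (h : HasHamCyc G) : G.IsHamiltonian := by
  obtain ⟨l, hl, hall⟩ := h
  intro _
  rcases l with _ | ⟨a, _ | ⟨b, l⟩⟩
  · simp [IsCyc] at hl
  · simp [IsCyc] at hl
  obtain ⟨h1, h2, h3⟩ := isCyc_iff_of_cons.1 hl
  have hch : List.IsChain G.Adj (b :: l ++ [a]) := by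
    simp only [List.cons_append, List.isChain_cons_cons] at h3
    exact h3.2
  have hab : G.Adj a b := by
    simp only [List.cons_append, List.isChain_cons_cons] at h3
    exact h3.1
  obtain ⟨w', hsup⟩ := exists_walk_support_eq hch
  have hlen : w'.length = (b :: l ++ [a]).length - 1 := by
    rw [← hsup, SimpleGraph.Walk.length_support]; simp
  have hnd : (b :: l ++ [a]).Nodup := by
    have : (b :: l ++ [a]).Perm (a :: b :: l) := by
      simpa using (List.perm_append_comm (l₁ := b :: l) (l₂ := [a]))
    exact this.nodup_iff.2 h1
  refine ⟨a, SimpleGraph.Walk.cons hab w', ?_⟩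
  rw [SimpleGraph.Walk.isHamiltonianCycle_iff_isCycle_and_length_eq]
  constructor
  · rw [SimpleGraph.Walk.isCycle_iff_isPath_tail_and_le_length]
    refine ⟨?_, ?_⟩
    · have hp : w'.IsPath := by
        rw [SimpleGraph.Walk.isPath_def, hsup]
        exact hnd
      simpa using hp
    · simp only [SimpleGraph.Walk.length_cons, hlen]
      simp at h2 ⊢; omega
  · simp only [SimpleGraph.Walk.length_cons, hlen]
    have : (a :: b :: l).length = Fintype.card V := by
      rw [← List.toFinset_card_of_nodup h1, ← Finset.card_univ]
      congr 1
      ext v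
      simpa using hall v
    simp at this ⊢; omega

/-- Two disjoint cycles with consecutive pairs inside a common clique can be merged. -/
theorem IsCyc.merge {G : SimpleGraph V} {l₁ l₂ : List V} (h₁ : IsCyc G l₁) (h₂ : IsCyc G l₂)
    (hd : ∀ v ∈ l₁, v ∉ l₂) {p q p' q' : V} (hp : ConsecIn l₁ p q) (hp' : ConsecIn l₂ p' q')
    (hpq : G.Adj p q') (hqp : G.Adj p' q) :
    ∃ l, IsCyc G l ∧ (∀ v, v ∈ l ↔ v ∈ l₁ ∨ v ∈ l₂) ∧ ConsecIn l p q' ∧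
      (∀ a b, ConsecIn l₁ a b → (a = p ∧ b = q) ∨ ConsecIn l a b) ∧
      (∀ a b, ConsecIn l₂ a b → (a = p' ∧ b = q') ∨ ConsecIn l a b) := by
  obtain ⟨m, hm⟩ := hp
  obtain ⟨m', hm'⟩ := hp'
  have h₁' := h₁.rotated hm
  have h₂' := h₂.rotated hm'
  have hr : (q' :: m' ++ [p']) ~r (p' :: q' :: m') := by
    simpa using List.isRotated_append (l := q' :: m') (l' := [p'])
  -- Read from `p'`, the merged cycle is the second cycle with the first one inserted, so
  -- `ConsecIn.insert` applies to both.
  have hrl : (p :: ((q' :: m' ++ [p']) ++ q :: m)) ~r (p' :: ((q :: m ++ [p]) ++ q' :: m')) := by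
    have := List.isRotated_append (l := p :: q' :: m') (l' := p' :: q :: m)
    simpa using this
  have hdj : ∀ v ∈ q' :: m' ++ [p'], v ∉ p :: q :: m := by
    intro v hv hv'
    exact hd v (hm.mem_iff.2 hv') (hm'.mem_iff.2 (hr.mem_iff.1 hv))
  refine ⟨p :: ((q' :: m' ++ [p']) ++ q :: m), ?_, ?_, ?_, ?_, ?_⟩
  · refine h₁'.insert (hr.nodup_iff.2 h₂'.1) hdj ?_
    have := (isCyc_iff_of_cons.1 h₂').2.2
    simp only [List.cons_append, List.isChain_cons_cons] at this
    have h3 : List.IsChain G.Adj (q' :: (m' ++ [p', q])) := by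
      rw [List.isChain_cons_append_cons_cons]
      exact ⟨this.2, hqp, by simp⟩
    simp only [List.cons_append, List.append_assoc, List.nil_append, List.isChain_cons_cons]
    exact ⟨hpq, h3⟩
  · intro v
    rw [hm.mem_iff, hm'.mem_iff]
    simp only [List.mem_cons, List.mem_append, List.not_mem_nil, or_false, List.cons_append]
    tauto
  · exact ⟨m' ++ [p'] ++ q :: m, List.IsRotated.refl _⟩
  · intro a b hab
    exact (hab.rotated hm).insert
  · intro a b hab
    rcases (hab.rotated hm').insert (w := q :: m ++ [p]) with h | h
    · exact Or.inl h
    · exact Or.inr (h.rotated hrl.symm)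

end ClawFree

/-! ### Closing up Hamiltonian paths. -/

namespace ClawFree

variable {V : Type*}

open List

/-- `l` lists the vertices of a Hamiltonian path of `H` from `u` to `v`. -/
structure HamPath (H : SimpleGraph V) (u v : V) (l : List V) : Prop where
  nodup : l.Nodup
  all : ∀ w, w ∈ l
  chain : List.IsChain H.Adj l
  head : l.head? = some u
  last : l.getLast? = some v

theorem isCyc_of_chain {H : SimpleGraph V} {l : List V} (hn : l.Nodup) (h3 : 3 ≤ l.length)
    (hc : List.IsChain H.Adj l) (hl : ∀ a ∈ l.getLast?, ∀ b ∈ l.head?, H.Adj a b) :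
    IsCyc H l := by
  rcases l with _ | ⟨a, l⟩
  · simp at h3
  rw [isCyc_iff_of_cons]
  refine ⟨hn, h3, ?_⟩
  have : List.IsChain H.Adj ((a :: l) ++ [a]) := by
    rw [List.isChain_append]
    refine ⟨hc, by simp, ?_⟩
    intro p hp q hq
    simp only [List.head?_cons, Option.mem_def, Option.some.injEq] at hq
    subst hq
    exact hl p hp _ (by simp)
  simpa using this

theorem HamPath.reverse {H : SimpleGraph V} {u v : V} {l : List V} (h : HamPath H u v l) :
    HamPath H v u l.reverse where
  nodup := List.nodup_reverse.2 h.nodup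
  all := fun w => List.mem_reverse.2 (h.all w)
  chain := by
    rw [List.isChain_reverse]
    exact h.chain.imp fun a b hab => hab.symm
  head := by rw [List.head?_reverse, h.last]
  last := by rw [List.getLast?_reverse, h.head]

theorem chain_reverse {H : SimpleGraph V} {l : List V} (h : List.IsChain H.Adj l) :
    List.IsChain H.Adj l.reverse := by
  rw [List.isChain_reverse]
  exact h.imp fun a b hab => hab.symm

variable {H : SimpleGraph V} {u v : V}

/-- The classical exchange: go from `u` to `y`, jump to `v`, return along the path to `z`, and close
with `zu`. -/
theorem HamPath.hasHamCyc_of_next {s t : List V} {y z : V} (h : HamPath H u v (s ++ y :: t))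
    (h3 : 3 ≤ (s ++ y :: t).length) (hz : t.head? = some z) (hzu : H.Adj z u) (hyv : H.Adj y v) :
    HasHamCyc H := by
  obtain ⟨h1, h2, h4, h5, h6⟩ := h
  have hp : ((s ++ [y]).reverse ++ t).Perm (s ++ y :: t) := by
    have := (List.reverse_perm (s ++ [y])).append_right t
    simpa using this
  have hs : s ++ y :: t = (s ++ [y]) ++ t := by simp
  have htl : t.getLast? = some v := by
    rcases t with _ | ⟨t0, t⟩
    · simp at hz
    · simpa using h6
  refine ⟨(s ++ [y]).reverse ++ t, isCyc_of_chain (hp.nodup_iff.2 h1) (by rwa [hp.length_eq]) ?_ ?_,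
    fun w => hp.mem_iff.2 (h2 w)⟩
  · rw [hs, List.isChain_append] at h4
    rw [List.isChain_append]
    refine ⟨chain_reverse h4.1, h4.2.1, ?_⟩
    intro p hp' q hq
    rw [List.getLast?_reverse] at hp'
    have hpu : p = u := by
      rw [hs, List.head?_append] at h5
      rcases s with _ | ⟨s0, s⟩ <;> simp_all
    have hqz : q = z := by simpa [hz] using hq.symm
    rw [hpu, hqz]; exact hzu.symm
  · intro p hp' q hq
    have hpv : p = v := by
      rw [List.getLast?_append, htl] at hp'
      simpa using hp'.symm
    have hqy : q = y := by simpa using hq.symm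
    rw [hpv, hqy]; exact hyv.symm

theorem HamPath.hasHamCyc_of_prev {s t : List V} {y z : V} (h : HamPath H u v (s ++ y :: t))
    (h3 : 3 ≤ (s ++ y :: t).length) (hz : s.getLast? = some z) (hzv : H.Adj z v)
    (hyu : H.Adj y u) : HasHamCyc H := by
  have h' := h.reverse
  have he : (s ++ y :: t).reverse = t.reverse ++ y :: s.reverse := by simp
  rw [he] at h'
  refine h'.hasHamCyc_of_next ?_ (by rw [List.head?_reverse, hz]) hzv hyu
  simp at h3 ⊢; omega

/-- The gap `m` is moved to the end: from `u` to `y`, over to `y'`, on to `v`, then through `m` from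
`z` to `z'` and back to `u`. -/
theorem HamPath.hasHamCyc_of_cross {s m t : List V} {y y' z z' : V}
    (h : HamPath H u v (s ++ y :: (m ++ y' :: t))) (h3 : 3 ≤ (s ++ y :: (m ++ y' :: t)).length)
    (hz : m.head? = some z) (hzv : H.Adj z v) (hz' : m.getLast? = some z') (hzu : H.Adj z' u)
    (hyy : H.Adj y y') : HasHamCyc H := by
  obtain ⟨h1, h2, h4, h5, h6⟩ := h
  have hp : (s ++ y :: (y' :: t ++ m)).Perm (s ++ y :: (m ++ y' :: t)) :=
    (List.perm_append_comm.cons y).append_left s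
  refine ⟨s ++ y :: (y' :: t ++ m), isCyc_of_chain (hp.nodup_iff.2 h1) (by rwa [hp.length_eq]) ?_ ?_,
    fun w => hp.mem_iff.2 (h2 w)⟩
  · rw [List.isChain_split] at h4
    have h8 : List.IsChain H.Adj ((y :: m) ++ (y' :: t)) := by simpa using h4.2
    rw [List.isChain_append] at h8
    rw [List.isChain_split]
    refine ⟨h4.1, ?_⟩
    rw [List.cons_append, List.isChain_cons_cons]
    refine ⟨hyy, ?_⟩
    rw [← List.cons_append, List.isChain_append]
    refine ⟨h8.2.1, h8.1.tail, ?_⟩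
    intro p hp' q hq
    have : p = v := by
      rw [List.getLast?_append, List.getLast?_cons, List.getLast?_append] at h6
      simp only [List.getLast?_cons] at h6 hp'
      simp at h6 hp'
      rw [← hp', h6]
    have hq' : q = z := by simpa [hz] using hq.symm
    rw [this, hq']; exact hzv.symm
  · intro p hp' q hq
    have hpz : p = z' := by
      rw [List.getLast?_append, List.getLast?_cons, List.getLast?_append, hz'] at hp'
      simpa using hp'.symm
    have hqu : q = u := by
      rw [List.head?_append] at h5 hq
      rcases s with _ | ⟨s0, s⟩ <;> simp_all
    rw [hpz, hqu]; exact hzu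

theorem HamPath.reroute {s m t : List V} {y y' z z' : V}
    (h : HamPath H u v (s ++ y :: (m ++ y' :: t)))
    (hz : m.head? = some z) (hzy : H.Adj z y') (hz' : m.getLast? = some z') (hzy' : H.Adj y z') :
    HamPath H u v (s ++ y :: (m.reverse ++ y' :: t)) := by
  obtain ⟨h1, h2, h4, h5, h6⟩ := h
  have hp : (s ++ y :: (m.reverse ++ y' :: t)).Perm (s ++ y :: (m ++ y' :: t)) :=
    (((List.reverse_perm m).append_right _).cons y).append_left s
  refine ⟨hp.nodup_iff.2 h1, fun w => hp.mem_iff.2 (h2 w), ?_, ?_, ?_⟩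
  · rw [List.isChain_split] at h4 ⊢
    refine ⟨h4.1, ?_⟩
    have h8 : List.IsChain H.Adj ((y :: m) ++ (y' :: t)) := by simpa using h4.2
    rw [List.isChain_append] at h8
    have h9 : List.IsChain H.Adj (m.reverse ++ (y' :: t)) := by
      rw [List.isChain_append]
      refine ⟨chain_reverse h8.1.tail, h8.2.1, ?_⟩
      intro p hp' q hq
      rw [List.getLast?_reverse, hz] at hp'
      simp at hp' hq
      rw [← hp', ← hq]; exact hzy
    rw [List.isChain_cons]
    refine ⟨?_, h9⟩
    intro q hq
    rw [List.head?_append, List.head?_reverse, hz'] at hq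
    simp at hq
    rw [← hq]; exact hzy'
  · rw [← h5]
    rcases s with _ | ⟨s0, s⟩ <;> simp
  · rw [← h6]
    simp [List.getLast?_append, List.getLast?_cons]

theorem HamPath.left_ne {s t : List V} {y : V} (h : HamPath H u v (s ++ y :: t)) (hy : y ≠ u) :
    ∀ z ∈ y :: t, z ≠ u := by
  rcases s with _ | ⟨s0, s⟩
  · have := h.head
    simp at this
    exact absurd this hy
  · have h1 := h.head
    have h2 := h.nodup
    simp only [List.cons_append, List.head?_cons, Option.some.injEq] at h1
    subst h1
    rw [List.cons_append, List.nodup_cons] at h2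
    rintro z hz rfl
    exact h2.1 (List.mem_append_right _ hz)

theorem HamPath.right_ne {s t : List V} {y : V} (h : HamPath H u v (s ++ y :: t)) (hy : y ≠ v) :
    ∀ z ∈ s ++ [y], z ≠ v := by
  have h' := h.reverse
  have he : (s ++ y :: t).reverse = t.reverse ++ y :: s.reverse := by simp
  rw [he] at h'
  intro z hz
  refine h'.left_ne hy z ?_
  simp at hz ⊢
  tauto

/-- `z` is equal or adjacent to one of `u`, `v`. -/
def NearPair (H : SimpleGraph V) (u v z : V) : Prop := z = u ∨ z = v ∨ H.Adj z u ∨ H.Adj z v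

/-- The ends of the gap are interior to the path, so each of them is adjacent to `u` or to `v`. If
the first sees `u`, or the last sees `v`, an exchange at `y` or at `y'` closes the path; otherwise
the crossing does. -/
theorem HamPath.hasHamCyc_of_near {s m t : List V} {y y' : V}
    (h : HamPath H u v (s ++ y :: (m ++ y' :: t)))
    (hyu : H.Adj y u) (hyv : H.Adj y v) (hyu' : H.Adj y' u) (hyv' : H.Adj y' v)
    (hyy : H.Adj y y') (h1 : ∀ z ∈ m.head?, NearPair H u v z)
    (h2 : ∀ z ∈ m.getLast?, NearPair H u v z) : HasHamCyc H := by
  have hs : s ≠ [] := by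
    rintro rfl
    have := h.head
    simp at this
    exact hyu.ne this
  have h3 : 3 ≤ (s ++ y :: (m ++ y' :: t)).length := by
    have := List.length_pos_of_ne_nil hs
    simp; omega
  rcases hm : m.head? with _ | z
  · have : m = [] := by simpa using hm
    subst this
    exact h.hasHamCyc_of_next h3 (z := y') (by simp) hyu' hyv
  have hmne : m ≠ [] := by rintro rfl; simp at hm
  obtain ⟨z', hz'⟩ : ∃ z', m.getLast? = some z' := ⟨m.getLast hmne, List.getLast?_eq_getLast_of_ne_nil hmne⟩
  have hzm : z ∈ m := List.mem_of_head? hm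
  have hzm' : z' ∈ m := List.mem_of_getLast? hz'
  have hl := h.left_ne hyu.ne
  have h' : HamPath H u v ((s ++ y :: m) ++ y' :: t) := by simpa using h
  have hr := h'.right_ne hyv'.ne
  rcases h1 z hm with e | e | e | e
  · exact absurd e (hl z (by simp [hzm]))
  · exact absurd e (hr z (by simp [hzm]))
  · exact h.hasHamCyc_of_next h3 (z := z) (by simp [hm]) e hyv
  rcases h2 z' hz' with e' | e' | e' | e'
  · exact absurd e' (hl z' (by simp [hzm']))
  · exact absurd e' (hr z' (by simp [hzm']))
  · exact h.hasHamCyc_of_cross h3 hm e hz' e' hyy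
  · refine h'.hasHamCyc_of_prev (by simpa using h3) (z := z') ?_ e' hyu'
    simp [List.getLast?_append, List.getLast?_cons, hz']

theorem _root_.List.exists_split_pair {l : List V} {a b : V} (ha : a ∈ l) (hb : b ∈ l)
    (hab : a ≠ b) :
    (∃ s m t, l = s ++ a :: (m ++ b :: t)) ∨ (∃ s m t, l = s ++ b :: (m ++ a :: t)) := by
  obtain ⟨s, t, rfl⟩ := List.append_of_mem ha
  simp only [List.mem_append, List.mem_cons] at hb
  rcases hb with hb | hb | hb
  · obtain ⟨s', t', rfl⟩ := List.append_of_mem hb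
    exact Or.inr ⟨s', t', t, by simp⟩
  · exact absurd hb.symm hab
  · obtain ⟨s', t', rfl⟩ := List.append_of_mem hb
    exact Or.inl ⟨s, s', t', rfl⟩

theorem HamPath.adj_gap {s m t : List V} {y y' : V} (h : HamPath H u v (s ++ y :: (m ++ y' :: t))) :
    (∀ z ∈ m.head?, H.Adj y z) ∧ (∀ z ∈ m.getLast?, H.Adj y' z) := by
  have hc := h.chain
  rw [List.isChain_split] at hc
  have h8 : List.IsChain H.Adj ((y :: m) ++ (y' :: t)) := by simpa using hc.2
  rw [List.isChain_append, List.isChain_cons] at h8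
  refine ⟨h8.1.1, fun z hz => (h8.2.2 z ?_ y' (by simp)).symm⟩
  rw [List.getLast?_cons]
  simp only [Option.mem_def] at hz ⊢
  simp [hz]

/-- The ends of the gap between `y` and `y'` are neighbours of `y` and `y'`, hence near. This makes
an edge `uv` dispensable when two adjacent common neighbours see nothing far from `u` and `v`. -/
theorem HamPath.hasHamCyc_of_pair {l : List V} {y y' : V} (h : HamPath H u v l)
    (hyu : H.Adj y u) (hyv : H.Adj y v) (hyu' : H.Adj y' u) (hyv' : H.Adj y' v)
    (hyy : H.Adj y y') (h1 : ∀ z, H.Adj y z → NearPair H u v z)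
    (h2 : ∀ z, H.Adj y' z → NearPair H u v z) : HasHamCyc H := by
  rcases List.exists_split_pair (h.all y) (h.all y') hyy.ne with ⟨s, m, t, rfl⟩ | ⟨s, m, t, rfl⟩
  · obtain ⟨k1, k2⟩ := h.adj_gap
    exact h.hasHamCyc_of_near hyu hyv hyu' hyv' hyy (fun z hz => h1 z (k1 z hz))
      (fun z hz => h2 z (k2 z hz))
  · obtain ⟨k1, k2⟩ := h.adj_gap
    exact h.hasHamCyc_of_near hyu' hyv' hyu hyv hyy.symm (fun z hz => h2 z (k1 z hz))
      (fun z hz => h1 z (k2 z hz))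

theorem HamPath.length_ge {s t : List V} {y : V} (h : HamPath H u v (s ++ y :: t))
    (hu : y ≠ u) (hv : y ≠ v) : 3 ≤ (s ++ y :: t).length := by
  have hs : s ≠ [] := by
    rintro rfl
    have := h.head
    simp at this
    exact hu this
  have ht : t ≠ [] := by
    rintro rfl
    have := h.last
    simp at this
    exact hv this
  have := List.length_pos_of_ne_nil hs
  have := List.length_pos_of_ne_nil ht
  simp; omega

/-- Unless a gap ending at `x` already closes the path, the successors `z`, `z'` of `w`, `w'` are
far from `u` and `v`, so they are adjacent by `hw` and `hb`. Reversing the stretch from `z` to `w'`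
makes `w'` follow `w`, and the exchange applies. -/
theorem HamPath.hasHamCyc_of_triple_aux₁ {s m₁ m₂ t : List V} {x w w' : V}
    (h : HamPath H u v (s ++ w :: (m₁ ++ w' :: (m₂ ++ x :: t))))
    (hxu : H.Adj x u) (hxv : H.Adj x v) (hwu : H.Adj w u) (hwv : H.Adj w v)
    (hwu' : H.Adj w' u) (hwv' : H.Adj w' v) (hxw : H.Adj x w) (hxw' : H.Adj x w')
    (hww : H.Adj w w') (hx : ∀ z, H.Adj x z → NearPair H u v z)
    (hw : ∀ z, ¬ NearPair H u v z → (H.Adj w z ↔ H.Adj w' z))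
    (hb : ∀ z z', ¬ NearPair H u v z → ¬ NearPair H u v z' → H.Adj w z → H.Adj w z' → z ≠ z' →
      H.Adj z z') : HasHamCyc H := by
  have e1 : s ++ w :: (m₁ ++ w' :: (m₂ ++ x :: t)) = s ++ w :: ((m₁ ++ w' :: m₂) ++ x :: t) := by
    simp
  have e2 : s ++ w :: (m₁ ++ w' :: (m₂ ++ x :: t)) = (s ++ w :: m₁) ++ w' :: (m₂ ++ x :: t) := by
    simp
  have h1 := e1 ▸ h
  have h2 := e2 ▸ h
  have nd := h.nodup
  by_cases c1 : ∀ z ∈ (m₁ ++ w' :: m₂).head?, NearPair H u v z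
  · exact h1.hasHamCyc_of_near hwu hwv hxu hxv hxw.symm c1 (fun z hz => hx z (h1.adj_gap.2 z hz))
  by_cases c2 : ∀ z ∈ m₂.head?, NearPair H u v z
  · exact h2.hasHamCyc_of_near hwu' hwv' hxu hxv hxw'.symm c2 (fun z hz => hx z (h2.adj_gap.2 z hz))
  push Not at c1 c2
  obtain ⟨z, hz, hzn⟩ := c1
  obtain ⟨z', hz', hzn'⟩ := c2
  have hzm : m₁.head? = some z := by
    rcases m₁ with _ | ⟨z0, m₁⟩
    · simp at hz
      subst hz
      exact absurd (Or.inr (Or.inr (Or.inl hwu'))) hzn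
    · simpa using hz
  have a1 : H.Adj w z := h1.adj_gap.1 z hz
  have a2 : H.Adj w' z' := h2.adj_gap.1 z' hz'
  have a3 : H.Adj w z' := (hw z' hzn').2 a2
  have hne : z ≠ z' := by
    rintro rfl
    have m1 : z ∈ m₁ := List.mem_of_head? hzm
    have m2 : z ∈ m₂ := List.mem_of_head? hz'
    have := nd.sublist (List.sublist_append_right s _)
    rw [List.nodup_cons, List.nodup_append] at this
    exact this.2.2.2 z m1 z (by simp [m2]) rfl
  have a4 := hb z z' hzn hzn' a1 a3 hne
  rcases m₂ with _ | ⟨z0, m₂⟩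
  · simp at hz'
  simp only [List.head?_cons, Option.mem_def, Option.some.injEq] at hz'
  subst hz'
  have h3 : HamPath H u v (s ++ w :: ((m₁ ++ [w']) ++ z0 :: (m₂ ++ x :: t))) := by simpa using h
  have h4 := h3.reroute (z := z) (z' := w') (by simp [hzm]) a4 (by simp) hww
  exact h4.hasHamCyc_of_next (h4.length_ge hwu.ne hwv.ne) (z := w') (by simp) hwu' hwv

/-- If neither gap at `x` closes the path, the whole stretch between `w` and `w'` can be reversed.
The vertex `g` after `x` is near: if it sees `u`, the original path closes at `x`; if it sees `v`,
the reversed one does, since there `g` precedes `x`. -/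
theorem HamPath.hasHamCyc_of_triple_aux₂ {s m₁ m₂ t : List V} {x w w' : V}
    (h : HamPath H u v (s ++ w :: (m₁ ++ x :: (m₂ ++ w' :: t))))
    (hxu : H.Adj x u) (hxv : H.Adj x v) (hwu : H.Adj w u) (hwv : H.Adj w v)
    (hwu' : H.Adj w' u) (hwv' : H.Adj w' v) (hxw : H.Adj x w) (hxw' : H.Adj x w')
    (hx : ∀ z, H.Adj x z → NearPair H u v z)
    (hw : ∀ z, ¬ NearPair H u v z → (H.Adj w z ↔ H.Adj w' z)) : HasHamCyc H := by
  have e2 : s ++ w :: (m₁ ++ x :: (m₂ ++ w' :: t)) = (s ++ w :: m₁) ++ x :: (m₂ ++ w' :: t) := by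
    simp
  have h2 := e2 ▸ h
  by_cases c1 : ∀ z ∈ m₁.head?, NearPair H u v z
  · exact h.hasHamCyc_of_near hwu hwv hxu hxv hxw.symm c1 (fun z hz => hx z (h.adj_gap.2 z hz))
  by_cases c2 : ∀ z ∈ m₂.getLast?, NearPair H u v z
  · exact h2.hasHamCyc_of_near hxu hxv hwu' hwv' hxw' (fun z hz => hx z (h2.adj_gap.1 z hz)) c2
  push Not at c1 c2
  obtain ⟨z, hz, hzn⟩ := c1
  obtain ⟨z', hz', hzn'⟩ := c2
  have a1 : H.Adj w' z := (hw z hzn).1 (h.adj_gap.1 z hz)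
  have a2 : H.Adj w z' := (hw z' hzn').2 (h2.adj_gap.2 z' hz')
  have h3 : HamPath H u v (s ++ w :: ((m₁ ++ x :: m₂) ++ w' :: t)) := by simpa using h
  have hz'' : m₂.getLast? = some z' := hz'
  have h4 := h3.reroute (z := z) (z' := z')
    (by rw [List.head?_append, show m₁.head? = some z from hz]; rfl) a1.symm
    (by simp [List.getLast?_append, List.getLast?_cons, hz'']) a2
  rcases m₂ with _ | ⟨g, m₂⟩
  · simp at hz'
  have hgx : H.Adj x g := h2.adj_gap.1 g (by simp)
  have hgu : g ≠ u := h2.left_ne hxu.ne g (by simp)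
  have h5 : HamPath H u v ((s ++ w :: m₁ ++ x :: (g :: m₂)) ++ w' :: t) := by simpa using h
  have hgv : g ≠ v := h5.right_ne hwv'.ne g (by simp)
  rcases hx g hgx with e | e | e | e
  · exact absurd e hgu
  · exact absurd e hgv
  · exact h2.hasHamCyc_of_next (h2.length_ge hxu.ne hxv.ne) (z := g) (by simp) e hxv
  · have h6 : HamPath H u v ((s ++ w :: (m₂.reverse ++ [g])) ++ x :: (m₁.reverse ++ w' :: t)) := by
      simpa using h4
    exact h6.hasHamCyc_of_prev (h6.length_ge hxu.ne hxv.ne) (z := g)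
      (by simp [List.getLast?_append, List.getLast?_cons]) e hxu

theorem NearPair.symm {z : V} (h : NearPair H u v z) : NearPair H v u z := by
  unfold NearPair at *; tauto

/-- Up to exchanging `w` with `w'` and reversing the path, only the position of `x` matters: outside
the stretch from `w` to `w'`, or inside it. -/
theorem HamPath.hasHamCyc_of_triple {l : List V} {x w w' : V} (h : HamPath H u v l)
    (hxu : H.Adj x u) (hxv : H.Adj x v) (hwu : H.Adj w u) (hwv : H.Adj w v)
    (hwu' : H.Adj w' u) (hwv' : H.Adj w' v) (hxw : H.Adj x w) (hxw' : H.Adj x w')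
    (hww : H.Adj w w') (hx : ∀ z, H.Adj x z → NearPair H u v z)
    (hw : ∀ z, ¬ NearPair H u v z → (H.Adj w z ↔ H.Adj w' z))
    (hb : ∀ z z', ¬ NearPair H u v z → ¬ NearPair H u v z' → H.Adj w z → H.Adj w z' → z ≠ z' →
      H.Adj z z') : HasHamCyc H := by
  have hx' : ∀ z, H.Adj x z → NearPair H v u z := fun z hz => (hx z hz).symm
  have hw2 : ∀ z, ¬ NearPair H v u z → (H.Adj w z ↔ H.Adj w' z) :=
    fun z hz => hw z fun hh => hz hh.symm
  have hb2 : ∀ z z', ¬ NearPair H u v z → ¬ NearPair H u v z' → H.Adj w' z → H.Adj w' z' → z ≠ z' →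
      H.Adj z z' := fun z z' k1 k2 k3 k4 => hb z z' k1 k2 ((hw z k1).2 k3) ((hw z' k2).2 k4)
  have main : ∀ {w w' : V}, (∃ s m t, l = s ++ w :: (m ++ w' :: t)) →
      H.Adj w u → H.Adj w v → H.Adj w' u → H.Adj w' v → H.Adj x w → H.Adj x w' → H.Adj w w' →
      (∀ z, ¬ NearPair H u v z → (H.Adj w z ↔ H.Adj w' z)) →
      (∀ z z', ¬ NearPair H u v z → ¬ NearPair H u v z' → H.Adj w z → H.Adj w z' → z ≠ z' →
      H.Adj z z') → HasHamCyc H := by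
    rintro w w' ⟨s, m, t, rfl⟩ hwu hwv hwu' hwv' hxw hxw' hww hw hb
    have hmem := h.all x
    simp only [List.mem_append, List.mem_cons] at hmem
    rcases hmem with hm | hm | hm | hm | hm
    · obtain ⟨s1, s2, rfl⟩ := List.append_of_mem hm
      have hr := h.reverse
      have h' : HamPath H v u (t.reverse ++ w' :: (m.reverse ++ w :: (s2.reverse ++ x :: s1.reverse))) := by
        simpa using hr
      refine h'.hasHamCyc_of_triple_aux₁ hxv hxu hwv' hwu' hwv hwu hxw' hxw hww.symm hx'
        (fun z hz => (hw z fun hh => hz hh.symm).symm) ?_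
      intro z z' k1 k2 k3 k4
      have k1' : ¬ NearPair H u v z := fun hh => k1 hh.symm
      have k2' : ¬ NearPair H u v z' := fun hh => k2 hh.symm
      exact hb z z' k1' k2' ((hw z k1').2 k3) ((hw z' k2').2 k4)
    · exact absurd hm hxw.ne
    · obtain ⟨s1, s2, rfl⟩ := List.append_of_mem hm
      have h' : HamPath H u v (s ++ w :: (s1 ++ x :: (s2 ++ w' :: t))) := by simpa using h
      exact h'.hasHamCyc_of_triple_aux₂ hxu hxv hwu hwv hwu' hwv' hxw hxw' hx hw
    · exact absurd hm hxw'.ne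
    · obtain ⟨s1, s2, rfl⟩ := List.append_of_mem hm
      exact h.hasHamCyc_of_triple_aux₁ hxu hxv hwu hwv hwu' hwv' hxw hxw' hww hx hw hb
  rcases List.exists_split_pair (h.all w) (h.all w') hww.ne with hs | hs
  · exact main hs hwu hwv hwu' hwv' hxw hxw' hww hw hb
  · exact main hs hwu' hwv' hwu hwv hxw' hxw hww.symm (fun z hz => (hw z hz).symm) hb2

end ClawFree

/-! ### Local completion and hamiltonicity. -/

namespace ClawFree

variable {V : Type*}

open List

theorem isCyc_of_consecIn {G : SimpleGraph V} {l : List V} (hn : l.Nodup) (h3 : 3 ≤ l.length)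
    (h : ∀ p q, ConsecIn l p q → G.Adj p q) : IsCyc G l := by
  rcases l with _ | ⟨a, l⟩
  · simp at h3
  rw [isCyc_iff_of_cons]
  refine ⟨hn, h3, ?_⟩
  have hl : l ≠ [] := by rintro rfl; simp at h3
  rw [List.isChain_iff_forall_rel_of_append_cons_cons]
  intro p q s t he
  apply h
  rcases List.eq_nil_or_concat t with rfl | ⟨t, b, rfl⟩
  · rcases s with _ | ⟨s0, s⟩
    · have := congrArg List.length he
      simp at this
      exact absurd this hl
    · have he' : a :: l ++ [a] = (s0 :: s ++ [p]) ++ [q] := by simpa using he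
      have h1 := List.append_inj' he' rfl
      simp only [List.cons_append, List.cons.injEq, and_true] at h1
      obtain ⟨⟨rfl, rfl⟩, h2⟩ := h1
      refine ⟨s, ?_⟩
      rw [← h2]
      have := List.isRotated_append (l := a :: s) (l' := [p])
      simpa using this
  · have he' : a :: l ++ [a] = (s ++ p :: q :: t) ++ [b] := by simpa using he
    have h1 := List.append_inj' he' rfl
    rw [h1.1]
    refine ⟨t ++ s, ?_⟩
    have := List.isRotated_append (l := s) (l' := p :: q :: t)
    simpa using this

theorem hasHamCyc_or_hamPath_of_edge {H H' : SimpleGraph V} {u v : V}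
    (hH : ∀ a b, H'.Adj a b → H.Adj a b ∨ (a = u ∧ b = v) ∨ (a = v ∧ b = u))
    (h : HasHamCyc H') : HasHamCyc H ∨ (∃ l, HamPath H u v l) ∨ (∃ l, HamPath H v u l) := by
  obtain ⟨L, hL, hall⟩ := h
  have key : ∀ u v, (∀ a b, H'.Adj a b → H.Adj a b ∨ (a = u ∧ b = v) ∨ (a = v ∧ b = u)) →
      ConsecIn L u v → ∃ l, HamPath H v u l := by
    rintro u v hH ⟨m, hm⟩
    have hL' := hL.rotated hm
    have hr : (u :: v :: m) ~r (v :: m ++ [u]) := by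
      simpa using List.isRotated_append (l := [u]) (l' := v :: m)
    have hL'' := hL'.rotated hr
    have hnd := hL''.1
    have hlen := hL''.2.1
    have hch : List.IsChain H'.Adj (v :: m ++ [u]) := by
      have := (isCyc_iff_of_cons.1 hL').2.2
      simp only [List.cons_append, List.isChain_cons_cons] at this
      simpa using this.2
    refine ⟨v :: m ++ [u], hnd, fun w => ?_, ?_, by simp, List.getLast?_concat⟩
    · rw [← hr.mem_iff, ← hm.mem_iff]; exact hall w
    · have hum : u ∉ v :: m := (List.nodup_cons.1 hL'.1).1
      rw [List.isChain_append] at hch ⊢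
      refine ⟨?_, by simp, ?_⟩
      · refine hch.1.imp_of_mem_imp ?_
        intro a b ha hb hab
        rcases hH a b hab with h | ⟨rfl, rfl⟩ | ⟨rfl, rfl⟩
        · exact h
        · exact absurd ha hum
        · exact absurd hb hum
      · intro p hp q hq
        have hqu : q = u := by simpa using hq.symm
        subst hqu
        rcases hH _ _ (hch.2.2 p hp q hq) with h | ⟨rfl, rfl⟩ | ⟨rfl, h⟩
        · exact h
        · exact absurd (List.mem_of_getLast? hp) hum
        -- In this case the last vertex before `u` would be `v`. A cycle has at least three
        -- vertices, so `v` would be repeated.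
        · rcases m with _ | ⟨m0, m⟩
          · simp at hlen
          · have hp' : p ∈ m0 :: m := by
              rw [List.getLast?_cons_cons] at hp
              exact List.mem_of_getLast? hp
            have := (List.nodup_cons.1 (List.nodup_cons.1 hL'.1).2).1
            exact absurd hp' this
  by_cases c1 : ConsecIn L u v
  · exact Or.inr (Or.inr (key u v hH c1))
  by_cases c2 : ConsecIn L v u
  · refine Or.inr (Or.inl (key v u (fun a b hab => ?_) c2))
    rcases hH a b hab with h | h | h
    · exact Or.inl h
    · exact Or.inr (Or.inr h)
    · exact Or.inr (Or.inl h)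
  refine Or.inl ⟨L, isCyc_of_consecIn hL.1 hL.2.1 ?_, hall⟩
  intro p q hpq
  rcases hH p q (hL.adj hpq) with h | ⟨rfl, rfl⟩ | ⟨rfl, rfl⟩
  · exact h
  · exact absurd hpq c1
  · exact absurd hpq c2

/-- If every missing edge between `A` and `B` can be dispensed with, hamiltonicity descends. -/
theorem hasHamCyc_descend [Finite V] {A B : SimpleGraph V}
    (h : ∀ H : SimpleGraph V, A ≤ H → H ≤ B → ∀ u v l, ¬ H.Adj u v → B.Adj u v →
      HamPath H u v l → HasHamCyc H) {H : SimpleGraph V} (hA : A ≤ H) (hB : H ≤ B)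
    (hH : HasHamCyc H) : HasHamCyc A := by
  induction hk : {p : V × V | H.Adj p.1 p.2 ∧ ¬ A.Adj p.1 p.2}.ncard using Nat.strong_induction_on
    generalizing H with
  | _ k ih =>
  by_cases hle : H ≤ A
  · exact le_antisymm hle hA ▸ hH
  obtain ⟨u, v, huv, huvA⟩ : ∃ u v, H.Adj u v ∧ ¬ A.Adj u v := by
    by_contra hcon
    push Not at hcon
    exact hle fun a b hab => hcon a b hab
  let H₀ := H.deleteEdges {s(u, v)}
  have hadj : ∀ a b, H₀.Adj a b ↔ H.Adj a b ∧ ¬ (s(a, b) = s(u, v)) := by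
    intro a b; simp [H₀, SimpleGraph.deleteEdges_adj]
  have hA₀ : A ≤ H₀ := by
    intro a b hab
    rw [hadj]
    refine ⟨hA hab, fun he => ?_⟩
    rcases Sym2.eq_iff.1 he with ⟨rfl, rfl⟩ | ⟨rfl, rfl⟩
    · exact huvA hab
    · exact huvA hab.symm
  have hB₀ : H₀ ≤ B := fun a b hab => hB ((hadj a b).1 hab).1
  have hH₀ : HasHamCyc H₀ := by
    have hn : ¬ H₀.Adj u v := fun hh => ((hadj u v).1 hh).2 rfl
    have hE : ∀ a b, H.Adj a b → H₀.Adj a b ∨ (a = u ∧ b = v) ∨ (a = v ∧ b = u) := by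
      intro a b hab
      by_cases he : s(a, b) = s(u, v)
      · exact Or.inr (Sym2.eq_iff.1 he)
      · exact Or.inl ((hadj a b).2 ⟨hab, he⟩)
    rcases hasHamCyc_or_hamPath_of_edge hE hH with h' | ⟨l, hl⟩ | ⟨l, hl⟩
    · exact h'
    · exact h H₀ hA₀ hB₀ u v l hn (hB huv) hl
    · exact h H₀ hA₀ hB₀ v u l (fun hh => hn hh.symm) (hB huv.symm) hl
  refine ih _ ?_ hA₀ hB₀ hH₀ rfl
  rw [← hk]
  refine Set.ncard_lt_ncard ?_ (Set.toFinite _)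
  refine ⟨fun p hp => ⟨((hadj _ _).1 hp.1).1, hp.2⟩, fun hsub => ?_⟩
  have : (u, v) ∈ {p : V × V | H₀.Adj p.1 p.2 ∧ ¬ A.Adj p.1 p.2} := hsub ⟨huv, huvA⟩
  exact ((hadj u v).1 this.1).2 rfl

/-- No vertex has three pairwise nonadjacent neighbours. -/
def NoClaw (G : SimpleGraph V) : Prop :=
  ∀ c x y z, G.Adj c x → G.Adj c y → G.Adj c z → x ≠ y → y ≠ z → x ≠ z →
    G.Adj x y ∨ G.Adj y z ∨ G.Adj x z

/-- An induced embedding from a graph on `Fin n`, checked on increasing pairs. -/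
def embeddingOfLt {n : ℕ} {H : SimpleGraph (Fin n)} {G : SimpleGraph V} (f : Fin n → V)
    (hne : ∀ i j, i < j → f i ≠ f j) (hadj : ∀ i j, i < j → (G.Adj (f i) (f j) ↔ H.Adj i j)) :
    H ↪g G where
  toFun := f
  inj' := by
    intro i j hij
    rcases lt_trichotomy i j with h | h | h
    · exact absurd hij (hne i j h)
    · exact h
    · exact absurd hij.symm (hne j i h)
  map_rel_iff' := by
    intro i j
    change G.Adj (f i) (f j) ↔ H.Adj i j
    rcases lt_trichotomy i j with h | h | h
    · exact hadj i j h
    · subst h; simp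
    · rw [G.adj_comm, H.adj_comm]; exact hadj j i h

theorem noClaw_of_isClawFree {G : SimpleGraph V} (h : IsClawFree G) : NoClaw G := by
  intro c x y z hx hy hz hxy hyz hxz
  by_contra hcon
  push Not at hcon
  obtain ⟨h1, h2, h3⟩ := hcon
  apply h
  refine ⟨embeddingOfLt ![c, x, y, z] ?_ ?_⟩
  · intro i j hij
    fin_cases i <;> fin_cases j <;>
      first
      | exact absurd hij (by decide)
      | simp [hx.ne, hy.ne, hz.ne, hxy, hyz, hxz]
  · intro i j hij
    fin_cases i <;> fin_cases j <;>
      first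
      | exact absurd hij (by decide)
      | simp [clawGraph, SimpleGraph.starGraph_adj, hx, hy, hz, h1, h2, h3]

/-- `v` lies in the closed neighbourhood of `x`. -/
def InBall (G : SimpleGraph V) (x v : V) : Prop := v = x ∨ G.Adj x v

/-- The local completion of `G` at `x`: the closed neighbourhood of `x` becomes a clique. -/
def completion (G : SimpleGraph V) (x : V) : SimpleGraph V where
  Adj a b := a ≠ b ∧ (G.Adj a b ∨ (InBall G x a ∧ InBall G x b))
  symm := ⟨fun _ _ h => ⟨h.1.symm, h.2.imp (fun h => h.symm) And.symm⟩⟩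
  loopless := ⟨fun _ h => h.1 rfl⟩

theorem le_completion (G : SimpleGraph V) (x : V) : G ≤ completion G x :=
  fun _ _ h => ⟨h.ne, Or.inl h⟩

theorem InBall.adj_completion {G : SimpleGraph V} {x a b : V} (ha : InBall G x a)
    (hb : InBall G x b) (hab : a ≠ b) : (completion G x).Adj a b := ⟨hab, Or.inr ⟨ha, hb⟩⟩

theorem completion_adj_self {G : SimpleGraph V} {x a : V} (h : (completion G x).Adj x a) :
    G.Adj x a := by
  rcases h.2 with h' | ⟨-, h' | h'⟩
  · exact h'
  · exact absurd h'.symm h.1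
  · exact h'

/-- If a claw edge `wp` were new, both ends would lie in the ball of `x`, so the leaves `q`, `r`
would not, and `x`, `q`, `r` would be the leaves of a claw at `w` in `G`. So all three edges are
old, and the claw is one of `G`. -/
theorem NoClaw.completion {G : SimpleGraph V} (hG : NoClaw G) (x : V) :
    NoClaw (completion G x) := by
  intro w p q r hp hq hr hpq hqr hpr
  by_contra hcon
  push Not at hcon
  obtain ⟨h1, h2, h3⟩ := hcon
  have key : ∀ p q r, (ClawFree.completion G x).Adj w p → (ClawFree.completion G x).Adj w q →
      (ClawFree.completion G x).Adj w r → p ≠ q → q ≠ r → p ≠ r →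
      ¬ (ClawFree.completion G x).Adj p q → ¬ (ClawFree.completion G x).Adj q r →
      ¬ (ClawFree.completion G x).Adj p r → G.Adj w p := by
    intro p q r hp hq hr hpq hqr hpr h1 h2 h3
    rcases hp.2 with h | ⟨hw, hbp⟩
    · exact h
    have hbq : ¬ InBall G x q := fun h => h1 (hbp.adj_completion h hpq)
    have hbr : ¬ InBall G x r := fun h => h3 (hbp.adj_completion h hpr)
    have hwq : G.Adj w q := hq.2.resolve_right fun h => hbq h.2
    have hwr : G.Adj w r := hr.2.resolve_right fun h => hbr h.2
    rcases hw with rfl | hw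
    · exact absurd (Or.inr hwq) hbq
    · rcases hG w x q r hw.symm hwq hwr (fun h => hbq (Or.inl h.symm)) hqr
        (fun h => hbr (Or.inl h.symm)) with h | h | h
      · exact absurd (Or.inr h) hbq
      · exact absurd (le_completion G x h) h2
      · exact absurd (Or.inr h) hbr
  have a1 := key p q r hp hq hr hpq hqr hpr h1 h2 h3
  have a2 := key q r p hq hr hp hqr hpr.symm hpq.symm h2 (fun h => h3 h.symm) (fun h => h1 h.symm)
  have a3 := key r p q hr hp hq hpr.symm hpq hqr.symm (fun h => h3 h.symm) h1 (fun h => h2 h.symm)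
  rcases hG w p q r a1 a2 a3 hpq hqr hpr with h | h | h
  · exact h1 (le_completion G x h)
  · exact h2 (le_completion G x h)
  · exact h3 (le_completion G x h)

/-- Join the pairs of neighbours of `x` that have a common neighbour in the neighbourhood of `x`. -/
def halfCompletion (G : SimpleGraph V) (x : V) : SimpleGraph V where
  Adj a b := G.Adj a b ∨ (a ≠ b ∧ G.Adj x a ∧ G.Adj x b ∧ ∃ y, G.Adj x y ∧ G.Adj y a ∧ G.Adj y b)
  symm := ⟨fun _ _ h => h.imp (fun h => h.symm)
    fun ⟨h1, h2, h3, y, h4, h5, h6⟩ => ⟨h1.symm, h3, h2, y, h4, h6, h5⟩⟩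
  loopless := ⟨fun _ h => h.elim (fun h => h.ne rfl) fun h => h.1 rfl⟩

/-- The new edges are given up in two rounds, with `halfCompletion` in between. An edge `uv` of the
first round has no common neighbour inside the neighbourhood of `x` and is handled by a triple; one
of the second round has such a neighbour and is handled by a pair. -/
theorem hasHamCyc_of_completion [Finite V] {G : SimpleGraph V} (hG : NoClaw G) {x a b c : V}
    (hxa : G.Adj x a) (hxb : G.Adj x b) (hxc : G.Adj x c) (hab : G.Adj a b) (hbc : G.Adj b c)
    (hac : ¬ G.Adj a c) (hne : a ≠ c) (h : HasHamCyc (completion G x)) : HasHamCyc G := by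
  have hle1 : G ≤ halfCompletion G x := fun _ _ h => Or.inl h
  have hle2 : halfCompletion G x ≤ completion G x := by
    rintro p q (h | ⟨h1, h2, h3, -⟩)
    · exact le_completion G x h
    · exact ⟨h1, Or.inr ⟨Or.inr h2, Or.inr h3⟩⟩
  have hball : ∀ H : SimpleGraph V, G ≤ H → ∀ u v, G.Adj x u → G.Adj x v → u ≠ v → ¬ G.Adj u v →
      ∀ z, InBall G x z → NearPair H u v z := by
    rintro H hGH u v hu hv huv hnuv z (rfl | hz)
    · exact Or.inr (Or.inr (Or.inl (hGH hu)))
    by_cases e1 : z = u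
    · exact Or.inl e1
    by_cases e2 : z = v
    · exact Or.inr (Or.inl e2)
    rcases hG x z u v hz hu hv e1 huv e2 with h | h | h
    · exact Or.inr (Or.inr (Or.inl (hGH h)))
    · exact absurd h hnuv
    · exact Or.inr (Or.inr (Or.inr (hGH h)))
  have hnb : ∀ H : SimpleGraph V, H ≤ completion G x → ∀ y z, H.Adj y z →
      G.Adj y z ∨ InBall G x z := by
    intro H hH y z hyz
    exact (hH hyz).2.imp id And.right
  have hxball : ∀ H : SimpleGraph V, H ≤ completion G x → ∀ z, H.Adj x z → InBall G x z :=
    fun H hH z hz => Or.inr (completion_adj_self (hH hz))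
  have hclaw : ∀ H : SimpleGraph V, G ≤ H → ∀ y p q z, G.Adj y p → G.Adj y q → p ≠ q → ¬ G.Adj p q →
      G.Adj y z → NearPair H p q z := by
    intro H hGH y p q z hp hq hpq hnpq hz
    by_cases e1 : z = p
    · exact Or.inl e1
    by_cases e2 : z = q
    · exact Or.inr (Or.inl e2)
    rcases hG y z p q hz hp hq e1 hpq e2 with h | h | h
    · exact Or.inr (Or.inr (Or.inl (hGH h)))
    · exact absurd h hnpq
    · exact Or.inr (Or.inr (Or.inr (hGH h)))
  have hhalf : HasHamCyc (halfCompletion G x) := by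
    refine hasHamCyc_descend (A := halfCompletion G x) (B := completion G x) ?_ hle2 le_rfl h
    intro H hAH hHB u v l huv huvB hl
    have hGH := hle1.trans hAH
    have hnuv : ¬ G.Adj u v := fun h => huv (hGH h)
    have hne' : u ≠ v := huvB.ne
    have hu : G.Adj x u := by
      rcases huvB.2 with h | ⟨h | h, h'⟩
      · exact absurd h hnuv
      · subst h
        exact absurd (completion_adj_self huvB) hnuv
      · exact h
    have hv : G.Adj x v := by
      rcases huvB.2 with h | ⟨h', h | h⟩
      · exact absurd h hnuv
      · subst h
        exact absurd (completion_adj_self huvB.symm).symm hnuv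
      · exact h
    -- `H` contains the half completion but not `uv`, so the neighbourhood of `x` splits into a side
    -- at `u` and a side at `v`.
    have hno : ∀ y, G.Adj x y → G.Adj y u → ¬ G.Adj y v := fun y h1 h2 h3 =>
      huv (hAH (Or.inr ⟨hne', hu, hv, y, h1, h2, h3⟩))
    have hside : ∀ z, G.Adj x z → (z = u ∨ G.Adj z u) ∨ (z = v ∨ G.Adj z v) := by
      intro z hz
      rcases hball G le_rfl u v hu hv hne' hnuv z (Or.inr hz) with h | h | h | h <;> tauto
    -- an edge of the neighbourhood of `x` between the two sides
    obtain ⟨w, w', hxw, hxw', hww, hwu, hwv⟩ : ∃ w w', G.Adj x w ∧ G.Adj x w' ∧ G.Adj w w' ∧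
        (w = u ∨ G.Adj w u) ∧ (w' = v ∨ G.Adj w' v) := by
      by_contra hcon
      push Not at hcon
      have hprop : ∀ p q, G.Adj x p → G.Adj x q → G.Adj p q → (p = u ∨ G.Adj p u) →
          (q = u ∨ G.Adj q u) := by
        intro p q hp hq hpq hpu
        rcases hside q hq with h | h
        · exact h
        · exact absurd h (by have := hcon p q hp hq hpq hpu; tauto)
      have hprop' : ∀ p q, G.Adj x p → G.Adj x q → G.Adj p q → (p = v ∨ G.Adj p v) →
          (q = v ∨ G.Adj q v) := by
        intro p q hp hq hpq hpu
        rcases hside q hq with h | h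
        · exact absurd hpu (by have := hcon q p hq hp hpq.symm h; tauto)
        · exact h
      -- With no edge between the sides, the path `a`, `b`, `c` stays on one side, and `a`, `c` and
      -- the opposite end are the leaves of a claw at `x`.
      have hnear : ∀ r s, r ≠ s → ¬ G.Adj r s → G.Adj x r → G.Adj x s →
          (∀ y, G.Adj x y → G.Adj y r → ¬ G.Adj y s) →
          (a = r ∨ G.Adj a r) → (c = r ∨ G.Adj c r) → False := by
        intro r s hrs hnrs hr hs hno h1 h2
        have has : ¬ G.Adj a s := by
          rcases h1 with rfl | h1
          · exact hnrs
          · exact hno a hxa h1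
        have hcs : ¬ G.Adj c s := by
          rcases h2 with rfl | h2
          · exact hnrs
          · exact hno c hxc h2
        have has' : a ≠ s := by
          rintro rfl
          rcases h1 with h1 | h1
          · exact hrs h1.symm
          · exact hnrs h1.symm
        have hcs' : c ≠ s := by
          rintro rfl
          rcases h2 with h1 | h1
          · exact hrs h1.symm
          · exact hnrs h1.symm
        rcases hG x a c s hxa hxc hs hne hcs' has' with h | h | h
        · exact hac h
        · exact hcs h
        · exact has h
      rcases hside a hxa with h | h
      · exact hnear u v hne' hnuv hu hv hno h
          (hprop b c hxb hxc hbc (hprop a b hxa hxb hab h))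
      · exact hnear v u hne'.symm (fun h => hnuv h.symm) hv hu (fun y h1 h2 h3 => hno y h1 h3 h2) h
          (hprop' b c hxb hxc hbc (hprop' a b hxa hxb hab h))
    have hwu : G.Adj w u := by
      rcases hwu with rfl | h
      · rcases hwv with rfl | h'
        · exact absurd hww hnuv
        · exact absurd h' (hno w' hxw' hww.symm)
      · exact h
    have hwv : G.Adj w' v := by
      rcases hwv with rfl | h
      · exact absurd hww (hno w hxw hwu)
      · exact h
    have hnwv : ¬ G.Adj w v := hno w hxw hwu
    have hnwu : ¬ G.Adj w' u := fun h => hno w' hxw' h hwv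
    have hnev : w ≠ v := by rintro rfl; exact hnuv hwu.symm
    have hneu : w' ≠ u := by rintro rfl; exact hnuv hwv
    -- Each of `w`, `w'` is the witness by which the half completion joins the other one to the
    -- opposite end.
    have Hwv : H.Adj w v := hAH (Or.inr ⟨hnev, hxw, hv, w', hxw', hww.symm, hwv⟩)
    have Hwu : H.Adj w' u := hAH (Or.inr ⟨hneu, hxw', hu, w, hxw, hww, hwu⟩)
    have houtside : ∀ z, ¬ NearPair H u v z → ¬ InBall G x z := fun z hz hb =>
      hz (hball H hGH u v hu hv hne' hnuv z hb)
    -- A far `z` is outside the ball, so `wz` is old; at `w` the vertices `u`, `w'`, `z` are not the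
    -- leaves of a claw, and `z` does not see `u`.
    have hb1 : ∀ z, ¬ NearPair H u v z → H.Adj w z → G.Adj w z ∧ G.Adj w' z := by
      intro z hz hwz
      have h1 := (hnb H hHB w z hwz).resolve_right (houtside z hz)
      refine ⟨h1, ?_⟩
      rcases hclaw G le_rfl w u w' z hwu hww hneu.symm (fun h => hnwu h.symm) h1 with h | h | h | h
      · exact absurd (Or.inl h) hz
      · subst h; exact absurd (Or.inr hxw') (houtside _ hz)
      · exact absurd (Or.inr (Or.inr (Or.inl (hGH h)))) hz
      · exact h.symm
    have hb2 : ∀ z, ¬ NearPair H u v z → H.Adj w' z → G.Adj w' z ∧ G.Adj w z := by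
      intro z hz hwz
      have h1 := (hnb H hHB w' z hwz).resolve_right (houtside z hz)
      refine ⟨h1, ?_⟩
      rcases hclaw G le_rfl w' v w z hwv hww.symm hnev.symm (fun h => hnwv h.symm) h1 with h | h | h | h
      · exact absurd (Or.inr (Or.inl h)) hz
      · subst h; exact absurd (Or.inr hxw) (houtside _ hz)
      · exact absurd (Or.inr (Or.inr (Or.inr (hGH h)))) hz
      · exact h.symm
    refine hl.hasHamCyc_of_triple (x := x) (w := w) (w' := w') (hGH hu) (hGH hv) (hGH hwu) Hwv Hwu
      (hGH hwv) (hGH hxw) (hGH hxw') (hGH hww) ?_ ?_ ?_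
    · exact fun z hz => hball H hGH u v hu hv hne' hnuv z (hxball H hHB z hz)
    · exact fun z hz => ⟨fun h => hGH (hb1 z hz h).2, fun h => hGH (hb2 z hz h).2⟩
    · intro z z' hz hz' h1 h2 hzz
      have g1 := (hb1 z hz h1).1
      have g2 := (hb1 z' hz' h2).1
      have o1 := houtside z hz
      have o2 := houtside z' hz'
      rcases hG w x z z' hxw.symm g1 g2 (fun h => o1 (Or.inl h.symm)) hzz
        (fun h => o2 (Or.inl h.symm)) with h | h | h
      · exact absurd (Or.inr h) o1
      · exact hGH h
      · exact absurd (Or.inr h) o2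
  -- Second round: `x` and the witness `y` are adjacent common neighbours of `u` and `v`.
  refine hasHamCyc_descend (A := G) (B := halfCompletion G x) ?_ hle1 le_rfl hhalf
  intro H hAH hHB u v l huv huvB hl
  have hnuv : ¬ G.Adj u v := fun h => huv (hAH h)
  obtain h | ⟨hne', hu, hv, y, hy, hyu, hyv⟩ := huvB
  · exact absurd h hnuv
  refine hl.hasHamCyc_of_pair (y := x) (y' := y) (hAH hu) (hAH hv) (hAH hyu) (hAH hyv) (hAH hy) ?_ ?_
  · exact fun z hz => hball H hAH u v hu hv hne' hnuv z (hxball H (hHB.trans hle2) z hz)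
  · intro z hz
    rcases hnb H (hHB.trans hle2) y z hz with h | h
    · exact hclaw H hAH y u v z hyu hyv hne' hnuv h
    · exact hball H hAH u v hu hv hne' hnuv z h

end ClawFree

/-! ### The closure and the lifting of induced paths. -/

namespace ClawFree

variable {V : Type*}

/-- The step from a graph to its local completion at the hub of an induced diamond. -/
def CompletionStep (G G' : SimpleGraph V) : Prop :=
  ∃ x a b c, G.Adj x a ∧ G.Adj x b ∧ G.Adj x c ∧ G.Adj a b ∧ G.Adj b c ∧ ¬ G.Adj a c ∧ a ≠ c ∧
    G' = completion G x

open Relation in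
-- Each step adds the edge `ac`, so the number of nonadjacent pairs drops.
theorem exists_closure [Finite V] {G : SimpleGraph V} (hG : NoClaw G) :
    ∃ D, ReflTransGen CompletionStep G D ∧ NoClaw D ∧ DiamondFree D := by
  induction hk : {p : V × V | ¬ G.Adj p.1 p.2}.ncard using Nat.strong_induction_on generalizing G with
  | _ k ih =>
  by_cases hD : DiamondFree G
  · exact ⟨G, .refl, hG, hD⟩
  simp only [DiamondFree] at hD
  push Not at hD
  obtain ⟨x, a, b, c, h1, h2, h3, h4, h5, h6, h7⟩ := hD
  obtain ⟨D, hD1, hD2⟩ := ih _ (by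
    rw [← hk]
    refine Set.ncard_lt_ncard ⟨fun p hp hpp => hp (le_completion G x hpp), fun hsub => ?_⟩
      (Set.toFinite _)
    have : (a, c) ∈ {p : V × V | ¬ (completion G x).Adj p.1 p.2} := hsub h7
    exact this (InBall.adj_completion (G := G) (x := x) (Or.inr h1) (Or.inr h3) h6)) (hG.completion x) rfl
  exact ⟨D, .head ⟨x, a, b, c, h1, h2, h3, h4, h5, h7, h6, rfl⟩ hD1, hD2⟩

theorem CompletionStep.le {G G' : SimpleGraph V} (h : CompletionStep G G') : G ≤ G' := by
  obtain ⟨x, a, b, c, -, -, -, -, -, -, -, rfl⟩ := h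
  exact le_completion G x

theorem CompletionStep.noClaw {G G' : SimpleGraph V} (h : CompletionStep G G') (hG : NoClaw G) :
    NoClaw G' := by
  obtain ⟨x, a, b, c, -, -, -, -, -, -, -, rfl⟩ := h
  exact hG.completion x

theorem le_of_steps {G D : SimpleGraph V} (h : Relation.ReflTransGen CompletionStep G D) :
    G ≤ D := by
  induction h with
  | refl => exact le_rfl
  | tail _ h ih => exact ih.trans h.le

theorem hasHamCyc_of_steps [Finite V] {G D : SimpleGraph V} (hG : NoClaw G)
    (h : Relation.ReflTransGen CompletionStep G D) (hD : HasHamCyc D) : HasHamCyc G := by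
  induction h using Relation.ReflTransGen.head_induction_on with
  | refl => exact hD
  | head h _ ih =>
    have := ih (h.noClaw hG)
    obtain ⟨x, a, b, c, h1, h2, h3, h4, h5, h6, h7, rfl⟩ := h
    exact hasHamCyc_of_completion hG h1 h2 h3 h4 h5 h6 h7 this

/-- The neighbourhood of `x` is a clique. -/
def Simplicial (D : SimpleGraph V) (x : V) : Prop :=
  ∀ a b, D.Adj x a → D.Adj x b → a ≠ b → D.Adj a b

theorem simplicial_completion (G : SimpleGraph V) (x : V) : Simplicial (completion G x) x :=
  fun _ _ ha hb hab => InBall.adj_completion (Or.inr (completion_adj_self ha))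
    (Or.inr (completion_adj_self hb)) hab

/-- If `x` is in the ball of `y`, then so are all its neighbours, and the ball is now a clique.
Otherwise `x` gains no edge. -/
theorem Simplicial.completion {G : SimpleGraph V} {x : V} (h : Simplicial G x) (y : V) :
    Simplicial (completion G y) x := by
  intro a b ha hb hab
  by_cases hx : InBall G y x
  · have key : ∀ a, (ClawFree.completion G y).Adj x a → InBall G y a := by
      intro a ha
      rcases ha.2 with h' | h'
      · rcases hx with rfl | hx
        · exact Or.inr h'
        · by_cases hay : a = y
          · exact Or.inl hay
          · exact Or.inr (h y a hx.symm h' (Ne.symm hay))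
      · exact h'.2
    exact (key a ha).adj_completion (key b hb) hab
  · have key : ∀ a, (ClawFree.completion G y).Adj x a → G.Adj x a := fun a ha =>
      ha.2.resolve_right fun h' => hx h'.1
    exact le_completion G y (h a b (key a ha) (key b hb) hab)

theorem Simplicial.of_steps {G D : SimpleGraph V} {x : V} (hx : Simplicial G x)
    (h : Relation.ReflTransGen CompletionStep G D) : Simplicial D x := by
  induction h with
  | refl => exact hx
  | tail _ h ih =>
    obtain ⟨y, a, b, c, -, -, -, -, -, -, -, rfl⟩ := h
    exact ih.completion y

/-- The list is an induced path of `G`. -/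
def IndPath (G : SimpleGraph V) : List V → Prop
  | [] => True
  | a :: l => a ∉ l ∧ (∀ b ∈ l, G.Adj a b ↔ l.head? = some b) ∧ IndPath G l

theorem indPath_append {G : SimpleGraph V} {l₁ l₂ : List V} :
    IndPath G (l₁ ++ l₂) ↔ IndPath G l₁ ∧ IndPath G l₂ ∧ ∀ a ∈ l₁, ∀ b ∈ l₂,
      a ≠ b ∧ (G.Adj a b ↔ l₁.getLast? = some a ∧ l₂.head? = some b) := by
  induction l₁ with
  | nil => simp [IndPath]
  | cons a l₁ ih =>
    rcases l₁ with _ | ⟨c, l₁⟩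
    · simp only [List.cons_append, List.nil_append, IndPath, List.mem_cons, List.not_mem_nil,
        or_false, forall_eq, List.getLast?_singleton, true_and, not_false_eq_true]
      constructor
      · rintro ⟨h1, h2, h3⟩
        exact ⟨⟨fun b hb => hb.elim, trivial⟩, h3, fun b hb => ⟨fun h => h1 (h ▸ hb), h2 b hb⟩⟩
      · rintro ⟨-, h3, h4⟩
        exact ⟨fun h => (h4 a h).1 rfl, fun b hb => (h4 b hb).2, h3⟩
    · rw [List.cons_append, IndPath, ih]
      constructor
      · rintro ⟨h1, h2, h3, h4, h5⟩
        have h1' : a ∉ c :: l₁ := fun h => h1 (List.mem_append_left _ h)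
        refine ⟨⟨h1', fun b hb => ?_, h3⟩, h4, ?_⟩
        · rw [h2 b (List.mem_append_left _ hb)]; simp
        · intro p hp q hq
          rw [List.mem_cons] at hp
          rcases hp with rfl | hp
          · refine ⟨fun h => h1 (h ▸ List.mem_append_right _ hq), ?_⟩
            rw [h2 q (List.mem_append_right _ hq)]
            constructor
            · intro h
              simp only [List.cons_append, List.head?_cons, Option.some.injEq] at h
              exact absurd h (h5 c (by simp) q hq).1
            · rintro ⟨h, -⟩
              rw [List.getLast?_cons_cons] at h
              exact absurd (List.mem_of_getLast? h) h1'
          · rw [List.getLast?_cons_cons]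
            exact h5 p hp q hq
      · rintro ⟨⟨h1, h2, h3⟩, h4, h5⟩
        refine ⟨?_, ?_, h3, h4, ?_⟩
        · intro h
          rcases List.mem_append.1 h with h | h
          · exact h1 h
          · exact (h5 a (by simp) a h).1 rfl
        · intro b hb
          rcases List.mem_append.1 hb with h | h
          · rw [h2 b h]; simp
          · rw [(h5 a (by simp) b h).2, List.getLast?_cons_cons]
            constructor
            · rintro ⟨h', -⟩
              exact absurd (List.mem_of_getLast? h') h1
            · intro h'
              simp only [List.cons_append, List.head?_cons, Option.some.injEq] at h'
              exact absurd h' (h5 c (by simp) b h).1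
        · intro p hp q hq
          have := h5 p (List.mem_cons_of_mem _ hp) q hq
          rwa [List.getLast?_cons_cons] at this

theorem IndPath.nodup {G : SimpleGraph V} {l : List V} (h : IndPath G l) : l.Nodup := by
  induction l with
  | nil => simp
  | cons a l ih => exact List.nodup_cons.2 ⟨h.1, ih h.2.2⟩

theorem IndPath.chain {G : SimpleGraph V} {l : List V} (h : IndPath G l) :
    List.IsChain G.Adj l := by
  induction l with
  | nil => simp
  | cons a l ih =>
    rw [List.isChain_cons]
    exact ⟨fun b hb => (h.2.1 b (List.mem_of_head? hb)).2 hb, ih h.2.2⟩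

theorem IndPath.of_le {G G' : SimpleGraph V} (hle : G ≤ G') {l : List V} (h : IndPath G' l)
    (hc : List.IsChain G.Adj l) : IndPath G l := by
  induction l with
  | nil => trivial
  | cons a l ih =>
    rw [List.isChain_cons] at hc
    exact ⟨h.1, fun b hb => ⟨fun hab => (h.2.1 b hb).1 (hle hab), fun hb' => hc.1 b hb'⟩,
      ih h.2.2 hc.2⟩

theorem IndPath.of_completion_of_ball {G : SimpleGraph V} {x : V} {l : List V}
    (h : IndPath (completion G x) l)
    (hb : ∀ p ∈ l, ∀ q ∈ l, InBall G x p → InBall G x q → p = q) : IndPath G l := by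
  refine h.of_le (le_completion G x) (h.chain.imp_of_mem_imp ?_)
  intro a b ha hb' hab
  exact hab.2.resolve_right fun h' => hab.1 (hb a ha b hb' h'.1 h'.2)

theorem InBall.adj {G : SimpleGraph V} {x p : V} (h : InBall G x p) (hp : p ≠ x) : G.Adj x p :=
  h.resolve_left hp

/-- The ball of `x` is a clique of the completion, so an induced path meets it in at most two,
consecutive vertices. If their edge is new, subdividing it by `x` gives an induced path of `G`. -/
theorem IndPath.of_completion {G : SimpleGraph V} {x : V} {l : List V}
    (h : IndPath (completion G x) l) :
    IndPath G l ∨ ∃ s p q t, l = s ++ p :: q :: t ∧ G.Adj x p ∧ G.Adj x q ∧ p ≠ q ∧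
      (∀ r ∈ l, InBall G x r → r = p ∨ r = q) ∧ x ∉ l ∧ IndPath G (s ++ p :: x :: q :: t) := by
  by_cases hc : List.IsChain G.Adj l
  · exact Or.inl (h.of_le (le_completion G x) hc)
  right
  rw [List.isChain_iff_forall_rel_of_append_cons_cons] at hc
  push Not at hc
  obtain ⟨p, q, s, t, rfl, hpq⟩ := hc
  have e : s ++ p :: q :: t = (s ++ [p]) ++ (q :: t) := by simp
  rw [e] at h
  obtain ⟨h1, h2, h3⟩ := indPath_append.1 h
  have hpq' : (completion G x).Adj p q := ((h3 p (by simp) q (by simp)).2).2 (by simp)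
  obtain ⟨hp, hq⟩ := hpq'.2.resolve_left hpq
  have hpx : p ≠ x := by
    rintro rfl
    exact hpq (completion_adj_self hpq')
  have hqx : q ≠ x := by
    rintro rfl
    exact hpq (completion_adj_self hpq'.symm).symm
  have hl : ∀ r ∈ s ++ [p], InBall G x r → r = p := by
    intro r hr hb
    by_contra hne
    have hrq : r ≠ q := (h3 r hr q (by simp)).1
    have := ((h3 r hr q (by simp)).2).1 (hb.adj_completion hq hrq)
    simp at this
    exact hne this.symm
  have hr : ∀ r ∈ q :: t, InBall G x r → r = q := by
    intro r hr hb
    by_contra hne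
    have hrq : p ≠ r := (h3 p (by simp) r hr).1
    have := ((h3 p (by simp) r hr).2).1 (hp.adj_completion hb hrq)
    simp at this
    exact hne this.symm
  have hxl : x ∉ s ++ [p] := fun h => hpx (hl x h (Or.inl rfl)).symm
  have hxr : x ∉ q :: t := fun h => hqx (hr x h (Or.inl rfl)).symm
  refine ⟨s, p, q, t, rfl, hp.adj hpx, hq.adj hqx, hpq'.ne, ?_, ?_, ?_⟩
  · intro r hr' hb
    rw [e, List.mem_append] at hr'
    exact hr'.imp (fun h => hl r h hb) fun h => hr r h hb
  · rw [e, List.mem_append]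
    exact fun h => h.elim hxl hxr
  · have e' : s ++ p :: x :: q :: t = (s ++ [p]) ++ (x :: q :: t) := by simp
    rw [e', indPath_append]
    refine ⟨h1.of_completion_of_ball fun a ha b hb ha' hb' =>
      (hl a ha ha').trans (hl b hb hb').symm, ⟨hxr, ?_, h2.of_completion_of_ball
        fun a ha b hb ha' hb' => (hr a ha ha').trans (hr b hb hb').symm⟩, ?_⟩
    · intro b hb
      constructor
      · intro hxb
        rw [hr b hb (Or.inr hxb)]; rfl
      · intro hb'
        have : b = q := by simpa using hb'.symm
        rw [this]; exact hq.adj hqx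
    · intro a ha b hb
      rw [List.mem_cons] at hb
      rcases hb with rfl | hb
      · refine ⟨fun h => hxl (h ▸ ha), ?_⟩
        constructor
        · intro hab
          rw [hl a ha (Or.inr hab.symm)]; simp
        · intro h'
          have : a = p := by simpa using h'.1.symm
          rw [this]; exact (hp.adj hpx).symm
      · refine ⟨(h3 a ha b hb).1, ?_⟩
        constructor
        · intro hab
          have := ((h3 a ha b hb).2).1 (le_completion G x hab)
          simp at this
          rw [← this.1, ← this.2] at hab
          exact absurd hab hpq
        · intro h'
          have : b = x := by simpa using h'.2.symm
          exact absurd (this ▸ hb) hxr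

/-- `S` contains every simplicial vertex of `D` that sees two elements of `S`. -/
def LeafClosed (D : SimpleGraph V) (S : Set V) : Prop :=
  ∀ x p q, Simplicial D x → p ∈ S → q ∈ S → p ≠ q → D.Adj x p → D.Adj x q → x ∈ S

/-- Steps are undone one by one. An inserted hub is simplicial after its own completion and remains
so in `D`, and it sees two vertices of `S`; this is what `LeafClosed` asks for. -/
theorem IndPath.lift {G D : SimpleGraph V} (h : Relation.ReflTransGen CompletionStep G D)
    {S : Set V} (hS : LeafClosed D S) {l : List V} (hl : IndPath D l) (hlS : ∀ v ∈ l, v ∈ S) :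
    ∃ l', IndPath G l' ∧ l'.head? = l.head? ∧ l'.getLast? = l.getLast? ∧ l.length ≤ l'.length ∧
      ∀ v ∈ l', v ∈ S := by
  induction h using Relation.ReflTransGen.head_induction_on with
  | refl => exact ⟨l, hl, rfl, rfl, le_rfl, hlS⟩
  | head h hD ih =>
    obtain ⟨l', h1, h2, h3, h4, h5⟩ := ih
    have hle := h.le
    obtain ⟨x, a, b, c, -, -, -, -, -, -, -, rfl⟩ := h
    have hx : Simplicial D x := (simplicial_completion _ x).of_steps hD
    rcases h1.of_completion with h6 | ⟨s, p, q, t, rfl, hp, hq, hpq, -, -, h6⟩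
    · exact ⟨l', h6, h2, h3, h4, h5⟩
    · refine ⟨_, h6, ?_, ?_, ?_, ?_⟩
      · rw [← h2]; rcases s with _ | ⟨s0, s⟩ <;> simp
      · rw [← h3]; simp [List.getLast?_append, List.getLast?_cons]
      · refine h4.trans ?_; simp
      · have hle' := hle.trans (le_of_steps hD)
        have hxS : x ∈ S := hS x p q hx (h5 p (by simp)) (h5 q (by simp)) hpq (hle' hp) (hle' hq)
        intro v hv
        simp only [List.mem_append, List.mem_cons] at hv
        rcases hv with hv | rfl | rfl | rfl | hv
        · exact h5 v (by simp [hv])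
        · exact h5 _ (by simp)
        · exact hxS
        · exact h5 _ (by simp)
        · exact h5 v (by simp [hv])

end ClawFree

/-! ### Lifting generalized nets. -/

namespace ClawFree

variable {V : Type*}

/-- A generalized net: a triangle `t` with three induced paths `t i :: r i` hanging from it. -/
structure IsNet (G : SimpleGraph V) (t : Fin 3 → V) (r : Fin 3 → List V) : Prop where
  path : ∀ i, IndPath G (t i :: r i)
  cross : ∀ i j, i ≠ j → ∀ p ∈ t i :: r i, ∀ q ∈ t j :: r j,
    p ≠ q ∧ (G.Adj p q ↔ p = t i ∧ q = t j)

theorem IsNet.adj {G : SimpleGraph V} {t : Fin 3 → V} {r : Fin 3 → List V} (h : IsNet G t r)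
    {i j : Fin 3} (hij : i ≠ j) : G.Adj (t i) (t j) :=
  ((h.cross i j hij _ (by simp) _ (by simp)).2).2 ⟨rfl, rfl⟩

theorem IsNet.adj_imp {G : SimpleGraph V} {t : Fin 3 → V} {r : Fin 3 → List V} (h : IsNet G t r)
    {i j : Fin 3} (hij : i ≠ j) {p q : V} (hp : p ∈ t i :: r i) (hq : q ∈ t j :: r j)
    (hpq : G.Adj p q) : p = t i ∧ q = t j :=
  ((h.cross i j hij _ hp _ hq).2).1 hpq

theorem IsNet.notMem {G : SimpleGraph V} {t : Fin 3 → V} {r : Fin 3 → List V} (h : IsNet G t r)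
    {i : Fin 3} {p : V} (hp : p ∈ r i) : p ≠ t i := fun he => (h.path i).1 (he ▸ hp)

/-- The net obtained by pushing the leg `j` away from the triangle. -/
theorem IsNet.push {G : SimpleGraph V} {x : V} {t : Fin 3 → V} {r : Fin 3 → List V}
    (h : IsNet (completion G x) t r) {i j k : Fin 3} (hij : i ≠ j) (hjk : j ≠ k) (hik : i ≠ k)
    (hb : ∀ a, ∀ p ∈ t a :: r a, InBall G x p → p = t a) (hx : ∀ a, G.Adj x (t a))
    (hnij : ¬ G.Adj (t i) (t j)) (hnkj : ¬ G.Adj (t k) (t j)) (hik' : G.Adj (t i) (t k)) :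
    IsNet G (Function.update t j x) (Function.update r j (t j :: r j)) := by
  have hall : ∀ a : Fin 3, a = i ∨ a = j ∨ a = k := by omega
  have hp : ∀ a, IndPath G (t a :: r a) := fun a =>
    (h.path a).of_completion_of_ball fun p hp q hq hp' hq' =>
      (hb a p hp hp').trans (hb a q hq hq').symm
  have hxn : ∀ a, x ∉ t a :: r a := fun a hx' => by
    have := hb a x hx' (Or.inl rfl)
    exact (hx a).ne this
  have hxadj : ∀ a, ∀ q ∈ t a :: r a, G.Adj x q ↔ q = t a := fun a q hq =>
    ⟨fun h' => hb a q hq (Or.inr h'), fun h' => h' ▸ hx a⟩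
  have hne : ∀ a b, a ≠ b → ∀ p ∈ t a :: r a, ∀ q ∈ t b :: r b, p ≠ q := fun a b hab p hp q hq =>
    (h.cross a b hab p hp q hq).1
  have himp : ∀ a b, a ≠ b → ∀ p ∈ t a :: r a, ∀ q ∈ t b :: r b, G.Adj p q → p = t a ∧ q = t b :=
    fun a b hab p hp q hq hpq => h.adj_imp hab hp hq (le_completion G x hpq)
  refine ⟨fun a => ?_, ?_⟩
  · by_cases haj : a = j
    · subst haj
      simp only [Function.update_self]
      refine ⟨hxn a, fun b hb' => ?_, hp a⟩
      rw [hxadj a b hb']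
      simp [eq_comm]
    · simpa [Function.update_of_ne haj] using hp a
  · have main : ∀ b, b ≠ j → ∀ p ∈ x :: t j :: r j, ∀ q ∈ t b :: r b,
        p ≠ q ∧ (G.Adj p q ↔ p = x ∧ q = t b) := by
      intro b hbj p hp q hq
      rw [List.mem_cons] at hp
      rcases hp with rfl | hp
      · refine ⟨fun he => hxn b (he ▸ hq), ?_⟩
        rw [hxadj b q hq]; simp
      · refine ⟨hne j b hbj.symm p hp q hq, ⟨fun hpq => ?_, fun hpq => ?_⟩⟩
        · exfalso
          obtain ⟨rfl, rfl⟩ := himp j b hbj.symm p hp q hq hpq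
          rcases hall b with rfl | rfl | rfl
          · exact hnij hpq.symm
          · exact hbj rfl
          · exact hnkj hpq.symm
        · exact absurd (hpq.1 ▸ hp) (hxn j)
    intro a b hab p hp q hq
    by_cases haj : a = j
    · subst haj
      simp only [Function.update_self, Function.update_of_ne hab.symm] at hp hq ⊢
      exact main b hab.symm p hp q hq
    · by_cases hbj : b = j
      · subst hbj
        simp only [Function.update_self, Function.update_of_ne haj] at hp hq ⊢
        have := main a haj q hq p hp
        rw [G.adj_comm, this.2]
        exact ⟨this.1.symm, and_comm⟩
      · simp only [Function.update_of_ne haj, Function.update_of_ne hbj] at hp hq ⊢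
        refine ⟨hne a b hab p hp q hq, himp a b hab p hp q hq, ?_⟩
        rintro ⟨rfl, rfl⟩
        rcases hall a with rfl | rfl | rfl <;> rcases hall b with rfl | rfl | rfl <;>
          first
          | exact hik'
          | exact hik'.symm
          | exact absurd rfl hab
          | exact absurd rfl haj
          | exact absurd rfl hbj

/-- How a net refines the net `t, r` by means of the vertex `x`. -/
structure NetRefine (G : SimpleGraph V) (x : V) (t : Fin 3 → V) (r : Fin 3 → List V)
    (t' : Fin 3 → V) (r' : Fin 3 → List V) : Prop where
  last : ∀ i, (t' i :: r' i).getLast? = (t i :: r i).getLast?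
  length : ∀ i, (r i).length ≤ (r' i).length
  mem : ∀ i, ∀ v ∈ t' i :: r' i, v ∈ t i :: r i ∨ v = x ∧
    ((∃ p ∈ t i :: r i, ∃ q ∈ t i :: r i, p ≠ q ∧ G.Adj x p ∧ G.Adj x q) ∨
      ∃ a b, a ≠ b ∧ G.Adj x (t a) ∧ G.Adj x (t b))

/-- If the triangle is old, at most one leg uses a new edge, and `x` subdivides it. Otherwise the
ball meets the net exactly in the triangle, and claw-freeness leaves exactly one old triangle edge:
`x` and this edge form the new triangle, and the third leg is pushed out by one vertex. -/
theorem IsNet.of_completion {G : SimpleGraph V} (hG : NoClaw G) {x : V} {t : Fin 3 → V}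
    {r : Fin 3 → List V} (h : IsNet (completion G x) t r) (hr : ∀ i, r i ≠ []) :
    ∃ t' r', IsNet G t' r' ∧ NetRefine G x t r t' r' := by
  by_cases ht : ∀ i j, i ≠ j → G.Adj (t i) (t j)
  · by_cases hp : ∀ i, IndPath G (t i :: r i)
    · refine ⟨t, r, ⟨hp, fun i j hij p hp q hq => ⟨(h.cross i j hij p hp q hq).1,
        fun hpq => h.adj_imp hij hp hq (le_completion G x hpq), ?_⟩⟩,
        fun _ => rfl, fun _ => le_rfl, fun _ _ h => Or.inl h⟩
      rintro ⟨rfl, rfl⟩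
      exact ht i j hij
    push Not at hp
    obtain ⟨i, hi⟩ := hp
    obtain ⟨s, p, q, w, e, hp, hq, hpq, hball, hxn, hpath⟩ := (h.path i).of_completion.resolve_left hi
    have hqt : q ≠ t i := by
      have hn := (h.path i).nodup
      rcases s with _ | ⟨s0, s⟩
      · obtain ⟨rfl, -⟩ := List.cons.inj e
        exact hpq.symm
      · rw [e] at hn
        obtain ⟨rfl, -⟩ := List.cons.inj e
        rintro rfl
        simp at hn
    have hqi : q ∈ t i :: r i := by rw [e]; simp
    have hnob : ∀ j, j ≠ i → ∀ v ∈ t j :: r j, ¬ InBall G x v := fun j hj v hv hb =>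
      hqt (h.adj_imp hj.symm hqi hv (InBall.adj_completion (Or.inr hq) hb
        (h.cross i j hj.symm q hqi v hv).1)).1
    obtain ⟨w', e'⟩ : ∃ w', s ++ p :: x :: q :: w = t i :: w' := by
      rcases s with _ | ⟨s0, s⟩
      · obtain ⟨rfl, -⟩ := List.cons.inj e
        exact ⟨_, rfl⟩
      · obtain ⟨rfl, -⟩ := List.cons.inj e
        exact ⟨_, rfl⟩
    have hmem : ∀ v ∈ t i :: w', v ∈ t i :: r i ∨ v = x := by
      intro v hv
      rw [← e'] at hv
      rw [e]
      simp only [List.mem_append, List.mem_cons] at hv ⊢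
      tauto
    rw [e'] at hpath
    refine ⟨t, Function.update r i w', ⟨fun j => ?_, ?_⟩, fun j => ?_, fun j => ?_, fun j => ?_⟩
    · by_cases hj : j = i
      · subst hj; simpa using hpath
      · rw [Function.update_of_ne hj]
        exact (h.path j).of_completion_of_ball fun a ha _ _ ha' => absurd ha' (hnob j hj a ha)
    · have main : ∀ b, b ≠ i → ∀ p ∈ t i :: w', ∀ q ∈ t b :: r b,
          p ≠ q ∧ (G.Adj p q ↔ p = t i ∧ q = t b) := by
        intro b hb p hp' q hq'
        rcases hmem p hp' with hp' | rfl
        · refine ⟨(h.cross i b hb.symm p hp' q hq').1,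
            fun h' => h.adj_imp hb.symm hp' hq' (le_completion G x h'), ?_⟩
          rintro ⟨rfl, rfl⟩
          exact ht i b hb.symm
        · refine ⟨fun he => hnob b hb q hq' (Or.inl he.symm),
            fun h' => absurd (Or.inr h') (hnob b hb q hq'), fun h' => ?_⟩
          exact absurd (h'.1 ▸ List.mem_cons_self) hxn
      intro a b hab p hp q hq
      by_cases ha : a = i
      · subst ha
        simp only [Function.update_self, Function.update_of_ne hab.symm] at hp hq
        exact main b hab.symm p hp q hq
      · by_cases hb : b = i
        · subst hb
          simp only [Function.update_self, Function.update_of_ne ha] at hp hq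
          have := main a ha q hq p hp
          rw [G.adj_comm, this.2]
          exact ⟨this.1.symm, and_comm⟩
        · simp only [Function.update_of_ne ha, Function.update_of_ne hb] at hp hq
          refine ⟨(h.cross a b hab p hp q hq).1,
            fun h' => h.adj_imp hab hp hq (le_completion G x h'), ?_⟩
          rintro ⟨rfl, rfl⟩
          exact ht a b hab
    · by_cases hj : j = i
      · subst hj
        rw [Function.update_self, e, ← e']
        simp [List.getLast?_append, List.getLast?_cons]
      · rw [Function.update_of_ne hj]
    · by_cases hj : j = i
      · subst hj
        have h1 := congrArg List.length e
        have h2 := congrArg List.length e'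
        simp at h1 h2
        rw [Function.update_self]; omega
      · rw [Function.update_of_ne hj]
    · intro v hv
      by_cases hj : j = i
      · subst hj
        rw [Function.update_self] at hv
        refine (hmem v hv).imp_right fun hv => ⟨hv, Or.inl ⟨p, ?_, q, hqi, hpq, hp, hq⟩⟩
        rw [e]; simp
      · rw [Function.update_of_ne hj] at hv
        exact Or.inl hv
  · push Not at ht
    obtain ⟨i, j, hij, hnij⟩ := ht
    obtain ⟨k, hik, hjk⟩ : ∃ k, i ≠ k ∧ j ≠ k :=
      (by decide : ∀ i j : Fin 3, i ≠ j → ∃ k, i ≠ k ∧ j ≠ k) i j hij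
    have hall : ∀ a : Fin 3, a = i ∨ a = j ∨ a = k := by omega
    obtain ⟨hbi, hbj⟩ := (h.adj hij).2.resolve_left hnij
    have hb : ∀ a, ∀ p ∈ t a :: r a, InBall G x p → p = t a := by
      intro a p hp hpb
      by_cases ha : a = i
      · subst ha
        exact (h.adj_imp hij hp (by simp) (hpb.adj_completion hbj
          (h.cross a j hij p hp _ (by simp)).1)).1
      · exact (h.adj_imp ha hp (by simp) (hpb.adj_completion hbi
          (h.cross a i ha p hp _ (by simp)).1)).1
    choose n hn using fun a => List.exists_mem_of_ne_nil _ (hr a)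
    have hnext : ∀ a, ∃ n ∈ r a, (completion G x).Adj (t a) n := by
      intro a
      have hra := hr a
      rcases hra' : r a with _ | ⟨n, w⟩
      · exact absurd hra' hra
      · refine ⟨n, by simp, ?_⟩
        have := h.path a
        rw [hra'] at this
        exact (this.2.1 n (by simp)).2 rfl
    choose n hn hnadj using hnext
    have hnb : ∀ a, ¬ InBall G x (n a) := fun a hb' =>
      h.notMem (hn a) (hb a _ (List.mem_cons_of_mem _ (hn a)) hb')
    have hnG : ∀ a, G.Adj (t a) (n a) := fun a =>
      (hnadj a).2.resolve_right fun h' => hnb a h'.2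
    have htx : ∀ a, t a ≠ x := fun a he => hnb a (Or.inr (he ▸ hnG a))
    have hcr : ∀ a b, a ≠ b → ¬ G.Adj (n a) (t b) := fun a b hab hadj =>
      h.notMem (hn a) (h.adj_imp hab (List.mem_cons_of_mem _ (hn a)) (by simp)
        (le_completion G x hadj)).1
    have hcrne : ∀ a b, a ≠ b → n a ≠ t b := fun a b hab =>
      (h.cross a b hab _ (List.mem_cons_of_mem _ (hn a)) _ (by simp)).1
    -- Legs are nonempty, so a third triangle vertex off the ball would make `x`, `n i`, `t k` the
    -- leaves of a claw at `t i`.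
    have hbk : InBall G x (t k) := by
      by_contra hbk
      have hik' : G.Adj (t i) (t k) := (h.adj hik).2.resolve_right fun h' => hbk h'.2
      rcases hG (t i) x (n i) (t k) (hbi.adj (htx i)).symm (hnG i) hik'
        (fun he => hnb i (Or.inl he.symm)) (hcrne i k hik) (fun he => hbk (Or.inl he.symm))
        with h' | h' | h'
      · exact hnb i (Or.inr h')
      · exact hcr i k hik h'
      · exact hbk (Or.inr h')
    have hx : ∀ a, G.Adj x (t a) := by
      intro a
      rcases hall a with rfl | rfl | rfl
      · exact hbi.adj (htx _)
      · exact hbj.adj (htx _)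
      · exact hbk.adj (htx _)
    have hne : ∀ a b, a ≠ b → t a ≠ t b := fun a b hab => (h.adj hab).ne
    have hnot : ¬ (G.Adj (t i) (t k) ∧ G.Adj (t j) (t k)) := by
      rintro ⟨h1, h2⟩
      rcases hG (t k) (t i) (n k) (t j) h1.symm (hnG k) h2.symm (hcrne k i hik.symm).symm
        (hcrne k j hjk.symm) (hne i j hij) with h' | h' | h'
      · exact hcr k i hik.symm h'.symm
      · exact hcr k j hjk.symm h'
      · exact hnij h'
    have fin : ∀ i j, i ≠ j → i ≠ k → j ≠ k → ¬ G.Adj (t i) (t j) → G.Adj (t i) (t k) →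
        ¬ G.Adj (t k) (t j) → ∃ t' r', IsNet G t' r' ∧ NetRefine G x t r t' r' := by
      intro i j hij hik hjk h1 h2 h3
      refine ⟨_, _, h.push hij hjk hik hb hx h1 h3 h2, fun a => ?_, fun a => ?_, fun a => ?_⟩ <;>
        by_cases ha : a = j
      · subst ha; simp [List.getLast?_cons]
      · simp [Function.update_of_ne ha]
      · subst ha; simp
      · simp [Function.update_of_ne ha]
      · subst ha
        intro v hv
        simp only [Function.update_self] at hv
        rw [List.mem_cons] at hv
        exact hv.symm.imp_right fun hv => ⟨hv, Or.inr ⟨i, k, hik, hx _, hx _⟩⟩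
      · intro v hv
        simp only [Function.update_of_ne ha] at hv
        exact Or.inl hv
    -- The triangle vertices are not independent in `G`, since `x` sees them all. By `hnot` exactly
    -- one of the edges at `t k` is old.
    rcases hG x (t i) (t k) (t j) (hx i) (hx k) (hx j) (hne i k hik) (hne k j hjk.symm)
      (hne i j hij) with h' | h' | h'
    · exact fin i j hij hik hjk hnij h' fun h'' => hnot ⟨h', h''.symm⟩
    · exact fin j i hij.symm hjk hik (fun h => hnij h.symm) h'.symm
        fun h'' => hnot ⟨h''.symm, h'.symm⟩
    · exact absurd h' hnij

/-- A hub subdividing a leg is confined by `hS`. A hub becoming a triangle vertex sees two different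
legs and heads a third; for it `hS'` is needed. -/
theorem IsNet.lift {G D : SimpleGraph V} (hG : NoClaw G)
    (h : Relation.ReflTransGen CompletionStep G D) {S : Fin 3 → Set V}
    (hS : ∀ i, LeafClosed D (S i))
    (hS' : ∀ x i j, i ≠ j → ∀ p ∈ S i, ∀ q ∈ S j, Simplicial D x → D.Adj x p → D.Adj x q →
      ∀ k, x ∈ S k)
    {t : Fin 3 → V} {r : Fin 3 → List V} (hn : IsNet D t r) (hr : ∀ i, r i ≠ [])
    (hmem : ∀ i, ∀ v ∈ t i :: r i, v ∈ S i) :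
    ∃ t' r', IsNet G t' r' ∧ (∀ i, (t' i :: r' i).getLast? = (t i :: r i).getLast?) ∧
      (∀ i, (r i).length ≤ (r' i).length) ∧ ∀ i, ∀ v ∈ t' i :: r' i, v ∈ S i := by
  induction h using Relation.ReflTransGen.head_induction_on with
  | refl => exact ⟨t, r, hn, fun _ => rfl, fun _ => le_rfl, hmem⟩
  | head h hD ih =>
    obtain ⟨t₁, r₁, h1, h2, h3, h4⟩ := ih (h.noClaw hG)
    have hle := h.le
    obtain ⟨x, a, b, c, -, -, -, -, -, -, -, rfl⟩ := h
    have hx : Simplicial D x := (simplicial_completion _ x).of_steps hD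
    have hle' := hle.trans (le_of_steps hD)
    have hr₁ : ∀ i, r₁ i ≠ [] := by
      intro i he
      have := h3 i
      rw [he] at this
      exact hr i (List.length_eq_zero_iff.1 (Nat.le_zero.1 this))
    obtain ⟨t', r', h5, h6⟩ := h1.of_completion hG hr₁
    refine ⟨t', r', h5, fun i => (h6.last i).trans (h2 i), fun i => (h3 i).trans (h6.length i), ?_⟩
    intro i v hv
    rcases h6.mem i v hv with hv | ⟨rfl, ⟨p, hp, q, hq, hpq, hp', hq'⟩ | ⟨a, b, hab, ha, hb⟩⟩
    · exact h4 i v hv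
    · exact hS i v p q hx (h4 i p hp) (h4 i q hq) hpq (hle' hp') (hle' hq')
    · exact hS' v a b hab _ (h4 a _ (by simp)) _ (h4 b _ (by simp)) hx (hle' ha) (hle' hb) i

end ClawFree

/-! ### Dominating trails or thetas in graphs whose cuts have at least two edges. -/

namespace ClawFree

variable {X : Type*}

open List Relation

theorem exists_max_of_bounded {α : Type*} {P : α → Prop} (f : α → ℕ) (N : ℕ)
    (hN : ∀ a, P a → f a ≤ N) {a : α} (ha : P a) : ∃ b, P b ∧ ∀ c, P c → f c ≤ f b := by
  induction hk : N - f a using Nat.strong_induction_on generalizing a with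
  | _ k ih =>
  by_cases h : ∀ c, P c → f c ≤ f a
  · exact ⟨a, ha, h⟩
  push Not at h
  obtain ⟨c, hc, hac⟩ := h
  have := hN c hc
  exact ih (N - f c) (by omega) hc rfl

theorem exists_chain_of_reach {F : SimpleGraph X} {W : Set X} {a b : X} (ha : a ∈ W)
    (h : ReflTransGen (fun p q => F.Adj p q ∧ p ∈ W ∧ q ∈ W) a b) :
    ∃ l : List X, l.Nodup ∧ List.IsChain F.Adj l ∧ l.head? = some a ∧ l.getLast? = some b ∧
      ∀ v ∈ l, v ∈ W := by
  induction h using ReflTransGen.head_induction_on with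
  | refl => exact ⟨[b], by simp, by simp, rfl, rfl, by simpa using ha⟩
  | head h h' ih =>
    rename_i a c
    obtain ⟨l, h1, h2, h3, h4, h5⟩ := ih h.2.2
    by_cases hal : a ∈ l
    · obtain ⟨s, t, rfl⟩ := List.append_of_mem hal
      refine ⟨a :: t, (List.nodup_append.1 h1).2.1, (List.isChain_append.1 h2).2.1, rfl, ?_,
        fun v hv => h5 v (List.mem_append_right _ hv)⟩
      rw [← h4]; simp [List.getLast?_append, List.getLast?_cons]
    · rcases l with _ | ⟨d, l⟩
      · simp at h3
      obtain rfl : d = c := by simpa using h3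
      refine ⟨a :: d :: l, List.nodup_cons.2 ⟨hal, h1⟩, List.isChain_cons_cons.2 ⟨h.1, h2⟩, rfl,
        ?_, ?_⟩
      · rw [← h4]; simp [List.getLast?_cons]
      · intro v hv
        rcases List.mem_cons.1 hv with rfl | hv
        · exact ha
        · exact h5 v hv

theorem IsCyc.reverse {F : SimpleGraph X} {l : List X} (h : IsCyc F l) : IsCyc F l.reverse := by
  rcases l with _ | ⟨a, l⟩
  · exact h
  have hr : (a :: l.reverse) ~r (a :: l).reverse := by
    simpa using List.isRotated_append (l := [a]) (l' := l.reverse)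
  refine IsCyc.rotated ?_ hr
  rw [isCyc_iff_of_cons] at h ⊢
  refine ⟨by simpa using h.1, by simpa using h.2.1, ?_⟩
  simpa using chain_reverse h.2.2

/-- Every cut of `F[U]` has at least two edges. -/
def TwoEdgeConn (F : SimpleGraph X) (U : Set X) : Prop :=
  ∀ S ⊆ U, S.Nonempty → (U \ S).Nonempty → ∃ a ∈ S, ∃ b ∈ U \ S, ∃ c ∈ S, ∃ d ∈ U \ S,
    F.Adj a b ∧ F.Adj c d ∧ (a ≠ c ∨ b ≠ d)

/-- Every vertex outside `U` has at most one neighbour in `U`. -/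
def OuterSparse (F : SimpleGraph X) (U : Set X) : Prop :=
  ∀ y ∉ U, ∀ a ∈ U, ∀ b ∈ U, F.Adj y a → F.Adj y b → a = b

/-- `m` has a neighbour outside `U`. -/
def Marked (F : SimpleGraph X) (U : Set X) (m : X) : Prop := ∃ z ∉ U, F.Adj m z

/-- A list that is long, or a single vertex with a neighbour outside `U`. -/
def GoodLeg (F : SimpleGraph X) (U : Set X) (l : List X) : Prop :=
  2 ≤ l.length ∨ ∃ m, l = [m] ∧ Marked F U m

/-- `l` lists the interior vertices of a path of `F[U]` from `A` to `B`. -/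
structure IsLeg (F : SimpleGraph X) (U : Set X) (A B : X) (l : List X) : Prop where
  nodup : l.Nodup
  sub : ∀ v ∈ l, v ∈ U
  left : A ∉ l
  right : B ∉ l
  chain : List.IsChain F.Adj (A :: (l ++ [B]))
  good : GoodLeg F U l

/-- Three internally disjoint good paths of `F[U]` from `A` to `B`. -/
structure IsTheta (F : SimpleGraph X) (U : Set X) (A B : X) (α : Fin 3 → List X) : Prop where
  left : A ∈ U
  right : B ∈ U
  ne : A ≠ B
  leg : ∀ i, IsLeg F U A B (α i)
  disj : ∀ i j, i ≠ j → ∀ v ∈ α i, v ∉ α j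

theorem IsLeg.reverse {F : SimpleGraph X} {U : Set X} {A B : X} {l : List X}
    (h : IsLeg F U A B l) : IsLeg F U B A l.reverse where
  nodup := by simpa using h.nodup
  sub := by simpa using h.sub
  left := by simpa using h.right
  right := by simpa using h.left
  chain := by simpa using chain_reverse h.chain
  good := by
    rcases h.good with h | ⟨m, rfl, hm⟩
    · exact Or.inl (by simpa using h)
    · exact Or.inr ⟨m, by simp, hm⟩

theorem IsTheta.reverse {F : SimpleGraph X} {U : Set X} {A B : X} {α : Fin 3 → List X}
    (h : IsTheta F U A B α) : IsTheta F U B A fun i => (α i).reverse where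
  left := h.right
  right := h.left
  ne := h.ne.symm
  leg i := (h.leg i).reverse
  disj i j hij v hv := by simpa using h.disj i j hij v (by simpa using hv)

open Classical in
/-- The weight of a cycle: length first, then the number of marked vertices. -/
noncomputable def cycWeight (F : SimpleGraph X) (U : Set X) (N : ℕ) (l : List X) : ℕ :=
  l.length * (N + 1) + l.countP (Marked F U ·)

theorem cycWeight_perm {F : SimpleGraph X} {U : Set X} {N : ℕ} {l l' : List X} (h : l.Perm l') :
    cycWeight F U N l = cycWeight F U N l' := by
  rw [cycWeight, cycWeight, h.length_eq, h.countP_eq]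

/-- Exchanging the arc `α` for the ear `P` gives another cycle in `U`. By maximality `α` is at least
as long as `P`, and if `α` is a single vertex, then `P` is a single marked vertex, so `α` is marked
as well. -/
theorem arc_isLeg {F : SimpleGraph X} {U : Set X} {N : ℕ} {A B : X} {α β P : List X}
    (hcyc : IsCyc F (A :: (α ++ B :: β))) (hU : ∀ v ∈ A :: (α ++ B :: β), v ∈ U)
    (hN : (A :: (α ++ B :: β)).length ≤ N)
    (hmax : ∀ c', IsCyc F c' → (∀ v ∈ c', v ∈ U) →
      cycWeight F U N c' ≤ cycWeight F U N (A :: (α ++ B :: β)))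
    (hP : IsLeg F U A B P) (hd : ∀ v ∈ P, v ∉ A :: (α ++ B :: β)) : IsLeg F U A B α := by
  classical
  obtain ⟨h1, h2, h3⟩ := isCyc_iff_of_cons.1 hcyc
  have e : (A :: (α ++ B :: β)) ++ [A] = (A :: (α ++ [B])) ++ (β ++ [A]) := by simp
  have hch : List.IsChain F.Adj (A :: (α ++ [B])) := by
    have : List.IsChain F.Adj ((A :: (α ++ B :: β)) ++ [A]) := h3
    rw [e] at this
    exact (List.isChain_append.1 this).1
  have hch2 : List.IsChain F.Adj (B :: (β ++ [A])) := by
    have e' : (A :: (α ++ B :: β)) ++ [A] = (A :: α) ++ (B :: (β ++ [A])) := by simp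
    have : List.IsChain F.Adj ((A :: (α ++ B :: β)) ++ [A]) := h3
    rw [e'] at this
    exact (List.isChain_append.1 this).2.1
  have hn : α.Nodup ∧ β.Nodup ∧ A ∉ α ∧ A ∉ β ∧ B ∉ α ∧ B ∉ β ∧ A ≠ B ∧ ∀ v ∈ α, v ∉ β := by
    simp only [List.nodup_cons, List.mem_append, List.mem_cons, not_or, List.nodup_append] at h1
    obtain ⟨⟨h4, h5, h6⟩, h7, ⟨h8, h9⟩, h10⟩ := h1
    refine ⟨h7, h9, h4, h6, fun h => h10 B h B (by simp) rfl, h8, h5, fun v hv hv' => ?_⟩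
    exact h10 v hv v (by simp [hv']) rfl
  obtain ⟨n1, n2, n3, n4, n5, n6, n7, n8⟩ := hn
  have hPA := hP.left
  have hPB := hP.right
  have hdβ : ∀ v ∈ P, v ∉ β := fun v hv h => hd v hv (by simp [h])
  have hPne : 1 ≤ P.length := by
    rcases hP.good with h | ⟨m, rfl, -⟩
    · omega
    · simp
  have hcyc' : IsCyc F (A :: (P ++ B :: β)) := by
    rw [isCyc_iff_of_cons]
    refine ⟨?_, by simp; omega, ?_⟩
    · simp only [List.nodup_cons, List.mem_append, List.mem_cons, not_or, List.nodup_append]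
      refine ⟨⟨hPA, n7, n4⟩, hP.nodup, ⟨n6, n2⟩, ?_⟩
      rintro a ha b hb rfl
      rcases hb with rfl | hb
      · exact hPB ha
      · exact hdβ a ha hb
    · have := (List.isChain_split (R := F.Adj) (c := B) (l₁ := A :: P) (l₂ := β ++ [A])).2
        ⟨by simpa using hP.chain, hch2⟩
      simpa using this
  have hw := hmax _ hcyc' (by
    intro v hv
    simp only [List.mem_cons, List.mem_append] at hv
    rcases hv with rfl | hv | rfl | hv
    · exact hU _ (by simp)
    · exact hP.sub v hv
    · exact hU _ (by simp)
    · exact hU _ (by simp [hv]))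
  refine ⟨n1, fun v hv => hU v (by simp [hv]), n3, n5, hch, ?_⟩
  simp only [cycWeight, List.countP_cons, List.countP_append, List.length_cons,
    List.length_append] at hw hN
  have c1 := List.countP_le_length (p := fun x => decide (Marked F U x)) (l := α)
  have c2 := List.countP_le_length (p := fun x => decide (Marked F U x)) (l := P)
  set u := (if decide (Marked F U A) = true then 1 else 0) with hu
  set w := (if decide (Marked F U B) = true then 1 else 0) with hw'
  have hu1 : u ≤ 1 := by rw [hu]; split_ifs <;> omega
  have hw1 : w ≤ 1 := by rw [hw']; split_ifs <;> omega
  have c3 := List.countP_le_length (p := fun x => decide (Marked F U x)) (l := β)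
  -- The old cycle has at most `N` marked vertices, so the factor `N + 1` lets length decide first.
  have hlen : P.length ≤ α.length := by
    by_contra hlt
    have h4 : (α.length + (β.length + 1) + 1 + 1) * (N + 1) ≤
        (P.length + (β.length + 1) + 1) * (N + 1) := Nat.mul_le_mul_right _ (by omega)
    have h5 : (α.length + (β.length + 1) + 1 + 1) * (N + 1) =
      (α.length + (β.length + 1) + 1) * (N + 1) + (N + 1) := by ring
    omega
  by_cases h2α : 2 ≤ α.length
  · exact Or.inl h2α
  right
  obtain ⟨a, rfl⟩ := List.length_eq_one_iff.1 (show α.length = 1 by omega)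
  obtain ⟨m, rfl, hm⟩ := hP.good.resolve_left (by simp at hlen; omega)
  refine ⟨a, rfl, ?_⟩
  by_contra ha
  simp [hm, ha] at hw

/-- The exchange argument applies to both arcs between `A` and `B`, the second after reversing the
cycle; the ear is the third leg. -/
theorem exists_theta_of_ear {F : SimpleGraph X} {U : Set X} {N : ℕ} {c : List X}
    (hcyc : IsCyc F c) (hU : ∀ v ∈ c, v ∈ U) (hN : c.length ≤ N)
    (hmax : ∀ c', IsCyc F c' → (∀ v ∈ c', v ∈ U) → cycWeight F U N c' ≤ cycWeight F U N c)
    {A B : X} (hA : A ∈ c) (hB : B ∈ c) (hAB : A ≠ B) {P : List X} (hP : IsLeg F U A B P)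
    (hd : ∀ v ∈ P, v ∉ c) : ∃ α, IsTheta F U A B α := by
  obtain ⟨m, hm⟩ := List.exists_isRotated_cons hA
  have hBm : B ∈ m := by
    have := hm.mem_iff.1 hB
    rw [List.mem_cons] at this
    exact this.resolve_left hAB.symm
  obtain ⟨α, β, rfl⟩ := List.append_of_mem hBm
  have hα := arc_isLeg (hcyc.rotated hm) (fun v hv => hU v (hm.mem_iff.2 hv))
    (hm.perm.length_eq ▸ hN) (fun c' h h' => (hmax c' h h').trans (cycWeight_perm hm.perm).le) hP
    (fun v hv hv' => hd v hv (hm.mem_iff.2 hv'))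
  have hm' : c.reverse ~r (A :: (β.reverse ++ B :: α.reverse)) := by
    refine hm.reverse.trans ?_
    have := List.isRotated_append (l := β.reverse ++ B :: α.reverse) (l' := [A])
    simpa using this
  have hp' : c.Perm (A :: (β.reverse ++ B :: α.reverse)) :=
    (List.reverse_perm c).symm.trans hm'.perm
  have hβ := arc_isLeg (hcyc.reverse.rotated hm') (fun v hv => hU v (hp'.mem_iff.2 hv))
    (hp'.length_eq ▸ hN) (fun c' h h' => (hmax c' h h').trans (cycWeight_perm hp').le) hP
    (fun v hv hv' => hd v hv (hp'.mem_iff.2 hv'))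
  have hnd := (hm.nodup_iff.1 hcyc.1)
  have hαβ : ∀ v ∈ α, v ∉ β.reverse := by
    intro v hv hv'
    rw [List.mem_reverse] at hv'
    rw [List.nodup_cons, List.nodup_append] at hnd
    exact hnd.2.2.2 v hv v (by simp [hv']) rfl
  have hPα : ∀ v ∈ P, v ∉ α := fun v hv h => hd v hv (hm.mem_iff.2 (by simp [h]))
  have hPβ : ∀ v ∈ P, v ∉ β.reverse := fun v hv h => by
    rw [List.mem_reverse] at h
    exact hd v hv (hm.mem_iff.2 (by simp [h]))
  refine ⟨![P, α, β.reverse], hU A hA, hU B hB, hAB, ?_, ?_⟩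
  · intro i
    fin_cases i
    · exact hP
    · exact hα
    · exact hβ
  · intro i j hij
    fin_cases i <;> fin_cases j
    · exact absurd rfl hij
    · exact hPα
    · exact hPβ
    · exact fun v hv hv' => hPα v hv' hv
    · exact absurd rfl hij
    · exact hαβ
    · exact fun v hv hv' => hPβ v hv' hv
    · exact fun v hv hv' => hαβ v hv' hv
    · exact absurd rfl hij

/-- `F[U]` has no cut vertex. -/
def NoCut (F : SimpleGraph X) (U : Set X) : Prop :=
  ∀ x ∈ U, ∀ W ⊆ U, x ∉ W → W.Nonempty → ∀ y ∈ U, y ≠ x → y ∉ W →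
    ∃ a ∈ W, ∃ b ∈ U, b ∉ W ∧ b ≠ x ∧ F.Adj a b

/-- Two edges leave a vertex, and since it is not a cut vertex, their other ends are joined by a
path avoiding it. -/
theorem exists_cycle {F : SimpleGraph X} {U : Set X} (h2 : TwoEdgeConn F U) (hU : U.Nontrivial)
    (hcut : NoCut F U) : ∃ c, IsCyc F c ∧ ∀ v ∈ c, v ∈ U := by
  obtain ⟨a, ha⟩ := hU.nonempty
  obtain ⟨z, hz, hza⟩ := hU.exists_ne a
  obtain ⟨p, h1, b, hb, a', h2', c, hc, hab, hac, hne⟩ := h2 {a} (by simpa using ha) (by simp)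
    ⟨z, hz, by simpa using hza⟩
  obtain rfl := h1
  obtain rfl := h2'
  replace hne := hne.resolve_left (by simp)
  set W : Set X := U \ {a'} with hW
  set R := fun p q => F.Adj p q ∧ p ∈ W ∧ q ∈ W with hR
  have hreach : ReflTransGen R b c := by
    by_contra hcon
    obtain ⟨p, hp, q, hq, hq', hqa, hpq⟩ := hcut a' ha {v | v ∈ W ∧ ReflTransGen R b v}
      (fun v hv => hv.1.1) (fun h => h.1.2 rfl) ⟨b, hb, .refl⟩ c hc.1 hc.2 (fun h => hcon h.2)
    have hqW : q ∈ W := ⟨hq, hqa⟩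
    exact hq' ⟨hqW, hp.2.tail ⟨hpq, hp.1, hqW⟩⟩
  obtain ⟨l, l1, l2, l3, l4, l5⟩ := exists_chain_of_reach hb hreach
  rcases l with _ | ⟨b', l⟩
  · simp at l3
  obtain rfl : b' = b := by simpa using l3
  refine ⟨a' :: b' :: l, isCyc_iff_of_cons.2 ⟨List.nodup_cons.2 ⟨fun h => (l5 _ h).2 rfl, l1⟩, ?_, ?_⟩,
    ?_⟩
  · rcases l with _ | ⟨d, l⟩
    · simp at l4; exact absurd l4 hne
    · simp
  · have : List.IsChain F.Adj ((b' :: l) ++ [a']) := by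
      rw [List.isChain_append]
      refine ⟨l2, by simp, ?_⟩
      intro x hx y hy
      rw [l4] at hx
      simp at hx hy
      subst hx hy
      exact hac.symm
    exact List.isChain_cons_cons.2 ⟨hab, this⟩
  · intro v hv
    rcases List.mem_cons.1 hv with rfl | hv
    · exact ha
    · exact (l5 v hv).1

/-- The ear runs through the component `S` of `r₁` off the cycle. To be good it needs two interior
vertices, so distinct vertices of `S` must leave to distinct vertices of the cycle. -/
theorem exists_ear {F : SimpleGraph X} {U : Set X} (hcut : NoCut F U) {c : List X}
    (hcyc : IsCyc F c) (hU : ∀ v ∈ c, v ∈ U) {r₁ r₂ : X} (h1 : r₁ ∈ U) (h2 : r₂ ∈ U)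
    (h1c : r₁ ∉ c) (h2c : r₂ ∉ c) (hr : F.Adj r₁ r₂) :
    ∃ A ∈ c, ∃ B ∈ c, A ≠ B ∧ ∃ P, IsLeg F U A B P ∧ ∀ v ∈ P, v ∉ c := by
  set W : Set X := {v | v ∈ U ∧ v ∉ c} with hW
  set R := fun p q => F.Adj p q ∧ p ∈ W ∧ q ∈ W with hR
  have hsymm : ∀ p q, ReflTransGen R p q → ReflTransGen R q p := fun p q h => by
    rw [← reflTransGen_swap]
    exact ReflTransGen.mono (fun a b hab => ⟨hab.1.symm, hab.2.2, hab.2.1⟩) _ _ h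
  have hw1 : r₁ ∈ W := ⟨h1, h1c⟩
  have hw2 : r₂ ∈ W := ⟨h2, h2c⟩
  set S : Set X := {v | v ∈ W ∧ ReflTransGen R r₁ v} with hS
  have hs1 : r₁ ∈ S := ⟨hw1, .refl⟩
  have hs2 : r₂ ∈ S := ⟨hw2, .single ⟨hr, hw1, hw2⟩⟩
  have hclosed : ∀ p ∈ S, ∀ q ∈ U, q ∉ S → F.Adj p q → q ∈ c := by
    intro p hp q hq hqS hpq
    by_contra hqc
    have hqW : q ∈ W := ⟨hq, hqc⟩
    exact hqS ⟨hqW, hp.2.tail ⟨hpq, hp.1, hqW⟩⟩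
  obtain ⟨A₀, B₀, hA₀, hB₀, hAB₀⟩ : ∃ A₀ B₀, A₀ ∈ c ∧ B₀ ∈ c ∧ A₀ ≠ B₀ := by
    obtain ⟨hn, hl, -⟩ := hcyc
    rcases c with _ | ⟨x, _ | ⟨y, c⟩⟩
    · simp at hl
    · simp at hl
    · refine ⟨x, y, by simp, by simp, ?_⟩
      rintro rfl
      simp at hn
  have main : ∀ s ∈ S, ∀ s' ∈ S, s ≠ s' → ∀ A ∈ c, ∀ B ∈ c, A ≠ B → F.Adj s A → F.Adj s' B →
      ∃ A ∈ c, ∃ B ∈ c, A ≠ B ∧ ∃ P, IsLeg F U A B P ∧ ∀ v ∈ P, v ∉ c := by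
    intro s hs s' hs' hne A hA B hB hAB hsA hsB
    obtain ⟨l, l1, l2, l3, l4, l5⟩ := exists_chain_of_reach hs.1 ((hsymm _ _ hs.2).trans hs'.2)
    refine ⟨A, hA, B, hB, hAB, l, ⟨l1, fun v hv => (l5 v hv).1, fun h => (l5 _ h).2 hA,
      fun h => (l5 _ h).2 hB, ?_, ?_⟩, fun v hv => (l5 v hv).2⟩
    · rw [List.isChain_cons]
      constructor
      · intro y hy
        rw [List.head?_append, l3] at hy
        obtain rfl : s = y := by simpa using hy
        exact hsA.symm
      · rw [List.isChain_append]
        refine ⟨l2, by simp, ?_⟩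
        intro x hx y hy
        rw [l4] at hx
        simp at hx hy
        subst hx hy
        exact hsB
    · left
      rcases l with _ | ⟨d, _ | ⟨d', l⟩⟩
      · simp at l3
      · simp at l3 l4
        exact absurd (l3.symm.trans l4) hne
      · simp
  obtain ⟨s, hs, A, hA, hAS, hAr, hsA⟩ := hcut r₁ h1 (S \ {r₁}) (fun v hv => hv.1.1.1)
    (fun h => h.2 rfl) ⟨r₂, hs2, hr.ne.symm⟩ A₀ (hU _ hA₀) (fun h => h1c (h ▸ hA₀))
    (fun h => h.1.1.2 hA₀)
  have hAc : A ∈ c := hclosed s hs.1 A hA (fun h => hAS ⟨h, hAr⟩) hsA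
  obtain ⟨s', hs', B, hB, hBS, hBr, hsB⟩ := hcut s hs.1.1.1 (S \ {s}) (fun v hv => hv.1.1.1)
    (fun h => h.2 rfl) ⟨r₁, hs1, fun h => hs.2 h.symm⟩ A₀ (hU _ hA₀)
    (fun h => hs.1.1.2 (h ▸ hA₀)) (fun h => h.1.1.2 hA₀)
  have hBc : B ∈ c := hclosed s' hs'.1 B hB (fun h => hBS ⟨h, hBr⟩) hsB
  -- If `s` and `s'` both leave to `A`, then `A` not being a cut vertex gives a third exit, from
  -- `s''` to some other `C`; and `s''` differs from `s` or from `s'`.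
  by_cases hAB : A = B
  · subst hAB
    obtain ⟨B', hB', hBA⟩ : ∃ B' ∈ c, B' ≠ A := by
      by_cases h : A₀ = A
      · exact ⟨B₀, hB₀, fun h' => hAB₀ (h.trans h'.symm)⟩
      · exact ⟨A₀, hA₀, h⟩
    obtain ⟨s'', hs'', C, hC, hCS, hCA, hsC⟩ := hcut A hA S (fun v hv => hv.1.1)
      (fun h => h.1.2 hAc) ⟨r₁, hs1⟩ B' (hU _ hB') hBA (fun h => h.1.2 hB')
    have hCc : C ∈ c := hclosed s'' hs'' C hC hCS hsC
    by_cases h : s'' = s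
    · subst h
      exact main s'' hs'' s' hs'.1 (fun h => hs'.2 h.symm) C hCc A hAc hCA hsC hsB
    · exact main s'' hs'' s hs.1 h C hCc A hAc hCA hsC hsA
  · exact main s hs.1 s' hs'.1 (fun h => hs'.2 h.symm) A hAc B hBc hAB hsA hsB

/-- A graph part with all cuts of size at least two satisfies every property `T` that holds for
dominating cycles and is preserved by gluing at a vertex, unless it contains a good theta. -/
theorem theta_or_of_twoEdgeConn [Finite X] {F : SimpleGraph X} {T : Set X → Prop}
    (hc : ∀ U c, IsCyc F c → (∀ v ∈ c, v ∈ U) → (∀ m ∈ U, Marked F U m → m ∈ c) →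
      (∀ a ∈ U, ∀ b ∈ U, F.Adj a b → a ∈ c ∨ b ∈ c) → T U)
    (hm : ∀ U₁ U₂ x, x ∈ U₁ → x ∈ U₂ → (∀ v ∈ U₁, v ∈ U₂ → v = x) →
      (∀ a ∈ U₁, ∀ b ∈ U₂, F.Adj a b → a = x ∨ b = x) → (∃ a ∈ U₁, F.Adj x a) →
      (∃ b ∈ U₂, F.Adj x b) → T U₁ → T U₂ → T (U₁ ∪ U₂))
    {U : Set X} (h2 : TwoEdgeConn F U) (hJ : OuterSparse F U) (hU : U.Nontrivial) :
    T U ∨ ∃ U' A B α, OuterSparse F U' ∧ IsTheta F U' A B α := by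
  classical
  induction hk : U.ncard using Nat.strong_induction_on generalizing U with
  | _ k ih =>
  by_cases hcut : NoCut F U
  · obtain ⟨c₀, hc₀⟩ := exists_cycle h2 hU hcut
    have := Fintype.ofFinite X
    set N := Fintype.card X
    have hlen : ∀ c, IsCyc F c → c.length ≤ N := fun c hc => hc.1.length_le_card
    obtain ⟨c, ⟨hc1, hc2⟩, hmax⟩ := exists_max_of_bounded
      (P := fun c => IsCyc F c ∧ ∀ v ∈ c, v ∈ U) (cycWeight F U N) (N * (N + 1) + N)
      (fun c hc' => Nat.add_le_add (Nat.mul_le_mul_right _ (hlen c hc'.1))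
        (List.countP_le_length.trans (hlen c hc'.1))) hc₀
    replace hmax : ∀ c', IsCyc F c' → (∀ v ∈ c', v ∈ U) → cycWeight F U N c' ≤ cycWeight F U N c :=
      fun c' h h' => hmax c' ⟨h, h'⟩
    by_cases hdom : ∀ a ∈ U, ∀ b ∈ U, F.Adj a b → a ∈ c ∨ b ∈ c
    · by_cases hmark : ∀ m ∈ U, Marked F U m → m ∈ c
      · exact Or.inl (hc U c hc1 hc2 hmark hdom)
      -- The cycle meets every edge but misses the marked vertex `m`: the two edges leaving `m` end
      -- on the cycle, so `m` alone is a good ear.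
      push Not at hmark
      obtain ⟨m, hmU, hm', hmc⟩ := hmark
      obtain ⟨z, hz, hzm⟩ := hU.exists_ne m
      obtain ⟨p, h1, A, hA, m', h2', B, hB, hAm, hBm, hne⟩ := h2 {m} (by simpa using hmU) (by simp)
        ⟨z, hz, by simpa using hzm⟩
      obtain rfl := h1
      obtain rfl := h2'
      replace hne := hne.resolve_left (by simp)
      have hAc : A ∈ c := (hdom _ hmU A hA.1 hAm).resolve_left hmc
      have hBc : B ∈ c := (hdom _ hmU B hB.1 hBm).resolve_left hmc
      obtain ⟨α, hα⟩ := exists_theta_of_ear hc1 hc2 (hlen c hc1) hmax hAc hBc hne (P := [m'])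
        ⟨by simp, by simpa using hmU, by simpa using hAm.ne.symm, by simpa using hBm.ne.symm,
          by simp [hAm.symm, hBm], Or.inr ⟨m', rfl, hm'⟩⟩ (by simpa using hmc)
      exact Or.inr ⟨U, A, B, α, hJ, hα⟩
    · push Not at hdom
      obtain ⟨a, ha, b, hb, hab, hac, hbc⟩ := hdom
      obtain ⟨A, hA, B, hB, hAB, P, hP, hPc⟩ := exists_ear hcut hc1 hc2 ha hb hac hbc hab
      obtain ⟨α, hα⟩ := exists_theta_of_ear hc1 hc2 (hlen c hc1) hmax hA hB hAB hP hPc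
      exact Or.inr ⟨U, A, B, α, hJ, hα⟩
  · simp only [NoCut] at hcut
    push Not at hcut
    obtain ⟨x, hx, W, hW, hxW, hWne, y, hy, hyx, hyW, hno⟩ := hcut
    -- At a cut vertex `x`, either side together with `x` inherits the hypotheses, because edges of
    -- `U` leaving a subset of `W` stay in `insert x W`.
    have part : ∀ W ⊆ U, x ∉ W → W.Nonempty → (∃ y ∈ U, y ≠ x ∧ y ∉ W) →
        (∀ a ∈ W, ∀ b ∈ U, b ∉ W → b ≠ x → ¬ F.Adj a b) →
        (∃ a ∈ insert x W, F.Adj x a) ∧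
        (T (insert x W) ∨ ∃ U' A B α, OuterSparse F U' ∧ IsTheta F U' A B α) := by
      intro W hW hxW hWne ⟨y, hy, hyx, hyW⟩ hno
      have hsub : insert x W ⊆ U := Set.insert_subset hx hW
      constructor
      · obtain ⟨a, ha, b, hb, -, -, -, -, hab, -⟩ := h2 W hW hWne ⟨y, hy, hyW⟩
        refine ⟨a, Or.inr ha, ?_⟩
        by_cases hbx : b = x
        · exact hbx ▸ hab.symm
        · exact absurd hab (hno a ha b hb.1 hb.2 hbx)
      · refine ih _ ?_ ?_ ?_ ?_ rfl
        · rw [← hk]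
          refine Set.ncard_lt_ncard ⟨hsub, fun h => ?_⟩ (Set.toFinite _)
          rcases h hy with h | h
          · exact hyx h
          · exact hyW h
        · have aux : ∀ S ⊆ W, S.Nonempty → ∃ a ∈ S, ∃ b ∈ insert x W \ S, ∃ a' ∈ S,
              ∃ b' ∈ insert x W \ S, F.Adj a b ∧ F.Adj a' b' ∧ (a ≠ a' ∨ b ≠ b') := by
            intro S hS hSne
            obtain ⟨a, ha, b, hb, a', ha', b', hb', h1, h2', h3⟩ := h2 S (hS.trans hW) hSne
              ⟨y, hy, fun h => hyW (hS h)⟩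
            have key : ∀ a ∈ S, ∀ b ∈ U \ S, F.Adj a b → b ∈ insert x W \ S := by
              intro a ha b hb hab
              refine ⟨?_, hb.2⟩
              by_contra hbW
              simp only [Set.mem_insert_iff, not_or] at hbW
              exact hno a (hS ha) b hb.1 hbW.2 hbW.1 hab
            exact ⟨a, ha, b, key a ha b hb h1, a', ha', b', key a' ha' b' hb' h2', h1, h2', h3⟩
          intro S hS hSne hSc
          by_cases hxS : x ∈ S
          · have hsub' : insert x W \ S ⊆ W := fun v hv => hv.1.resolve_left fun h => hv.2 (h ▸ hxS)
            obtain ⟨a, ha, b, hb, a', ha', b', hb', h1, h2', h3⟩ := aux _ hsub' hSc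
            rw [Set.sdiff_sdiff_cancel_left hS] at hb hb'
            exact ⟨b, hb, a, ha, b', hb', a', ha', h1.symm, h2'.symm, h3.symm⟩
          · exact aux S (fun v hv => (hS hv).resolve_left fun h => hxS (h ▸ hv)) hSne
        · intro y hyU a ha b hb hya hyb
          by_cases hyU' : y ∈ U
          · simp only [Set.mem_insert_iff, not_or] at hyU
            have key : ∀ a ∈ insert x W, F.Adj y a → a = x := fun a ha hya =>
              ha.resolve_right fun h => hno a h y hyU' hyU.2 hyU.1 hya.symm
            rw [key a ha hya, key b hb hyb]
          · exact hJ y hyU' a (hsub ha) b (hsub hb) hya hyb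
        · obtain ⟨w, hw⟩ := hWne
          exact ⟨x, Or.inl rfl, w, Or.inr hw, fun h => hxW (h ▸ hw)⟩
    obtain ⟨n1, p1⟩ := part W hW hxW hWne ⟨y, hy, hyx, hyW⟩ hno
    have hno' : ∀ a ∈ (U \ W) \ {x}, ∀ b ∈ U, b ∉ (U \ W) \ {x} → b ≠ x → ¬ F.Adj a b := by
      intro a ha b hb hbW hbx hab
      have hbW' : b ∈ W := by
        by_contra h
        exact hbW ⟨⟨hb, h⟩, hbx⟩
      exact hno b hbW' a ha.1.1 ha.1.2 ha.2 hab.symm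
    obtain ⟨w, hw⟩ := hWne
    obtain ⟨n2, p2⟩ := part ((U \ W) \ {x}) (fun v hv => hv.1.1) (fun h => h.2 rfl)
      ⟨y, ⟨hy, hyW⟩, hyx⟩ ⟨w, hW hw, fun h => hxW (h ▸ hw), fun h => h.1.2 hw⟩ hno'
    rcases p1 with p1 | p1
    · rcases p2 with p2 | p2
      · left
        have e : insert x W ∪ insert x ((U \ W) \ {x}) = U := by
          ext v
          simp only [Set.mem_union, Set.mem_insert_iff, Set.mem_sdiff, Set.mem_singleton_iff]
          constructor
          · rintro ((rfl | h) | (rfl | h))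
            · exact hx
            · exact hW h
            · exact hx
            · exact h.1.1
          · intro h
            by_cases h1 : v = x <;> by_cases h2 : v ∈ W <;> simp [h, h1, h2]
        rw [← e]
        refine hm _ _ x (Or.inl rfl) (Or.inl rfl) ?_ ?_ n1 n2 p1 p2
        · rintro v (rfl | h) (h' | h')
          · rfl
          · rfl
          · exact h'
          · exact absurd h h'.1.2
        · rintro a (rfl | ha) b (rfl | hb) hab
          · exact Or.inl rfl
          · exact Or.inl rfl
          · exact Or.inr rfl
          · exact absurd hab (hno a ha b hb.1.1 hb.1.2 hb.2)
      · exact Or.inr p2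
    · exact Or.inr p1

end ClawFree

/-! ### The root graph of a claw-free, diamond-free graph. -/

namespace ClawFree

variable {V : Type*}

open List

/-- The clique generated by an edge `uv` of a diamond-free graph. -/
def line (D : SimpleGraph V) (u v : V) : Set V := {w | w = u ∨ w = v ∨ (D.Adj w u ∧ D.Adj w v)}

theorem left_mem_line (D : SimpleGraph V) (u v : V) : u ∈ line D u v := Or.inl rfl

theorem right_mem_line (D : SimpleGraph V) (u v : V) : v ∈ line D u v := Or.inr (Or.inl rfl)

theorem adj_of_mem_line {D : SimpleGraph V} (hD : DiamondFree D) {u v p q : V} (huv : D.Adj u v)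
    (hp : p ∈ line D u v) (hq : q ∈ line D u v) (hpq : p ≠ q) : D.Adj p q := by
  rcases hp with rfl | rfl | ⟨h1, h2⟩
  · rcases hq with rfl | rfl | ⟨h3, h4⟩
    · exact absurd rfl hpq
    · exact huv
    · exact h3.symm
  · rcases hq with rfl | rfl | ⟨h3, h4⟩
    · exact huv.symm
    · exact absurd rfl hpq
    · exact h4.symm
  · rcases hq with rfl | rfl | ⟨h3, h4⟩
    · exact h1
    · exact h2
    · exact hD u p v q h1.symm huv h3.symm h2 h4.symm hpq

theorem line_eq {D : SimpleGraph V} (hD : DiamondFree D) {u v p q : V} (huv : D.Adj u v)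
    (hp : p ∈ line D u v) (hq : q ∈ line D u v) (hpq : p ≠ q) : line D u v = line D p q := by
  have hadj := fun a b ha hb hab => adj_of_mem_line hD huv (p := a) (q := b) ha hb hab
  have hpq' := hadj p q hp hq hpq
  ext w
  constructor
  · intro hw
    by_cases h1 : w = p
    · exact Or.inl h1
    by_cases h2 : w = q
    · exact Or.inr (Or.inl h2)
    exact Or.inr (Or.inr ⟨hadj _ _ hw hp h1, hadj _ _ hw hq h2⟩)
  · intro hw
    have key : ∀ z ∈ line D u v, w ≠ z → D.Adj w z := by
      intro z hz hwz
      rcases hw with rfl | rfl | ⟨h1, h2⟩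
      · exact hadj _ _ hp hz hwz
      · exact hadj _ _ hq hz hwz
      · by_cases h3 : z = p
        · exact h3 ▸ h1
        by_cases h4 : z = q
        · exact h4 ▸ h2
        exact hD p w q z h1.symm hpq' (hadj _ _ hp hz (Ne.symm h3)) h2
          (hadj _ _ hq hz (Ne.symm h4)) hwz
    by_cases h1 : w = u
    · exact Or.inl h1
    by_cases h2 : w = v
    · exact Or.inr (Or.inl h2)
    exact Or.inr (Or.inr ⟨key _ (left_mem_line D u v) h1, key _ (right_mem_line D u v) h2⟩)

/-- A maximal clique with at least two vertices. -/
def IsLine (D : SimpleGraph V) (K : Set V) : Prop := ∃ u v, D.Adj u v ∧ K = line D u v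

/-- The nodes of `D`: the lines, and the singletons of simplicial vertices. -/
def Node (D : SimpleGraph V) : Type _ :=
  {K : Set V // IsLine D K ∨ ∃ v, Simplicial D v ∧ K = {v}}

instance (D : SimpleGraph V) : Membership V (Node D) := ⟨fun K v => v ∈ K.1⟩

instance (D : SimpleGraph V) [Finite V] : Finite (Node D) := inferInstanceAs (Finite {_K : Set V // _})

theorem Node.adj {D : SimpleGraph V} (hD : DiamondFree D) {K : Node D} {p q : V} (hp : p ∈ K)
    (hq : q ∈ K) (hpq : p ≠ q) : D.Adj p q := by
  change p ∈ K.1 at hp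
  change q ∈ K.1 at hq
  rcases K.2 with ⟨u, v, huv, h⟩ | ⟨v, -, h⟩ <;> rw [h] at hp hq
  · exact adj_of_mem_line hD huv hp hq hpq
  · exact absurd ((Set.mem_singleton_iff.1 hp).trans (Set.mem_singleton_iff.1 hq).symm) hpq

/-- Both nodes are the line spanned by `p` and `q`. Hence an edge of `nodeGraph D` carries exactly
one vertex of `D`. -/
theorem Node.eq_of_mem {D : SimpleGraph V} (hD : DiamondFree D) {K L : Node D} {p q : V}
    (hp : p ∈ K) (hq : q ∈ K) (hp' : p ∈ L) (hq' : q ∈ L) (hpq : p ≠ q) : K = L := by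
  have key : ∀ K : Node D, p ∈ K → q ∈ K → K.1 = line D p q := by
    intro K hp hq
    change p ∈ K.1 at hp
    change q ∈ K.1 at hq
    rcases K.2 with ⟨u, v, huv, h⟩ | ⟨v, -, h⟩ <;> rw [h] at hp hq ⊢
    · exact line_eq hD huv hp hq hpq
    · exact absurd ((Set.mem_singleton_iff.1 hp).trans (Set.mem_singleton_iff.1 hq).symm) hpq
  exact Subtype.ext ((key K hp hq).trans (key L hp' hq').symm)

/-- The node spanned by an edge. -/
def edgeNode {D : SimpleGraph V} {u v : V} (h : D.Adj u v) : Node D :=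
  ⟨line D u v, Or.inl ⟨u, v, h, rfl⟩⟩

theorem left_mem_edgeNode {D : SimpleGraph V} {u v : V} (h : D.Adj u v) : u ∈ edgeNode h :=
  left_mem_line D u v

theorem right_mem_edgeNode {D : SimpleGraph V} {u v : V} (h : D.Adj u v) : v ∈ edgeNode h :=
  right_mem_line D u v

/-- The node of a simplicial vertex. -/
def singletonNode {D : SimpleGraph V} {v : V} (h : Simplicial D v) : Node D :=
  ⟨{v}, Or.inr ⟨v, h, rfl⟩⟩

theorem mem_singletonNode {D : SimpleGraph V} {v w : V} (h : Simplicial D v) :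
    w ∈ singletonNode h ↔ w = v := Iff.rfl

/-- A simplicial vertex has its line and its singleton. Otherwise two nonadjacent neighbours span
two lines at `v`, and a third line would give a claw. The singletons are added as nodes so that the
count is two in every case. -/
theorem Node.exists_two {D : SimpleGraph V} (hD : DiamondFree D) (hc : NoClaw D) {v u : V}
    (h : D.Adj v u) : ∃ K L : Node D, K ≠ L ∧ v ∈ K ∧ v ∈ L ∧ ∀ M : Node D, v ∈ M → M = K ∨ M = L := by
  by_cases hs : Simplicial D v
  · refine ⟨edgeNode h, singletonNode hs, ?_, left_mem_edgeNode h, rfl, ?_⟩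
    · intro he
      have : u ∈ singletonNode hs := he ▸ right_mem_edgeNode h
      exact h.ne ((mem_singletonNode hs).1 this).symm
    · intro M hM
      by_cases hw : ∃ w ∈ M, w ≠ v
      · obtain ⟨w, hw, hwv⟩ := hw
        left
        have hvw : D.Adj v w := M.adj hD hM hw hwv.symm
        refine Node.eq_of_mem hD hM hw (left_mem_edgeNode h) ?_ hwv.symm
        by_cases hwu : w = u
        · exact hwu ▸ right_mem_edgeNode h
        · exact Or.inr (Or.inr ⟨hvw.symm, hs _ _ hvw h hwu⟩)
      · push Not at hw
        right
        exact Subtype.ext (Set.eq_singleton_iff_unique_mem.2 ⟨hM, hw⟩)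
  · have hs' := hs
    simp only [Simplicial] at hs
    push Not at hs
    obtain ⟨a, b, ha, hb, hab, hnab⟩ := hs
    refine ⟨edgeNode ha, edgeNode hb, ?_, left_mem_edgeNode ha, left_mem_edgeNode hb, ?_⟩
    · intro he
      have : b ∈ edgeNode ha := he ▸ right_mem_edgeNode hb
      exact hnab (Node.adj hD (right_mem_edgeNode ha) this hab)
    · intro M hM
      obtain ⟨w, hw, hwv⟩ : ∃ w ∈ M, w ≠ v := by
        obtain ⟨M, ⟨x, y, hxy, rfl⟩ | ⟨x, hx, rfl⟩⟩ := M
        · by_cases hxv : x = v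
          · exact ⟨y, right_mem_line D x y, fun h => hxy.ne (hxv.trans h.symm)⟩
          · exact ⟨x, left_mem_line D x y, hxv⟩
        · obtain rfl : v = x := hM
          exact absurd hx hs'
      have hvw : D.Adj v w := M.adj hD hM hw hwv.symm
      have key : ∀ z (hz : D.Adj v z), w = z ∨ D.Adj w z → M = edgeNode hz := by
        intro z hz h'
        refine Node.eq_of_mem hD hM hw (left_mem_edgeNode hz) ?_ hwv.symm
        rcases h' with rfl | h'
        · exact right_mem_edgeNode hz
        · exact Or.inr (Or.inr ⟨hvw.symm, h'⟩)
      by_cases hwa : w = a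
      · exact Or.inl (key a ha (Or.inl hwa))
      by_cases hwb : w = b
      · exact Or.inr (key b hb (Or.inl hwb))
      rcases hc v a b w ha hb hvw hab (Ne.symm hwb) (Ne.symm hwa) with hz | hz | hz
      · exact absurd hz hnab
      · exact Or.inr (key b hb (Or.inr hz.symm))
      · exact Or.inl (key a ha (Or.inr hz.symm))

/-- Three nodes through one vertex are not distinct. -/
theorem Node.eq_or_eq {D : SimpleGraph V} (hD : DiamondFree D) (hc : NoClaw D)
    (hdeg : ∀ v, ∃ u, D.Adj v u) {v : V} {K L M : Node D} (hK : v ∈ K) (hL : v ∈ L)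
    (hKL : K ≠ L) (hM : v ∈ M) : M = K ∨ M = L := by
  obtain ⟨u, hu⟩ := hdeg v
  obtain ⟨A, B, -, -, -, h⟩ := Node.exists_two hD hc hu
  rcases h K hK with rfl | rfl <;> rcases h L hL with rfl | rfl <;> rcases h M hM with rfl | rfl <;>
    simp_all

theorem Node.exists_other {D : SimpleGraph V} (hD : DiamondFree D) (hc : NoClaw D)
    (hdeg : ∀ v, ∃ u, D.Adj v u) (K : Node D) (v : V) : ∃ L : Node D, L ≠ K ∧ v ∈ L := by
  obtain ⟨u, hu⟩ := hdeg v
  obtain ⟨A, B, hAB, hA, hB, -⟩ := Node.exists_two hD hc hu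
  by_cases h : A = K
  · exact ⟨B, fun h' => hAB (h.trans h'.symm), hB⟩
  · exact ⟨A, h, hA⟩

/-- Two nodes are adjacent if they are distinct and meet. -/
def nodeGraph (D : SimpleGraph V) : SimpleGraph (Node D) where
  Adj K L := K ≠ L ∧ ∃ v, v ∈ K ∧ v ∈ L
  symm := ⟨fun _ _ ⟨h, v, h1, h2⟩ => ⟨h.symm, v, h2, h1⟩⟩
  loopless := ⟨fun _ h => h.1 rfl⟩

/-- A cycle of `D` that passes through cliques of `U` only and serves all vertices of `U`. -/
def Served (D : SimpleGraph V) (U : Set (Node D)) : Prop :=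
  ∃ c, IsCyc D c ∧ (∀ v ∈ c, ∃ K ∈ U, ∃ L ∈ U, K ≠ L ∧ v ∈ K ∧ v ∈ L) ∧
    ∀ K ∈ U, ∀ v ∈ K, ∃ L ∈ U, v ∈ L ∧ ∃ p q, ConsecIn c p q ∧ p ∈ L ∧ q ∈ L

/-- Both cycles have a consecutive pair inside the clique `x`: a vertex shared by `x` and a node of
the other part can only be served through `x`. They are disjoint, since both nodes of a common
vertex would be `x`, so they merge inside `x`. -/
theorem Served.union {D : SimpleGraph V} (hD : DiamondFree D) (hc : NoClaw D)
    (hdeg : ∀ v, ∃ u, D.Adj v u) {U₁ U₂ : Set (Node D)} {x : Node D} (hx₁ : x ∈ U₁) (hx₂ : x ∈ U₂)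
    (hU : ∀ v ∈ U₁, v ∈ U₂ → v = x) (h₁ : ∃ a ∈ U₁, (nodeGraph D).Adj x a)
    (h₂ : ∃ b ∈ U₂, (nodeGraph D).Adj x b) (s₁ : Served D U₁) (s₂ : Served D U₂) :
    Served D (U₁ ∪ U₂) := by
  obtain ⟨c₁, cyc₁, mem₁, srv₁⟩ := s₁
  obtain ⟨c₂, cyc₂, mem₂, srv₂⟩ := s₂
  have hdisj : ∀ v ∈ c₁, v ∉ c₂ := by
    intro v hv hv'
    obtain ⟨K, hK, L, hL, hKL, hvK, hvL⟩ := mem₁ v hv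
    obtain ⟨K', hK', L', hL', hKL', hvK', hvL'⟩ := mem₂ v hv'
    have e1 : K = x := hU K hK (by
      rcases Node.eq_or_eq hD hc hdeg hvK' hvL' hKL' hvK with h | h <;> rw [h] <;> assumption)
    have e2 : L = x := hU L hL (by
      rcases Node.eq_or_eq hD hc hdeg hvK' hvL' hKL' hvL with h | h <;> rw [h] <;> assumption)
    exact hKL (e1.trans e2.symm)
  have hxpair : ∀ (U U' : Set (Node D)) (c : List V), x ∈ U' → (∀ v ∈ U, v ∈ U' → v = x) →
      (∃ a ∈ U, (nodeGraph D).Adj x a) →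
      (∀ K ∈ U', ∀ v ∈ K, ∃ L ∈ U', v ∈ L ∧ ∃ p q, ConsecIn c p q ∧ p ∈ L ∧ q ∈ L) →
      ∃ p q, ConsecIn c p q ∧ p ∈ x ∧ q ∈ x := by
    rintro U U' c hx' hUU ⟨a, ha, hxa, w, hwx, hwa⟩ hs
    obtain ⟨L, hL, hwL, p, q, h1, h2, h3⟩ := hs x hx' w hwx
    have : L = x := by
      rcases Node.eq_or_eq hD hc hdeg hwx hwa hxa hwL with h | h
      · exact h
      · exact absurd (hUU a ha (h ▸ hL)).symm hxa
    exact ⟨p, q, h1, this ▸ h2, this ▸ h3⟩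
  obtain ⟨p, q, hpq, hp, hq⟩ := hxpair U₂ U₁ c₁ hx₁ (fun v h h' => hU v h' h) h₂ srv₁
  obtain ⟨p', q', hpq', hp', hq'⟩ := hxpair U₁ U₂ c₂ hx₂ hU h₁ srv₂
  have n1 : p ≠ q' := fun h => hdisj p hpq.mem.1 (h ▸ hpq'.mem.2)
  have n2 : p' ≠ q := fun h => hdisj q hpq.mem.2 (h ▸ hpq'.mem.1)
  obtain ⟨l, hl, hmem, hcons, k₁, k₂⟩ := cyc₁.merge cyc₂ hdisj hpq hpq' (x.adj hD hp hq' n1)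
    (x.adj hD hp' hq n2)
  refine ⟨l, hl, ?_, ?_⟩
  · intro v hv
    rcases (hmem v).1 hv with hv | hv
    · obtain ⟨K, hK, L, hL, h⟩ := mem₁ v hv
      exact ⟨K, Or.inl hK, L, Or.inl hL, h⟩
    · obtain ⟨K, hK, L, hL, h⟩ := mem₂ v hv
      exact ⟨K, Or.inr hK, L, Or.inr hL, h⟩
  · have key : ∀ c p q, IsCyc D c → ConsecIn c p q → p ∈ x → q ∈ x →
        (∀ a b, ConsecIn c a b → (a = p ∧ b = q) ∨ ConsecIn l a b) → ∀ L : Node D,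
        (∃ p q, ConsecIn c p q ∧ p ∈ L ∧ q ∈ L) → ∃ p q, ConsecIn l p q ∧ p ∈ L ∧ q ∈ L := by
      rintro c p q hc hpq hp hq hk L ⟨a, b, hab, ha, hb⟩
      rcases hk a b hab with ⟨rfl, rfl⟩ | h
      · obtain rfl : L = x := Node.eq_of_mem hD ha hb hp hq (hc.adj hpq).ne
        exact ⟨_, _, hcons, by assumption, by assumption⟩
      · exact ⟨a, b, h, ha, hb⟩
    rintro K (hK | hK) v hv
    · obtain ⟨L, hL, hvL, h⟩ := srv₁ K hK v hv
      exact ⟨L, Or.inl hL, hvL, key c₁ p q cyc₁ hpq hp hq k₁ L h⟩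
    · obtain ⟨L, hL, hvL, h⟩ := srv₂ K hK v hv
      exact ⟨L, Or.inr hL, hvL, key c₂ p' q' cyc₂ hpq' hp' hq' k₂ L h⟩

section EdgeList

variable {X : Type*} (e : X → X → V)

/-- The values of `e` on the consecutive pairs of the walk `a :: l`. -/
def edgeList : X → List X → List V
  | _, [] => []
  | a, b :: l => e a b :: edgeList b l

theorem edgeList_append_singleton (a z : X) (l : List X) :
    edgeList e a (l ++ [z]) = List.zipWith e (a :: l) (l ++ [z]) := by
  induction l generalizing a with
  | nil => rfl
  | cons b l ih => simp [edgeList, ih]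

theorem exists_of_mem_edgeList {F : SimpleGraph X} {a : X} {l : List X}
    (hc : List.IsChain F.Adj (a :: l)) {v : V} (hv : v ∈ edgeList e a l) :
    ∃ p ∈ a :: l, ∃ q ∈ a :: l, F.Adj p q ∧ v = e p q := by
  induction l generalizing a with
  | nil => simp [edgeList] at hv
  | cons b l ih =>
    rw [List.isChain_cons_cons] at hc
    rw [edgeList, List.mem_cons] at hv
    rcases hv with rfl | hv
    · exact ⟨a, by simp, b, by simp, hc.1, rfl⟩
    · obtain ⟨p, hp, q, hq, h⟩ := ih hc.2 hv
      exact ⟨p, List.mem_cons_of_mem _ hp, q, List.mem_cons_of_mem _ hq, h⟩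

/-- The values of `e` on the consecutive pairs of the cyclic list `c`. -/
def cycEdges (c : List X) : List V := List.zipWith e c (c.rotate 1)

theorem cycEdges_rotate (c : List X) (n : ℕ) : (cycEdges e c).rotate n = cycEdges e (c.rotate n) := by
  rw [cycEdges, List.zipWith_rotate_distrib _ _ _ _ (by simp), cycEdges, List.rotate_rotate,
    List.rotate_rotate, Nat.add_comm]

theorem cycEdges_cons (a : X) (m : List X) : cycEdges e (a :: m) = edgeList e a (m ++ [a]) := by
  rw [edgeList_append_singleton]; simp [cycEdges]

end EdgeList

theorem exists_edgeMap {D : SimpleGraph V} [Nonempty V] : ∃ e : Node D → Node D → V,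
    ∀ K L, (nodeGraph D).Adj K L → e K L ∈ K ∧ e K L ∈ L := by
  have : ∀ K L : Node D, ∃ v, (nodeGraph D).Adj K L → v ∈ K ∧ v ∈ L := by
    intro K L
    by_cases h : (nodeGraph D).Adj K L
    · obtain ⟨v, hv⟩ := h.2
      exact ⟨v, fun _ => hv⟩
    · exact ⟨Classical.arbitrary V, fun h' => absurd h' h⟩
  choose e he using this
  exact ⟨e, he⟩

/-- The edges of a cycle of the root graph, in cyclic order, form a cycle of `D`, with two
consecutive edges in each node passed. A vertex of `K` is an edge from `K` to some `Y`: if `Y` is in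
`U`, domination serves it; if not, `K` is marked and so lies on the cycle. -/
theorem served_of_cycle {D : SimpleGraph V} (hD : DiamondFree D) (hc : NoClaw D)
    (hdeg : ∀ v, ∃ u, D.Adj v u) {U : Set (Node D)} {c : List (Node D)}
    (hcyc : IsCyc (nodeGraph D) c) (hU : ∀ K ∈ c, K ∈ U)
    (hmark : ∀ m ∈ U, Marked (nodeGraph D) U m → m ∈ c)
    (hdom : ∀ a ∈ U, ∀ b ∈ U, (nodeGraph D).Adj a b → a ∈ c ∨ b ∈ c) : Served D U := by
  obtain ⟨K₀, -⟩ := List.exists_mem_of_length_pos (by have := hcyc.2.1; omega : 0 < c.length)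
  obtain ⟨v₀, hv₀⟩ : ∃ v, v ∈ K₀ := by
    obtain ⟨K, ⟨u, v, huv, rfl⟩ | ⟨v, -, rfl⟩⟩ := K₀
    · exact ⟨u, left_mem_line D u v⟩
    · exact ⟨v, rfl⟩
  have : Nonempty V := ⟨v₀⟩
  obtain ⟨e, he⟩ := exists_edgeMap (D := D)
  have heq : ∀ {K L K' L' : Node D}, (nodeGraph D).Adj K L → (nodeGraph D).Adj K' L' →
      e K L = e K' L' → (K = K' ∨ K = L') ∧ (L = K' ∨ L = L') := by
    intro K L K' L' h h' hee
    have h1 := he K L h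
    have h2 := he K' L' h'
    rw [hee] at h1
    exact ⟨Node.eq_or_eq hD hc hdeg h2.1 h2.2 h'.1 h1.1, Node.eq_or_eq hD hc hdeg h2.1 h2.2 h'.1 h1.2⟩
  have hnd : ∀ (l : List (Node D)) (a : Node D), (a :: l).Nodup →
      List.IsChain (nodeGraph D).Adj (a :: l) → (edgeList e a l).Nodup := by
    intro l
    induction l with
    | nil => simp [edgeList]
    | cons b l ih =>
      intro a hn hch
      rw [List.isChain_cons_cons] at hch
      rw [edgeList, List.nodup_cons]
      refine ⟨fun hmem => ?_, ih b (List.nodup_cons.1 hn).2 hch.2⟩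
      obtain ⟨p, hp, q, hq, hpq, h⟩ := exists_of_mem_edgeList e hch.2 hmem
      rcases (heq hch.1 hpq h).1 with h' | h'
      · exact (List.nodup_cons.1 hn).1 (h' ▸ hp)
      · exact (List.nodup_cons.1 hn).1 (h' ▸ hq)
  have hnodup : (cycEdges e c).Nodup := by
    rcases c with _ | ⟨a, _ | ⟨b, _ | ⟨d, m⟩⟩⟩
    · simp [cycEdges]
    · simpa using hcyc.2.1
    · simpa using hcyc.2.1
    obtain ⟨h1, -, h3⟩ := isCyc_iff_of_cons.1 hcyc
    simp only [List.cons_append, List.isChain_cons_cons] at h3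
    have h1' : (b :: d :: (m ++ [a])).Nodup := by
      have : (a :: b :: d :: m).Perm (b :: d :: (m ++ [a])) := by
        have := (List.isRotated_append (l := [a]) (l' := b :: d :: m)).perm
        simpa using this
      exact this.nodup_iff.1 h1
    have hch : List.IsChain (nodeGraph D).Adj (b :: d :: (m ++ [a])) :=
      List.isChain_cons_cons.2 ⟨h3.2.1, h3.2.2⟩
    rw [cycEdges_cons]
    simp only [List.cons_append, edgeList]
    refine List.nodup_cons.2 ⟨fun hmem => ?_, hnd _ _ h1' hch⟩
    rcases List.mem_cons.1 hmem with h | hmem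
    · rcases (heq h3.1 h3.2.1 h).1 with h' | h'
      · exact h3.1.ne h'
      · subst h'; simp at h1
    · obtain ⟨p, hp, q, hq, hpq, h⟩ := exists_of_mem_edgeList e h3.2.2 hmem
      have hb := (List.nodup_cons.1 h1').1
      rcases (heq h3.1 hpq h).2 with h' | h'
      · exact hb (h' ▸ hp)
      · exact hb (h' ▸ hq)
  have hlen : (cycEdges e c).length = c.length := by simp [cycEdges]
  have hrot : ∀ n, ∃ A B m x w, c.rotate n = A :: B :: m ∧ (nodeGraph D).Adj A B ∧
      (nodeGraph D).Adj B x ∧ (cycEdges e c).rotate n = e A B :: e B x :: w := by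
    intro n
    have hcn := hcyc.rotated ⟨n, rfl⟩
    rw [cycEdges_rotate]
    rcases h : c.rotate n with _ | ⟨A, _ | ⟨B, m⟩⟩
    · rw [h] at hcn; simpa using hcn.2.1
    · rw [h] at hcn; simpa using hcn.2.1
    rw [h] at hcn
    have h3 := (isCyc_iff_of_cons.1 hcn).2.2
    rw [cycEdges_cons]
    rcases m with _ | ⟨x, m⟩
    · simpa using hcn.2.1
    · simp only [List.cons_append, List.isChain_cons_cons] at h3
      exact ⟨A, B, _, x, _, rfl, h3.1, h3.2.1, rfl⟩
  have hserve : ∀ K ∈ c, ∃ p q, ConsecIn (cycEdges e c) p q ∧ p ∈ K ∧ q ∈ K := by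
    intro K hK
    obtain ⟨m, hm⟩ := List.exists_isRotated_cons hK
    have hm2 : c ~r (m ++ [K]) := hm.trans (by simpa using List.isRotated_append (l := [K]) (l' := m))
    rcases m.eq_nil_or_concat with rfl | ⟨m', J, rfl⟩
    · have := hcyc.2.1
      rw [hm.perm.length_eq] at this
      simp at this
    have hm3 : c ~r (J :: K :: m') := hm2.trans (by
      simpa using List.isRotated_append (l := m') (l' := [J, K]))
    obtain ⟨n, hn⟩ := hm3
    obtain ⟨A, B, m, x, w, h1, h2, h3, h4⟩ := hrot n
    rw [hn] at h1
    simp only [List.cons.injEq] at h1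
    obtain ⟨rfl, rfl, rfl⟩ := h1
    exact ⟨_, _, ⟨w, n, h4⟩, (he _ _ h2).2, (he _ _ h3).1⟩
  refine ⟨cycEdges e c, isCyc_of_consecIn hnodup (hlen ▸ hcyc.2.1) ?_, ?_, ?_⟩
  · rintro p q ⟨m, n, hn⟩
    obtain ⟨A, B, m', x, w, h1, h2, h3, h4⟩ := hrot n
    have hnn : (p :: q :: m).Nodup := hn ▸ (List.nodup_rotate.2 hnodup)
    rw [hn] at h4
    simp only [List.cons.injEq] at h4
    obtain ⟨rfl, rfl, rfl⟩ := h4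
    refine B.adj hD (he _ _ h2).2 (he _ _ h3).1 ?_
    simp at hnn; tauto
  · intro v hv
    rcases c with _ | ⟨a, m⟩
    · simp [cycEdges] at hv
    rw [cycEdges_cons] at hv
    obtain ⟨p, hp, q, hq, hpq, rfl⟩ := exists_of_mem_edgeList e (isCyc_iff_of_cons.1 hcyc).2.2 hv
    have hmem : ∀ p ∈ a :: (m ++ [a]), p ∈ U := fun p hp => hU p (by simp at hp ⊢; tauto)
    exact ⟨p, hmem p hp, q, hmem q hq, hpq.1, (he _ _ hpq).1, (he _ _ hpq).2⟩
  · intro K hK v hv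
    obtain ⟨Y, hYK, hvY⟩ := Node.exists_other hD hc hdeg K v
    by_cases hYU : Y ∈ U
    · rcases hdom K hK Y hYU ⟨hYK.symm, v, hv, hvY⟩ with h | h
      · exact ⟨K, hK, hv, hserve K h⟩
      · exact ⟨Y, hYU, hvY, hserve Y h⟩
    · exact ⟨K, hK, hv, hserve K (hmark K hK ⟨Y, hYU, hYK.symm, v, hv, hvY⟩)⟩

/-- Connectivity after the deletion of a vertex `w`, in terms of closed sets. -/
def CutFree (D : SimpleGraph V) : Prop :=
  ∀ w (S : Set V), (∀ p ∈ S, ∀ q, D.Adj p q → p ≠ w → q ≠ w → q ∈ S) →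
    ∀ s ∈ S, s ≠ w → ∀ t, t ≠ w → t ∈ S

theorem CutFree.mono {G D : SimpleGraph V} (hG : CutFree G) (h : G ≤ D) : CutFree D :=
  fun w S hS => hG w S fun p hp q hpq => hS p hp q (h hpq)

theorem cutFree_of_isKConnected [Fintype V] {G : SimpleGraph V} (h : IsKConnected G 2) :
    CutFree G := by
  intro w S hS s hs hsw t htw
  have hconn := h.2 {w} (by simp)
  obtain ⟨p⟩ := hconn.preconnected ⟨s, by simpa using hsw⟩ ⟨t, by simpa using htw⟩
  have key : ∀ (a b : {v : V | v ∉ ({w} : Finset V)}),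
      (G.induce {v : V | v ∉ ({w} : Finset V)}).Walk a b → a.1 ∈ S → b.1 ∈ S := by
    intro a b p
    induction p with
    | nil => exact id
    | cons hadj _ ih =>
      rename_i a b c _
      intro ha
      exact ih (hS _ ha _ hadj (by simpa using a.2) (by simpa using b.2))
  exact key _ _ p hs

/-- The dichotomy is applied to the set of lines. Being served there means domination, hence a
Hamiltonian cycle, so a theta remains. -/
theorem exists_theta_of_not_hasHamCyc [Fintype V] {D : SimpleGraph V} (hD : DiamondFree D)
    (hc : NoClaw D) (hcut : CutFree D) (hdeg : ∀ v, ∃ u, D.Adj v u) (h3 : 3 ≤ Fintype.card V)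
    (hham : ¬ HasHamCyc D) :
    ∃ U A B α, OuterSparse (nodeGraph D) U ∧ IsTheta (nodeGraph D) U A B α := by
  classical
  set U : Set (Node D) := {K | IsLine D K.1} with hU
  have hline : ∀ {u v} (h : D.Adj u v), edgeNode h ∈ U := fun h => ⟨_, _, h, rfl⟩
  have htwo : ∀ K ∈ U, ∀ w, ∃ v ∈ K, v ≠ w := by
    rintro ⟨K, hK'⟩ ⟨u, v, huv, hK⟩ w
    simp only at hK
    subst hK
    by_cases huw : u = w
    · exact ⟨v, right_mem_line D u v, fun h => huv.ne (huw.trans h.symm)⟩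
    · exact ⟨u, left_mem_line D u v, huw⟩
  by_cases hnt : U.Nontrivial
  -- A node that is not a line is a singleton, and its vertex lies in only one further node.
  · have hJ : OuterSparse (nodeGraph D) U := by
      rintro ⟨Y, hY⟩ hYU a ha b hb ⟨hya, v, hv, hva⟩ ⟨hyb, w, hw, hwb⟩
      rcases hY with hY | ⟨y, hy, rfl⟩
      · exact absurd hY hYU
      obtain rfl : v = y := hv
      obtain rfl : w = v := hw
      rcases Node.eq_or_eq hD hc hdeg (K := singletonNode hy) rfl hva hya hwb with h | h
      · exact absurd h.symm hyb
      · exact h.symm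
    have h2 : TwoEdgeConn (nodeGraph D) U := by
      intro S hS hSne hTne
      -- If at most one vertex `w` lay in lines on both sides, deleting it would disconnect `D`.
      have inter : ∃ v w : V, v ≠ w ∧ (∃ K ∈ S, v ∈ K) ∧ (∃ L ∈ U \ S, v ∈ L) ∧
          (∃ K ∈ S, w ∈ K) ∧ ∃ L ∈ U \ S, w ∈ L := by
        by_contra hcon
        obtain ⟨w, hw⟩ : ∃ w : V, ∀ v, (∃ K ∈ S, v ∈ K) → (∃ L ∈ U \ S, v ∈ L) → v = w := by
          by_cases hex : ∃ w : V, (∃ K ∈ S, w ∈ K) ∧ ∃ L ∈ U \ S, w ∈ L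
          · obtain ⟨w, h1, h2⟩ := hex
            refine ⟨w, fun v h3 h4 => ?_⟩
            by_contra hvw
            exact hcon ⟨v, w, hvw, h3, h4, h1, h2⟩
          · obtain ⟨K, hK⟩ := hSne
            obtain ⟨w, -⟩ : ∃ w : V, True := by
              have : 0 < Fintype.card V := by omega
              obtain ⟨w⟩ := Fintype.card_pos_iff.1 this
              exact ⟨w, trivial⟩
            exact ⟨w, fun v h3 h4 => absurd ⟨v, h3, h4⟩ hex⟩
        obtain ⟨K, hK⟩ := hSne
        obtain ⟨L, hL⟩ := hTne
        obtain ⟨s, hsK, hsw⟩ := htwo K (hS hK) w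
        obtain ⟨t, htL, htw⟩ := htwo L hL.1 w
        refine htw (hw t (hcut w {v | ∃ K ∈ S, v ∈ K} ?_ s ⟨K, hK, hsK⟩ hsw t htw) ⟨L, hL, htL⟩)
        rintro p ⟨M, hM, hpM⟩ q hpq hpw hqw
        refine ⟨edgeNode hpq, ?_, right_mem_edgeNode hpq⟩
        by_contra hnS
        exact hpw (hw p ⟨M, hM, hpM⟩ ⟨_, ⟨hline hpq, hnS⟩, left_mem_edgeNode hpq⟩)
      obtain ⟨v, w, hvw, ⟨K, hK, hvK⟩, ⟨L, hL, hvL⟩, ⟨K', hK', hwK⟩, ⟨L', hL', hwL⟩⟩ := inter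
      refine ⟨K, hK, L, hL, K', hK', L', hL', ⟨fun h => hL.2 (h ▸ hK), v, hvK, hvL⟩,
        ⟨fun h => hL'.2 (h ▸ hK'), w, hwK, hwL⟩, ?_⟩
      by_contra hcon
      push Not at hcon
      obtain ⟨rfl, rfl⟩ := hcon
      have := Node.eq_of_mem hD hvK hwK hvL hwL hvw
      exact hL.2 (this ▸ hK)
    rcases theta_or_of_twoEdgeConn (T := Served D)
      (fun U c h1 h2 h3 h4 => served_of_cycle hD hc hdeg h1 h2 h3 h4)
      (fun U₁ U₂ x h1 h2 h3 _ h5 h6 h7 h8 => Served.union hD hc hdeg h1 h2 h3 h5 h6 h7 h8) h2 hJ hnt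
      with h | h
    · obtain ⟨c, hcyc, -, hsrv⟩ := h
      refine absurd (hasHamCyc_of_dominating hD hcyc fun y hy => ?_) hham
      obtain ⟨u, hu⟩ := hdeg y
      obtain ⟨L, -, hyL, p, q, hpq, hp, hq⟩ := hsrv _ (hline hu) y (left_mem_edgeNode hu)
      exact ⟨p, q, hpq, L.adj hD hyL hp fun h => hy (h ▸ hpq.mem.1),
        L.adj hD hyL hq fun h => hy (h ▸ hpq.mem.2)⟩
    · exact h
  -- With a single line `D` is complete, and any ordering of the vertices is a cycle.
  · rw [Set.not_nontrivial_iff] at hnt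
    refine absurd ⟨Finset.univ.toList, isCyc_of_consecIn (Finset.nodup_toList _) (by simpa using h3)
      ?_, by simp⟩ hham
    rintro p q ⟨m, hm⟩
    have hpq : p ≠ q := by
      have := hm.nodup_iff.1 (Finset.nodup_toList _)
      simp at this; tauto
    obtain ⟨u, hu⟩ := hdeg p
    obtain ⟨w, hw⟩ := hdeg q
    have := hnt (hline hu) (hline hw)
    exact Node.adj hD (left_mem_edgeNode hu) (this ▸ left_mem_edgeNode hw) hpq

end ClawFree

/-! ### Heavy vertices and end-vertices of induced copies. -/

namespace ClawFree

variable {V : Type*}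

open List

/-- The neighbourhood of `v` consists of two disjoint cliques, and each nonadjacent pair has one
vertex in either of them. -/
theorem matching_of_pairs {D : SimpleGraph V} (hc : NoClaw D) (hD : DiamondFree D)
    {v a a' b b' : V} (ha : D.Adj v a) (ha' : D.Adj v a') (hb : D.Adj v b) (hb' : D.Adj v b')
    (haa : a ≠ a') (hbb : b ≠ b') (hab : a ≠ b) (hab' : a ≠ b') (hab₁ : a' ≠ b) (hab₂ : a' ≠ b')
    (na : ¬ D.Adj a a') (nb : ¬ D.Adj b b') :
    (D.Adj a b ∧ D.Adj a' b') ∨ (D.Adj a b' ∧ D.Adj a' b) := by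
  have key : ∀ {a a' b b' : V}, D.Adj v a → D.Adj v a' → D.Adj v b → D.Adj v b' → a ≠ a' → b ≠ b' →
      a' ≠ b → a' ≠ b' → ¬ D.Adj a a' → ¬ D.Adj b b' → D.Adj a b → D.Adj a' b' := by
    intro a a' b b' ha ha' hb hb' haa hbb h1 h2 na nb h
    rcases hc v a' b b' ha' hb hb' h1 hbb h2 with h' | h' | h'
    · exact absurd (hD v a b a' ha hb ha' h h'.symm haa) na
    · exact absurd h' nb
    · exact h'
  rcases hc v a a' b ha ha' hb haa hab₁ hab with h | h | h
  · exact absurd h na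
  · exact Or.inr ⟨key ha' ha hb hb' haa.symm hbb hab hab' (fun h => na h.symm) nb h, h⟩
  · exact Or.inl ⟨h, key ha ha' hb hb' haa hbb hab₁ hab₂ na nb h⟩

/-- A closed trail through the six neighbourhood cliques of an independent triple dominates. -/
theorem hasHamCyc_of_six [Finite V] {D : SimpleGraph V} (hc : NoClaw D) (hD : DiamondFree D)
    {v₁ v₂ v₃ a a' b b' d d' : V} (h₁₂ : v₁ ≠ v₂) (h₁₃ : v₁ ≠ v₃) (h₂₃ : v₂ ≠ v₃)
    (n₁₂ : ¬ D.Adj v₁ v₂) (n₁₃ : ¬ D.Adj v₁ v₃) (n₂₃ : ¬ D.Adj v₂ v₃)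
    (ha1 : D.Adj v₁ a) (ha2 : D.Adj v₂ a) (ha1' : D.Adj v₁ a') (ha2' : D.Adj v₂ a')
    (hb1 : D.Adj v₁ b) (hb3 : D.Adj v₃ b) (hb1' : D.Adj v₁ b') (hb3' : D.Adj v₃ b')
    (hd2 : D.Adj v₂ d) (hd3 : D.Adj v₃ d) (hd2' : D.Adj v₂ d') (hd3' : D.Adj v₃ d')
    (haa : a ≠ a') (hbb : b ≠ b') (hdd : d ≠ d')
    (hall : ∀ y, y ≠ v₁ → y ≠ v₂ → y ≠ v₃ → D.Adj v₁ y ∨ D.Adj v₂ y ∨ D.Adj v₃ y) :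
    HasHamCyc D := by
  have hthree : ∀ y, D.Adj v₁ y → D.Adj v₂ y → D.Adj v₃ y → False := by
    intro y h1 h2 h3
    rcases hc y v₁ v₂ v₃ h1.symm h2.symm h3.symm h₁₂ h₂₃ h₁₃ with h | h | h
    exacts [n₁₂ h, n₂₃ h, n₁₃ h]
  have hna : ∀ {u w x y : V}, u ≠ w → ¬ D.Adj u w → D.Adj u x → D.Adj w x → D.Adj u y → D.Adj w y →
      ¬ D.Adj x y := fun huw nuw h1 h2 h3 h4 h5 =>
    nuw (hD _ _ _ _ h1.symm h5 h2.symm h3 h4.symm huw)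
  have naa := hna h₁₂ n₁₂ ha1 ha2 ha1' ha2'
  have nbb := hna h₁₃ n₁₃ hb1 hb3 hb1' hb3'
  have ndd := hna h₂₃ n₂₃ hd2 hd3 hd2' hd3'
  have hne : ∀ {v x y : V}, D.Adj v x → ¬ D.Adj v y → x ≠ y := fun h h' he => h' (he ▸ h)
  have a3 : ¬ D.Adj v₃ a := fun h => hthree a ha1 ha2 h
  have a3' : ¬ D.Adj v₃ a' := fun h => hthree a' ha1' ha2' h
  have b2 : ¬ D.Adj v₂ b := fun h => hthree b hb1 h hb3
  have b2' : ¬ D.Adj v₂ b' := fun h => hthree b' hb1' h hb3'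
  have d1 : ¬ D.Adj v₁ d := fun h => hthree d h hd2 hd3
  have d1' : ¬ D.Adj v₁ d' := fun h => hthree d' h hd2' hd3'
  wlog hab : D.Adj a b ∧ D.Adj a' b' generalizing b b'
  · exact this hb1' hb3' hb1 hb3 hbb.symm (fun h => nbb h.symm) b2' b2
      ((matching_of_pairs hc hD ha1 ha1' hb1 hb1' haa hbb (hne ha2 b2) (hne ha2 b2') (hne ha2' b2)
        (hne ha2' b2') naa nbb).resolve_left hab)
  wlog had : D.Adj a d ∧ D.Adj a' d' generalizing d d'
  · exact this hd2' hd3' hd2 hd3 hdd.symm (fun h => ndd h.symm) d1' d1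
      ((matching_of_pairs hc hD ha2 ha2' hd2 hd2' haa hdd (hne ha1 d1) (hne ha1 d1') (hne ha1' d1)
        (hne ha1' d1') naa ndd).resolve_left had)
  -- The third matching is twisted: if `b` saw `d`, then `v₁`, `a`, `d` around `b` would force `v₁`
  -- to see `d`. The twist is what closes a single hexagon.
  have hbd : D.Adj b d' ∧ D.Adj b' d := by
    rcases matching_of_pairs hc hD hb3 hb3' hd3 hd3' hbb hdd (hne hb1 d1) (hne hb1 d1')
      (hne hb1' d1) (hne hb1' d1') nbb ndd with h | h
    · exact absurd (hD b v₁ a d hb1.symm hab.1.symm h.1 ha1 had.1 (fun he => n₁₂ (he ▸ hd2.symm)))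
        d1
    · exact h
  have hcyc : IsCyc D [a, b, d', a', b', d] := by
    rw [isCyc_iff_of_cons]
    refine ⟨?_, by simp, ?_⟩
    · have e1 := hne ha2 b2
      have e2 := hne ha1 d1'
      have e3 := hne ha2 b2'
      have e4 := hne ha1 d1
      have e5 := hne hb1 d1'
      have e6 := (hne ha2' b2).symm
      have e7 := hne hb1 d1
      have e8 := (hne ha1' d1').symm
      have e9 := (hne hb1' d1').symm
      have e10 := hne ha2' b2'
      have e11 := hne ha1' d1
      have e12 := hne hb1' d1
      simp [e1, e2, e3, e4, e5, e6, e7, e8, e9, e10, e11, e12, haa, hbb, hdd.symm]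
    · simp [hab.1, hbd.1, had.2.symm, hab.2, hbd.2, had.1.symm]
  have side : ∀ {v x x' z z' y : V}, D.Adj v x → D.Adj v x' → D.Adj v z → D.Adj v z' → D.Adj x z →
      D.Adj x' z' → x ≠ x' → ¬ D.Adj x x' → D.Adj v y → y ≠ x → y ≠ x' → y ≠ z → y ≠ z' →
      (D.Adj y x ∧ D.Adj y z) ∨ (D.Adj y x' ∧ D.Adj y z') := by
    intro v x x' z z' y h1 h2 h3 h4 h5 h6 h7 h8 h9 h10 h11 h12 h13
    rcases hc v x x' y h1 h2 h9 h7 h11.symm h10.symm with h | h | h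
    · exact absurd h h8
    · exact Or.inr ⟨h.symm, hD v y x' z' h9 h2 h4 h.symm h6 h13⟩
    · exact Or.inl ⟨h.symm, hD v y x z h9 h1 h3 h.symm h5 h12⟩
  refine hasHamCyc_of_dominating hD hcyc fun y hy => ?_
  simp only [List.mem_cons, List.not_mem_nil, or_false, not_or] at hy
  obtain ⟨y1, y2, y3, y4, y5, y6⟩ := hy
  have c1 : ConsecIn [a, b, d', a', b', d] a b := ⟨_, .refl _⟩
  have c2 : ConsecIn [a, b, d', a', b', d] b d' := ⟨_, 1, rfl⟩
  have c3 : ConsecIn [a, b, d', a', b', d] d' a' := ⟨_, 2, rfl⟩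
  have c4 : ConsecIn [a, b, d', a', b', d] a' b' := ⟨_, 3, rfl⟩
  have c5 : ConsecIn [a, b, d', a', b', d] b' d := ⟨_, 4, rfl⟩
  have c6 : ConsecIn [a, b, d', a', b', d] d a := ⟨_, 5, rfl⟩
  by_cases e1 : y = v₁
  · exact ⟨a, b, c1, e1 ▸ ha1, e1 ▸ hb1⟩
  by_cases e2 : y = v₂
  · exact ⟨d, a, c6, e2 ▸ hd2, e2 ▸ ha2⟩
  by_cases e3 : y = v₃
  · exact ⟨b, d', c2, e3 ▸ hb3, e3 ▸ hd3'⟩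
  rcases hall y e1 e2 e3 with h | h | h
  · rcases side ha1 ha1' hb1 hb1' hab.1 hab.2 haa naa h y1 y4 y2 y5 with h' | h'
    · exact ⟨a, b, c1, h'⟩
    · exact ⟨a', b', c4, h'⟩
  · rcases side ha2 ha2' hd2 hd2' had.1 had.2 haa naa h y1 y4 y6 y3 with h' | h'
    · exact ⟨d, a, c6, h'.2, h'.1⟩
    · exact ⟨d', a', c3, h'.2, h'.1⟩
  · rcases side hb3 hb3' hd3' hd3 hbd.1 hbd.2 hbb nbb h y2 y5 y3 y6 with hy | hy
    · exact ⟨b, d', c2, hy⟩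
    · exact ⟨b', d, c5, hy⟩

/-- The degree of `v` is at least `(n + 3) / 3`. -/
def Heavy [Fintype V] (G : SimpleGraph V) (v : V) : Prop :=
  Fintype.card V + 3 ≤ 3 * (G.neighborSet v).ncard

theorem Heavy.mono [Fintype V] {G D : SimpleGraph V} (h : G ≤ D) {v : V} (hv : Heavy G v) :
    Heavy D v := by
  refine hv.trans (Nat.mul_le_mul_left _ (Set.ncard_le_ncard (fun w hw => h hw) (Set.toFinite _)))

/-- Common neighbours of two nonadjacent vertices are pairwise nonadjacent by diamond-freeness, so
there are at most two. The neighbourhoods thus cover at least `n + 3 - 6` vertices and miss the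
three centres, so equality holds throughout, and `hasHamCyc_of_six` applies. -/
theorem not_three_heavy [Fintype V] {D : SimpleGraph V} (hc : NoClaw D) (hD : DiamondFree D)
    (hham : ¬ HasHamCyc D) {v₁ v₂ v₃ : V} (h₁₂ : v₁ ≠ v₂ ∧ ¬ D.Adj v₁ v₂)
    (h₁₃ : v₁ ≠ v₃ ∧ ¬ D.Adj v₁ v₃) (h₂₃ : v₂ ≠ v₃ ∧ ¬ D.Adj v₂ v₃)
    (w₁ : Heavy D v₁) (w₂ : Heavy D v₂) (w₃ : Heavy D v₃) : False := by
  classical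
  have hcard : ∀ v, (D.neighborSet v).ncard = (D.neighborFinset v).card := by
    intro v
    rw [← Set.ncard_coe_finset]; simp
  simp only [Heavy, hcard] at w₁ w₂ w₃
  have hinter : ∀ {u w : V}, u ≠ w ∧ ¬ D.Adj u w →
      (D.neighborFinset u ∩ D.neighborFinset w).card ≤ 2 := by
    rintro u w ⟨huw, nuw⟩
    by_contra hcon
    push Not at hcon
    obtain ⟨a, ha, b, hb, c, hc', hab, hac, hbc⟩ := Finset.two_lt_card.1 hcon
    simp only [Finset.mem_inter, SimpleGraph.mem_neighborFinset] at ha hb hc'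
    have key : ∀ {x y : V}, D.Adj u x ∧ D.Adj w x → D.Adj u y ∧ D.Adj w y → ¬ D.Adj x y :=
      fun h1 h2 h => nuw (hD _ _ _ _ h1.1.symm h h1.2.symm h2.1 h2.2.symm huw)
    rcases hc u a b c ha.1 hb.1 hc'.1 hab hbc hac with h | h | h
    exacts [key ha hb h, key hb hc' h, key ha hc' h]
  have i₁₂ := hinter h₁₂
  have i₁₃ := hinter h₁₃
  have i₂₃ := hinter h₂₃
  set N₁ := D.neighborFinset v₁ with hN₁
  set N₂ := D.neighborFinset v₂ with hN₂
  set N₃ := D.neighborFinset v₃ with hN₃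
  have e1 := Finset.card_union_add_card_inter N₁ N₂
  have e2 := Finset.card_union_add_card_inter (N₁ ∪ N₂) N₃
  have e3 : ((N₁ ∪ N₂) ∩ N₃).card ≤ (N₁ ∩ N₃).card + (N₂ ∩ N₃).card := by
    rw [Finset.union_inter_distrib_right]
    exact Finset.card_union_le _ _
  have hsub : N₁ ∪ N₂ ∪ N₃ ⊆ Finset.univ \ {v₁, v₂, v₃} := by
    intro y hy
    simp only [hN₁, hN₂, hN₃, Finset.mem_union, SimpleGraph.mem_neighborFinset] at hy
    simp only [Finset.mem_sdiff, Finset.mem_univ, true_and, Finset.mem_insert,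
      Finset.mem_singleton, not_or]
    refine ⟨?_, ?_, ?_⟩ <;> rintro rfl <;> simp_all [D.adj_comm]
  have hthree : ({v₁, v₂, v₃} : Finset V).card = 3 := by
    rw [Finset.card_eq_three]
    exact ⟨v₁, v₂, v₃, h₁₂.1, h₁₃.1, h₂₃.1, rfl⟩
  have e4 : (Finset.univ \ {v₁, v₂, v₃} : Finset V).card + 3 = Fintype.card V := by
    rw [← hthree, Finset.card_sdiff_add_card_eq_card (Finset.subset_univ _), Finset.card_univ]
  have e5 := Finset.card_le_card hsub
  have f₁₂ : (N₁ ∩ N₂).card = 2 := by omega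
  have f₁₃ : (N₁ ∩ N₃).card = 2 := by omega
  have f₂₃ : (N₂ ∩ N₃).card = 2 := by omega
  have heq := Finset.eq_of_subset_of_card_le hsub (by omega)
  obtain ⟨a, a', haa, ha⟩ := Finset.card_eq_two.1 f₁₂
  obtain ⟨b, b', hbb, hb⟩ := Finset.card_eq_two.1 f₁₃
  obtain ⟨d, d', hdd, hd⟩ := Finset.card_eq_two.1 f₂₃
  have get : ∀ {u w x y : V}, D.neighborFinset u ∩ D.neighborFinset w = {x, y} →
      (D.Adj u x ∧ D.Adj w x) ∧ D.Adj u y ∧ D.Adj w y := by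
    intro u w x y h
    have h1 : x ∈ D.neighborFinset u ∩ D.neighborFinset w := by rw [h]; simp
    have h2 : y ∈ D.neighborFinset u ∩ D.neighborFinset w := by rw [h]; simp
    simpa using And.intro h1 h2
  obtain ⟨⟨a1, a2⟩, a3, a4⟩ := get ha
  obtain ⟨⟨b1, b2⟩, b3, b4⟩ := get hb
  obtain ⟨⟨d1, d2⟩, d3, d4⟩ := get hd
  refine hham (hasHamCyc_of_six hc hD h₁₂.1 h₁₃.1 h₂₃.1 h₁₂.2 h₁₃.2 h₂₃.2 a1 a2 a3 a4 b1 b2 b3 b4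
    d1 d2 d3 d4 haa hbb hdd fun y y1 y2 y3 => ?_)
  have : y ∈ N₁ ∪ N₂ ∪ N₃ := by
    rw [heq]; simp [y1, y2, y3]
  simpa [hN₁, hN₂, hN₃, or_assoc] using this

/-- Every end-vertex of an induced copy of `H` in `G` is heavy. -/
def EndsHeavy [Fintype V] (H : SimpleGraph (Fin 6)) (G : SimpleGraph V) : Prop :=
  ∀ (f : H ↪g G) u, IsEndVertex H u → Heavy G (f u)

theorem endsHeavy_of_satisfiesPhi [Fintype V] {G : SimpleGraph V} [DecidableRel G.Adj]
    {H : SimpleGraph (Fin 6)} (h : SatisfiesPhi H 3 G) : EndsHeavy H G := by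
  intro f u hu
  have := h (f u) ⟨f, u, hu, rfl⟩
  have e : (G.neighborSet (f u)).ncard = G.degree (f u) := by
    rw [← SimpleGraph.card_neighborFinset_eq_degree, ← Set.ncard_coe_finset]; simp
  rw [Heavy, e]
  have h' : ((Fintype.card V + 3 : ℕ) : ℚ) ≤ ((3 * G.degree (f u) : ℕ) : ℚ) := by
    push_cast at this ⊢
    linarith
  exact_mod_cast h'

theorem isEndVertex_iff {H : SimpleGraph (Fin 6)} {u w : Fin 6} (h : ∀ x, H.Adj u x ↔ x = w) :
    IsEndVertex H u := ⟨w, (h w).2 rfl, fun x hx => (h x).1 hx⟩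

theorem EndsHeavy.path [Fintype V] {G : SimpleGraph V} (h : EndsHeavy (SimpleGraph.pathGraph 6) G)
    {v₀ v₁ v₂ v₃ v₄ v₅ : V} {l : List V} (hl : IndPath G (v₀ :: v₁ :: v₂ :: v₃ :: v₄ :: v₅ :: l)) :
    Heavy G v₀ := by
  simp only [IndPath, List.mem_cons, not_or, List.head?_cons, Option.some.injEq,
    forall_eq_or_imp] at hl
  let f : SimpleGraph.pathGraph 6 ↪g G := embeddingOfLt ![v₀, v₁, v₂, v₃, v₄, v₅] (by
    intro i j hij
    fin_cases i <;> fin_cases j <;>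
      first
      | exact absurd hij (by decide)
      | simp [hl]) (by
    intro i j hij
    fin_cases i <;> fin_cases j <;>
      first
      | exact absurd hij (by decide)
      | simp [hl, SimpleGraph.pathGraph_adj])
  exact h f 0 (isEndVertex_iff (w := 1) fun x => by
    fin_cases x <;> simp [SimpleGraph.pathGraph_adj])

/-- Distinct and nonadjacent. -/
def Far (G : SimpleGraph V) (p q : V) : Prop := p ≠ q ∧ ¬ G.Adj p q

theorem Far.symm {G : SimpleGraph V} {p q : V} (h : Far G p q) : Far G q p :=
  ⟨h.1.symm, fun h' => h.2 h'.symm⟩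

theorem Far.anti {G D : SimpleGraph V} (hle : G ≤ D) {p q : V} (h : Far D p q) : Far G p q :=
  ⟨h.1, fun h' => h.2 (hle h')⟩

theorem EndsHeavy.net [Fintype V] {G : SimpleGraph V} (h : EndsHeavy netGraph G) {t : Fin 3 → V}
    {r : Fin 3 → List V} (hn : IsNet G t r) {p : Fin 3 → V} (hp : ∀ i, p i ∈ r i)
    (htp : ∀ i, G.Adj (t i) (p i)) (i : Fin 3) : Heavy G (p i) := by
  have tt : ∀ {i j : Fin 3}, i ≠ j → G.Adj (t i) (t j) := fun hij => hn.adj hij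
  have hpt : ∀ i, p i ≠ t i := fun i => hn.notMem (hp i)
  have tp : ∀ {i j : Fin 3}, i ≠ j → Far G (t i) (p j) := fun {i j} hij =>
    ⟨(hn.cross i j hij _ (by simp) _ (List.mem_cons_of_mem _ (hp j))).1, fun h' =>
      hpt j (hn.adj_imp hij (by simp) (List.mem_cons_of_mem _ (hp j)) h').2⟩
  have pp : ∀ {i j : Fin 3}, i ≠ j → Far G (p i) (p j) := fun {i j} hij =>
    ⟨(hn.cross i j hij _ (List.mem_cons_of_mem _ (hp i)) _ (List.mem_cons_of_mem _ (hp j))).1,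
      fun h' => hpt j (hn.adj_imp hij (List.mem_cons_of_mem _ (hp i))
        (List.mem_cons_of_mem _ (hp j)) h').2⟩
  have a01 : G.Adj (t 0) (t 1) := tt (by decide)
  have a02 : G.Adj (t 0) (t 2) := tt (by decide)
  have a12 : G.Adj (t 1) (t 2) := tt (by decide)
  obtain ⟨b01, c01⟩ : Far G (t 0) (p 1) := tp (by decide)
  obtain ⟨b02, c02⟩ : Far G (t 0) (p 2) := tp (by decide)
  obtain ⟨b10, c10⟩ : Far G (t 1) (p 0) := tp (by decide)
  obtain ⟨b12, c12⟩ : Far G (t 1) (p 2) := tp (by decide)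
  obtain ⟨b20, c20⟩ : Far G (t 2) (p 0) := tp (by decide)
  obtain ⟨b21, c21⟩ : Far G (t 2) (p 1) := tp (by decide)
  obtain ⟨d01, e01⟩ : Far G (p 0) (p 1) := pp (by decide)
  obtain ⟨d02, e02⟩ : Far G (p 0) (p 2) := pp (by decide)
  obtain ⟨d12, e12⟩ : Far G (p 1) (p 2) := pp (by decide)
  let f : netGraph ↪g G := embeddingOfLt ![t 0, t 1, t 2, p 0, p 1, p 2] (by
    intro i j hij
    fin_cases i <;> fin_cases j <;>
      first
      | exact absurd hij (by decide)
      | simp [a01.ne, a02.ne, a12.ne, b01, b02, b10, b12, b20, b21, d01, d02, d12, (htp _).ne]) (by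
    intro i j hij
    fin_cases i <;> fin_cases j <;>
      first
      | exact absurd hij (by decide)
      | simp [netGraph, a01, a02, a12, c01, c02, c10, c12, c20, c21, e01, e02, e12, htp])
  fin_cases i
  · exact h f 3 (isEndVertex_iff (w := 0) fun x => by fin_cases x <;> simp [netGraph])
  · exact h f 4 (isEndVertex_iff (w := 1) fun x => by fin_cases x <;> simp [netGraph])
  · exact h f 5 (isEndVertex_iff (w := 2) fun x => by fin_cases x <;> simp [netGraph])

theorem EndsHeavy.wounded [Fintype V] {G : SimpleGraph V} (h : EndsHeavy woundedGraph G)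
    {v₀ v₁ v₂ v₃ v₄ v₅ : V} (h01 : G.Adj v₀ v₁) (h02 : G.Adj v₀ v₂) (h12 : G.Adj v₁ v₂)
    (h13 : G.Adj v₁ v₃) (h24 : G.Adj v₂ v₄) (h45 : G.Adj v₄ v₅) (h03 : Far G v₀ v₃)
    (h04 : Far G v₀ v₄) (h05 : Far G v₀ v₅) (h14 : Far G v₁ v₄) (h15 : Far G v₁ v₅)
    (h23 : Far G v₂ v₃) (h25 : Far G v₂ v₅) (h34 : Far G v₃ v₄) (h35 : Far G v₃ v₅) :
    Heavy G v₃ ∧ Heavy G v₅ := by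
  let f : woundedGraph ↪g G := embeddingOfLt ![v₀, v₁, v₂, v₃, v₄, v₅] (by
    intro i j hij
    fin_cases i <;> fin_cases j <;>
      first
      | exact absurd hij (by decide)
      | simp [h01.ne, h02.ne, h12.ne, h13.ne, h24.ne, h45.ne, h03.1, h04.1, h05.1, h14.1, h15.1,
          h23.1, h25.1, h34.1, h35.1]) (by
    intro i j hij
    fin_cases i <;> fin_cases j <;>
      first
      | exact absurd hij (by decide)
      | simp [woundedGraph, h01, h02, h12, h13, h24, h45, h03.2, h04.2, h05.2, h14.2, h15.2,
          h23.2, h25.2, h34.2, h35.2])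
  exact ⟨h f 3 (isEndVertex_iff (w := 1) fun x => by fin_cases x <;> simp [woundedGraph]),
    h f 5 (isEndVertex_iff (w := 4) fun x => by fin_cases x <;> simp [woundedGraph])⟩

end ClawFree

/-! ### Spiders at the branch nodes of a theta. -/

namespace ClawFree

variable {V : Type*}

open List

/-- All lines of `D` through `v` belong to `Q`. -/
def LinesIn (D : SimpleGraph V) (v : V) (Q : Set (Node D)) : Prop :=
  ∀ N : Node D, IsLine D N.1 → v ∈ N → N ∈ Q

theorem LinesIn.mono {D : SimpleGraph V} {v : V} {Q Q' : Set (Node D)} (h : LinesIn D v Q)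
    (hQ : Q ⊆ Q') : LinesIn D v Q' := fun N hN hv => hQ (h N hN hv)

theorem isLine_edgeNode {D : SimpleGraph V} {u v : V} (h : D.Adj u v) : IsLine D (edgeNode h).1 :=
  ⟨u, v, h, rfl⟩

/-- Equal or adjacent vertices share a line. Nonadjacency in `D` is therefore certified by disjoint
sets of nodes. -/
theorem LinesIn.far {D : SimpleGraph V} (hdeg : ∀ v, ∃ u, D.Adj v u) {v w : V}
    {Q Q' : Set (Node D)} (h : LinesIn D v Q) (h' : LinesIn D w Q') (hd : ∀ N ∈ Q, N ∉ Q') :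
    Far D v w := by
  constructor
  · rintro rfl
    obtain ⟨u, hu⟩ := hdeg v
    exact hd _ (h _ (isLine_edgeNode hu) (left_mem_edgeNode hu))
      (h' _ (isLine_edgeNode hu) (left_mem_edgeNode hu))
  · intro hvw
    exact hd _ (h _ (isLine_edgeNode hvw) (left_mem_edgeNode hvw))
      (h' _ (isLine_edgeNode hvw) (right_mem_edgeNode hvw))

theorem linesIn_of_two {D : SimpleGraph V} (hD : DiamondFree D) (hc : NoClaw D)
    (hdeg : ∀ v, ∃ u, D.Adj v u) {v : V} {K L : Node D} {Q : Set (Node D)} (hvK : v ∈ K)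
    (hvL : v ∈ L) (hKL : K ≠ L) (hK : K ∈ Q) (hL : L ∈ Q) : LinesIn D v Q := by
  intro N _ hv
  rcases Node.eq_or_eq hD hc hdeg hvK hvL hKL hv with rfl | rfl <;> assumption

theorem Node.isLine_of_ne {D : SimpleGraph V} {K : Node D} {p q : V} (hp : p ∈ K) (hq : q ∈ K)
    (hpq : p ≠ q) : IsLine D K.1 := by
  rcases K.2 with h | ⟨v, -, h⟩
  · exact h
  · change p ∈ K.1 at hp
    change q ∈ K.1 at hq
    rw [h] at hp hq
    exact absurd (hp.trans (Eq.symm hq)) hpq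

/-- The second node of a simplicial vertex is its singleton, which is not a line. -/
theorem linesIn_of_simplicial {D : SimpleGraph V} (hD : DiamondFree D) (hc : NoClaw D)
    (hdeg : ∀ v, ∃ u, D.Adj v u) {v : V} {K : Node D} {Q : Set (Node D)} (hs : Simplicial D v)
    (hv : v ∈ K) (hK : IsLine D K.1) (hKQ : K ∈ Q) : LinesIn D v Q := by
  have hnl : ¬ IsLine D (singletonNode hs).1 := by
    rintro ⟨x, y, hxy, h⟩
    have h1 : x ∈ (singletonNode hs).1 := h ▸ left_mem_line D x y
    have h2 : y ∈ (singletonNode hs).1 := h ▸ right_mem_line D x y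
    exact hxy.ne (Eq.trans h1 (Eq.symm h2))
  intro N hN hvN
  have hne : K ≠ singletonNode hs := fun h => hnl (h ▸ hK)
  rcases Node.eq_or_eq hD hc hdeg hv (show v ∈ singletonNode hs from rfl) hne hvN with rfl | rfl
  · exact hKQ
  · exact absurd hN hnl

/-- A node `A` with three arms `A, L i, Z i`, the `i`-th arm being confined to the set `Q i`. -/
structure Spider (D : SimpleGraph V) (A : Node D) (L Z : Fin 3 → Node D)
    (Q : Fin 3 → Set (Node D)) (a c : Fin 3 → V) : Prop where
  L_mem : ∀ i, L i ∈ Q i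
  Z_mem : ∀ i, Z i ∈ Q i
  L_ne_Z : ∀ i, L i ≠ Z i
  A_notMem : ∀ i, A ∉ Q i
  disj : ∀ i j, i ≠ j → ∀ N ∈ Q i, N ∉ Q j
  a_mem_A : ∀ i, a i ∈ A
  a_mem_L : ∀ i, a i ∈ L i
  c_mem_L : ∀ i, c i ∈ L i
  c_mem_Z : ∀ i, c i ∈ Z i

section Spider

variable {D : SimpleGraph V} {A : Node D} {L Z : Fin 3 → Node D} {Q : Fin 3 → Set (Node D)}
  {a c : Fin 3 → V}

/-- The vertices that may occur on the `i`-th leg of a net lifted from a spider. -/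
def armSet (D : SimpleGraph V) (A : Node D) (L : Fin 3 → Node D) (a c : Fin 3 → V) (i : Fin 3) :
    Set V := {v | v = a i ∨ v = c i ∨ (Simplicial D v ∧ (v ∈ A ∨ v ∈ L i))}

theorem Spider.A_ne_L (h : Spider D A L Z Q a c) (i : Fin 3) : A ≠ L i := fun he =>
  h.A_notMem i (he ▸ h.L_mem i)

theorem Spider.A_ne_Z (h : Spider D A L Z Q a c) (i : Fin 3) : A ≠ Z i := fun he =>
  h.A_notMem i (he ▸ h.Z_mem i)

variable (hD : DiamondFree D) (hc : NoClaw D) (hdeg : ∀ v, ∃ u, D.Adj v u)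

include hD hc hdeg

theorem Spider.c_notMem_A (h : Spider D A L Z Q a c) (i : Fin 3) : c i ∉ A := fun hA =>
  (Node.eq_or_eq hD hc hdeg (h.c_mem_L i) (h.c_mem_Z i) (h.L_ne_Z i) hA).elim (h.A_ne_L i)
    (h.A_ne_Z i)

theorem Spider.a_ne_c (h : Spider D A L Z Q a c) (i : Fin 3) : a i ≠ c i := fun he =>
  h.c_notMem_A hD hc hdeg i (he ▸ h.a_mem_A i)

theorem Spider.isLine_L (h : Spider D A L Z Q a c) (i : Fin 3) : IsLine D (L i).1 :=
  Node.isLine_of_ne (h.a_mem_L i) (h.c_mem_L i) (h.a_ne_c hD hc hdeg i)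

theorem Spider.a_ne_a (h : Spider D A L Z Q a c) {i j : Fin 3} (hij : i ≠ j) : a i ≠ a j := by
  intro he
  rcases Node.eq_or_eq hD hc hdeg (h.a_mem_A i) (h.a_mem_L i) (h.A_ne_L i)
    (he ▸ h.a_mem_L j : a i ∈ L j) with h' | h'
  · exact h.A_ne_L j h'.symm
  · exact h.disj i j hij _ (h.L_mem i) (h' ▸ h.L_mem j)

theorem Spider.isLine_A (h : Spider D A L Z Q a c) : IsLine D A.1 :=
  Node.isLine_of_ne (h.a_mem_A 0) (h.a_mem_A 1) (h.a_ne_a hD hc hdeg (by decide))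

theorem Spider.linesIn_a (h : Spider D A L Z Q a c) (i : Fin 3) : LinesIn D (a i) {A, L i} :=
  linesIn_of_two hD hc hdeg (h.a_mem_A i) (h.a_mem_L i) (h.A_ne_L i) (Or.inl rfl) (Or.inr rfl)

theorem Spider.linesIn_c (h : Spider D A L Z Q a c) (i : Fin 3) : LinesIn D (c i) (Q i) :=
  linesIn_of_two hD hc hdeg (h.c_mem_L i) (h.c_mem_Z i) (h.L_ne_Z i) (h.L_mem i) (h.Z_mem i)

omit hD hc hdeg in
theorem Spider.mem_of_armSet (h : Spider D A L Z Q a c) {i : Fin 3} {v : V}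
    (hv : v ∈ armSet D A L a c i) : v ∈ A ∨ v ∈ L i := by
  rcases hv with rfl | rfl | hv
  · exact Or.inl (h.a_mem_A i)
  · exact Or.inr (h.c_mem_L i)
  · exact hv.2

theorem Spider.linesIn_of_mem (h : Spider D A L Z Q a c) {i : Fin 3} {v : V}
    (hv : v ∈ armSet D A L a c i) (hA : v ∈ A) : LinesIn D v {A, L i} := by
  rcases hv with rfl | rfl | ⟨hs, -⟩
  · exact h.linesIn_a hD hc hdeg i
  · exact absurd hA (h.c_notMem_A hD hc hdeg i)
  · exact linesIn_of_simplicial hD hc hdeg hs hA (h.isLine_A hD hc hdeg) (Or.inl rfl)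

theorem Spider.linesIn_of_notMem (h : Spider D A L Z Q a c) {i : Fin 3} {v : V}
    (hv : v ∈ armSet D A L a c i) (hA : v ∉ A) : LinesIn D v (Q i) := by
  rcases hv with rfl | rfl | ⟨hs, hv⟩
  · exact absurd (h.a_mem_A i) hA
  · exact h.linesIn_c hD hc hdeg i
  · exact linesIn_of_simplicial hD hc hdeg hs (hv.resolve_left hA) (h.isLine_L hD hc hdeg i)
      (h.L_mem i)

theorem Spider.linesIn (h : Spider D A L Z Q a c) {i : Fin 3} {v : V}
    (hv : v ∈ armSet D A L a c i) : LinesIn D v (insert A (Q i)) := by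
  by_cases hA : v ∈ A
  · refine (h.linesIn_of_mem hD hc hdeg hv hA).mono ?_
    rintro N (rfl | rfl)
    · exact Or.inl rfl
    · exact Or.inr (h.L_mem i)
  · exact (h.linesIn_of_notMem hD hc hdeg hv hA).mono fun N hN => Or.inr hN

theorem Spider.isNet (h : Spider D A L Z Q a c) : IsNet D a fun i => [c i] := by
  have hac : ∀ i, D.Adj (a i) (c i) := fun i =>
    (L i).adj hD (h.a_mem_L i) (h.c_mem_L i) (h.a_ne_c hD hc hdeg i)
  have hfar : ∀ i j, i ≠ j → Far D (c i) (c j) := fun i j hij =>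
    (h.linesIn_c hD hc hdeg i).far hdeg (h.linesIn_c hD hc hdeg j) (h.disj i j hij)
  have hfar' : ∀ i j, i ≠ j → Far D (a i) (c j) := fun i j hij => by
    refine (h.linesIn_a hD hc hdeg i).far hdeg (h.linesIn_c hD hc hdeg j) ?_
    rintro N (rfl | rfl)
    · exact h.A_notMem j
    · exact h.disj i j hij _ (h.L_mem i)
  refine ⟨fun i => ⟨by simpa using h.a_ne_c hD hc hdeg i, by simpa using hac i, by simp,
    by simp, trivial⟩, ?_⟩
  intro i j hij p hp q hq
  simp only [List.mem_cons, List.not_mem_nil, or_false] at hp hq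
  rcases hp with rfl | rfl <;> rcases hq with rfl | rfl
  · simpa using ⟨h.a_ne_a hD hc hdeg hij, A.adj hD (h.a_mem_A i) (h.a_mem_A j)
      (h.a_ne_a hD hc hdeg hij)⟩
  · refine ⟨(hfar' i j hij).1, fun h' => absurd h' (hfar' i j hij).2, fun h' => ?_⟩
    exact absurd h'.2.symm (h.a_ne_c hD hc hdeg j)
  · refine ⟨(hfar' j i hij.symm).1.symm, fun h' => absurd h'.symm (hfar' j i hij.symm).2,
      fun h' => ?_⟩
    exact absurd h'.1.symm (h.a_ne_c hD hc hdeg i)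
  · refine ⟨(hfar i j hij).1, fun h' => absurd h' (hfar i j hij).2, fun h' => ?_⟩
    exact absurd h'.1.symm (h.a_ne_c hD hc hdeg i)

omit hD hc hdeg in
/-- The line through a simplicial vertex contains all its neighbours. -/
theorem exists_line_of_simplicial {x p q : V} (hs : Simplicial D x) (hp : D.Adj x p)
    (hq : D.Adj x q) : ∃ K : Node D, IsLine D K.1 ∧ x ∈ K ∧ p ∈ K ∧ q ∈ K := by
  refine ⟨edgeNode hp, isLine_edgeNode hp, left_mem_edgeNode hp, right_mem_edgeNode hp, ?_⟩
  by_cases hpq : q = p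
  · exact hpq ▸ right_mem_edgeNode hp
  · exact Or.inr (Or.inr ⟨hq.symm, hs _ _ hq hp hpq⟩)

/-- The line through `x`, `p`, `q` is `A` or `L i`: either one of `p`, `q` is in `A` and has no
other lines, or both lie in `L i`. -/
theorem Spider.leafClosed (h : Spider D A L Z Q a c) (i : Fin 3) :
    LeafClosed D (armSet D A L a c i) := by
  intro x p q hs hp hq hpq hxp hxq
  obtain ⟨K, hK, hxK, hpK, hqK⟩ := exists_line_of_simplicial hs hxp hxq
  have main : ∀ v ∈ armSet D A L a c i, v ∈ A → v ∈ K → x ∈ armSet D A L a c i := by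
    intro v hv hvA hvK
    rcases h.linesIn_of_mem hD hc hdeg hv hvA K hK hvK with rfl | rfl
    · exact Or.inr (Or.inr ⟨hs, Or.inl hxK⟩)
    · exact Or.inr (Or.inr ⟨hs, Or.inr hxK⟩)
  rcases h.mem_of_armSet hp with hp' | hp'
  · exact main p hp hp' hpK
  rcases h.mem_of_armSet hq with hq' | hq'
  · exact main q hq hq' hqK
  obtain rfl := Node.eq_of_mem hD hpK hqK hp' hq' hpq
  exact Or.inr (Or.inr ⟨hs, Or.inr hxK⟩)

/-- A hub that sees two different arms lies on a line belonging to both arm sets with `A` added;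
since arms are disjoint, this line is `A`, and the hub is admissible on every leg. -/
theorem Spider.lift (h : Spider D A L Z Q a c) {G : SimpleGraph V} (hG : NoClaw G)
    (hst : Relation.ReflTransGen CompletionStep G D) :
    ∃ t r, IsNet G t r ∧ (∀ i, r i ≠ []) ∧ (∀ i, (t i :: r i).getLast? = some (c i)) ∧
      ∀ i, ∀ v ∈ t i :: r i, v ∈ armSet D A L a c i := by
  obtain ⟨t, r, h1, h2, h3, h4⟩ := (h.isNet hD hc hdeg).lift hG hst
    (S := armSet D A L a c) (h.leafClosed hD hc hdeg) (by
      intro x i j hij p hp q hq hs hxp hxq k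
      obtain ⟨K, hK, hxK, hpK, hqK⟩ := exists_line_of_simplicial hs hxp hxq
      have hKA : K = A := by
        rcases h.linesIn hD hc hdeg hp K hK hpK with h1 | h1
        · exact h1
        rcases h.linesIn hD hc hdeg hq K hK hqK with h2 | h2
        · exact h2
        exact absurd h2 (h.disj i j hij K h1)
      exact Or.inr (Or.inr ⟨hs, Or.inl (hKA ▸ hxK)⟩))
    (fun i => by simp) (by
      intro i v hv
      simp only [List.mem_cons, List.not_mem_nil, or_false] at hv
      rcases hv with rfl | rfl
      · exact Or.inl rfl
      · exact Or.inr (Or.inl rfl))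
  refine ⟨t, r, h1, fun i he => ?_, fun i => (h2 i).trans (by simp), h4⟩
  have := h3 i
  rw [he] at this
  simp at this

end Spider

/-- The nodes of a leg, and the nodes outside `U` that are adjacent to it. -/
def legSet {X : Type*} (F : SimpleGraph X) (U : Set X) (l : List X) : Set X :=
  {N | N ∈ l ∨ (N ∉ U ∧ ∃ M ∈ l, F.Adj N M)}

theorem legSet_reverse {X : Type*} (F : SimpleGraph X) (U : Set X) (l : List X) :
    legSet F U l.reverse = legSet F U l := by
  simp [legSet]

/-- A node outside `U` attached to two legs would have two neighbours in `U`. -/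
theorem IsTheta.disj_legSet {X : Type*} {F : SimpleGraph X} {U : Set X} {A B : X}
    {α : Fin 3 → List X} (h : IsTheta F U A B α) (hJ : OuterSparse F U) {i j : Fin 3} (hij : i ≠ j)
    {N : X} (hi : N ∈ legSet F U (α i)) : N ∉ legSet F U (α j) := by
  rintro (hj | ⟨hj, M, hM, hNM⟩)
  · rcases hi with hi | ⟨hi, -⟩
    · exact h.disj i j hij N hi hj
    · exact hi ((h.leg j).sub N hj)
  · rcases hi with hi | ⟨-, M', hM', hNM'⟩
    · exact hj ((h.leg i).sub N hi)
    · have := hJ N hj M ((h.leg j).sub M hM) M' ((h.leg i).sub M' hM') hNM hNM'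
      exact h.disj i j hij M' hM' (this ▸ hM)

theorem IsTheta.left_notMem {X : Type*} {F : SimpleGraph X} {U : Set X} {A B : X}
    {α : Fin 3 → List X} (h : IsTheta F U A B α) (i : Fin 3) : A ∉ legSet F U (α i) := by
  rintro (h' | h')
  · exact (h.leg i).left h'
  · exact h'.1 h.left

theorem IsTheta.right_notMem {X : Type*} {F : SimpleGraph X} {U : Set X} {A B : X}
    {α : Fin 3 → List X} (h : IsTheta F U A B α) (i : Fin 3) : B ∉ legSet F U (α i) := by
  rintro (h' | h')
  · exact (h.leg i).right h'
  · exact h'.1 h.right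

/-- `Z i` is the second node of the leg or, for a leg with one node, the neighbour outside `U` that
goodness provides. -/
theorem IsTheta.exists_spider {D : SimpleGraph V} {U : Set (Node D)} {A B : Node D}
    {α : Fin 3 → List (Node D)} (h : IsTheta (nodeGraph D) U A B α)
    (hJ : OuterSparse (nodeGraph D) U) :
    ∃ L Z a c, Spider D A L Z (fun i => legSet (nodeGraph D) U (α i)) a c ∧
      ∀ i, (α i = [L i] ∧ Z i ∉ U) ∨ ∃ s, α i = L i :: Z i :: s := by
  have key : ∀ i, ∃ L Z a c, L ∈ legSet (nodeGraph D) U (α i) ∧ Z ∈ legSet (nodeGraph D) U (α i) ∧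
      L ≠ Z ∧ a ∈ A ∧ a ∈ L ∧ c ∈ L ∧ c ∈ Z ∧ ((α i = [L] ∧ Z ∉ U) ∨ ∃ s, α i = L :: Z :: s) := by
    intro i
    have hch := (h.leg i).chain
    rcases e : α i with _ | ⟨L, _ | ⟨Z, s⟩⟩
    · rcases (h.leg i).good with h' | ⟨m, h', -⟩ <;> simp [e] at h'
    · rcases (h.leg i).good with h' | ⟨m, h', Z, hZ, hmZ⟩
      · simp [e] at h'
      obtain rfl : L = m := by simpa [e] using h'
      rw [e] at hch
      simp only [List.cons_append, List.isChain_cons_cons] at hch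
      obtain ⟨⟨-, a, ha, ha'⟩, -⟩ := hch
      obtain ⟨hne, c, hc, hc'⟩ := hmZ
      exact ⟨L, Z, a, c, Or.inl (by simp), Or.inr ⟨hZ, L, by simp, hne.symm, c, hc', hc⟩, hne, ha,
        ha', hc, hc', Or.inl ⟨rfl, hZ⟩⟩
    · rw [e] at hch
      simp only [List.cons_append, List.isChain_cons_cons] at hch
      obtain ⟨⟨-, a, ha, ha'⟩, ⟨hne, c, hc, hc'⟩, -⟩ := hch
      exact ⟨L, Z, a, c, Or.inl (by simp), Or.inl (by simp), hne, ha, ha', hc, hc',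
        Or.inr ⟨s, rfl⟩⟩
  choose L Z a c h1 h2 h3 h4 h5 h6 h7 h8 using key
  exact ⟨L, Z, a, c, ⟨h1, h2, h3, h.left_notMem, fun i j hij N hN => h.disj_legSet hJ hij hN, h4, h5,
    h6, h7⟩, h8⟩

end ClawFree

/-! ### Double counting at six heavy vertices. -/

namespace ClawFree

variable {V : Type*}

open List

variable [Fintype V] {G D : SimpleGraph V} (hG : NoClaw G) (hle : G ≤ D) (hD : DiamondFree D)
  (hc : NoClaw D) (hdeg : ∀ v, ∃ u, D.Adj v u) (hham : ¬ HasHamCyc D)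

include hle hD hc hdeg hham in
theorem not_three_heavy_of_linesIn {v₁ v₂ v₃ : V} {Q₁ Q₂ Q₃ : Set (Node D)}
    (h₁ : LinesIn D v₁ Q₁) (h₂ : LinesIn D v₂ Q₂) (h₃ : LinesIn D v₃ Q₃)
    (h₁₂ : ∀ N ∈ Q₁, N ∉ Q₂) (h₁₃ : ∀ N ∈ Q₁, N ∉ Q₃) (h₂₃ : ∀ N ∈ Q₂, N ∉ Q₃)
    (w₁ : Heavy G v₁) (w₂ : Heavy G v₂) (w₃ : Heavy G v₃) : False :=
  not_three_heavy hc hD hham (h₁.far hdeg h₂ h₁₂) (h₁.far hdeg h₃ h₁₃) (h₂.far hdeg h₃ h₂₃)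
    (w₁.mono hle) (w₂.mono hle) (w₃.mono hle)

variable {A B : Node D} {L M Z Z' : Fin 3 → Node D} {Q : Fin 3 → Set (Node D)}
  {a c b c' p p' : Fin 3 → V}

include hle hD hc hdeg hham in
-- Both spiders share the leg sets `Q`. If `p i` is off `A`, its lines lie in `Q i`, and a `p' k` in
-- `B` with `k ≠ i` would complete it and some `p j` to three far heavy vertices. So both such `p'
-- k` are off `B`, and then the three vertices `p'` are pairwise far in `D`.
theorem Spider.heavy_mem (hA : Spider D A L Z Q a c) (hB : Spider D B M Z' Q b c') (hAB : A ≠ B)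
    (hp : ∀ i, p i ∈ armSet D A L a c i) (hp' : ∀ i, p' i ∈ armSet D B M b c' i)
    (w : ∀ i, Heavy G (p i)) (w' : ∀ i, Heavy G (p' i)) (i : Fin 3) : p i ∈ A := by
  by_contra hi
  obtain ⟨j, k, hij, hik, hjk⟩ := (by decide : ∀ i : Fin 3, ∃ j k, i ≠ j ∧ i ≠ k ∧ j ≠ k) i
  have key : ∀ j k, i ≠ j → i ≠ k → j ≠ k → p' k ∉ B := by
    intro j k hij hik hjk hk
    have hk' : LinesIn D (p' k) {B, M k} := hB.linesIn_of_mem hD hc hdeg (hp' k) hk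
    refine not_three_heavy_of_linesIn hle hD hc hdeg hham
      (hA.linesIn_of_notMem hD hc hdeg (hp i) hi) (hA.linesIn hD hc hdeg (hp j)) hk' ?_ ?_ ?_
      (w i) (w j) (w' k)
    · rintro N hN (rfl | hN')
      · exact hA.A_notMem i hN
      · exact hA.disj i j hij N hN hN'
    · rintro N hN (rfl | rfl)
      · exact hB.A_notMem i hN
      · exact hA.disj i k hik _ hN (hB.L_mem k)
    · rintro N (rfl | hN) (rfl | rfl)
      · exact hAB rfl
      · exact hA.A_notMem k (hB.L_mem k)
      · exact hB.A_notMem j hN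
      · exact hA.disj j k hjk _ hN (hB.L_mem k)
  refine not_three_heavy_of_linesIn hle hD hc hdeg hham
    (hB.linesIn_of_notMem hD hc hdeg (hp' j) (key k j hik hij hjk.symm))
    (hB.linesIn_of_notMem hD hc hdeg (hp' k) (key j k hij hik hjk))
    (hB.linesIn hD hc hdeg (hp' i)) (hB.disj j k hjk) ?_ ?_ (w' j) (w' k) (w' i)
  · rintro N hN (rfl | hN')
    · exact hB.A_notMem j hN
    · exact hB.disj i j hij N hN' hN
  · rintro N hN (rfl | hN')
    · exact hB.A_notMem k hN
    · exact hB.disj i k hik N hN' hN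

open Classical in
-- A number is at most one more than the number of pairs it has.
theorem bits_le (P : Fin 3 → Prop) : (∑ i, if P i then 1 else 0) ≤
    1 + ((if P 0 ∧ P 1 then 1 else 0) + (if P 0 ∧ P 2 then 1 else 0) +
      (if P 1 ∧ P 2 then 1 else 0)) := by
  rw [Fin.sum_univ_three]
  by_cases h0 : P 0 <;> by_cases h1 : P 1 <;> by_cases h2 : P 2 <;> simp [h0, h1, h2]

open Classical in
/-- The number of pairs of the nodes `L i` that meet in `y`. -/
noncomputable def pairCount (L : Fin 3 → Node D) (y : V) : ℕ :=
  (if y ∈ L 0 ∧ y ∈ L 1 then 1 else 0) + (if y ∈ L 0 ∧ y ∈ L 2 then 1 else 0) +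
      (if y ∈ L 1 ∧ y ∈ L 2 then 1 else 0)

include hD in
-- Each of the three pairs of distinct nodes shares at most one vertex.
theorem sum_pairCount_le (hL : ∀ i j, i ≠ j → L i ≠ L j) : ∑ y, pairCount L y ≤ 3 := by
  classical
  have key : ∀ i j, i ≠ j → ∑ y, (if y ∈ L i ∧ y ∈ L j then 1 else 0) ≤ 1 := by
    intro i j hij
    rw [← Finset.card_filter, Finset.card_le_one]
    intro x hx y hy
    simp only [Finset.mem_filter, Finset.mem_univ, true_and] at hx hy
    by_contra hxy
    exact hL i j hij (Node.eq_of_mem hD hx.1 hy.1 hx.2 hy.2 hxy)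
  simp only [pairCount, Finset.sum_add_distrib]
  have h1 := key 0 1 (by decide)
  have h2 := key 0 2 (by decide)
  have h3 := key 1 2 (by decide)
  omega

omit [Fintype V] in
theorem Spider.L_ne_L (hA : Spider D A L Z Q a c) (i j : Fin 3) (hij : i ≠ j) : L i ≠ L j :=
  fun h => hA.disj i j hij _ (hA.L_mem i) (h ▸ hA.L_mem j)

include hG hle hD hc hdeg hham in
-- Among the six vertices only `p k` and `p' k` can be adjacent in `G`. Heaviness makes their degree
-- sum at least `2n + 6`; counted from the other side it is at most `2n`, plus `6` for pairs of
-- meeting nodes, minus `6` for the six vertices themselves.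
theorem Spider.false_of_heavy (hA : Spider D A L Z Q a c) (hB : Spider D B M Z' Q b c')
    (hAB : A ≠ B) (hp : ∀ i, p i ∈ armSet D A L a c i) (hp' : ∀ i, p' i ∈ armSet D B M b c' i)
    (w : ∀ i, Heavy G (p i)) (w' : ∀ i, Heavy G (p' i))
    (f : ∀ i j, i ≠ j → Far G (p i) (p j)) (f' : ∀ i j, i ≠ j → Far G (p' i) (p' j)) : False := by
  classical
  have mA := hA.heavy_mem hle hD hc hdeg hham hB hAB hp hp' w w'
  have mB := hB.heavy_mem hle hD hc hdeg hham hA hAB.symm hp' hp w' w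
  have lA := fun i => hA.linesIn_of_mem hD hc hdeg (hp i) (mA i)
  have lB := fun i => hB.linesIn_of_mem hD hc hdeg (hp' i) (mB i)
  have hfar : ∀ i j, i ≠ j → Far D (p i) (p' j) := by
    intro i j hij
    refine (lA i).far hdeg (lB j) ?_
    rintro N (rfl | rfl) (h | h)
    · exact hAB h
    · exact hA.A_notMem j (h ▸ hB.L_mem j)
    · exact hB.A_notMem i (h ▸ hA.L_mem i)
    · exact hA.disj i j hij _ (hA.L_mem i) (h ▸ hB.L_mem j)
  have hne : ∀ i, p i ≠ p' i := by
    intro i he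
    rcases lA i B (hB.isLine_A hD hc hdeg) (he ▸ mB i) with h | h
    · exact hAB h.symm
    · exact hB.A_notMem i (h ▸ hA.L_mem i)
  set q : Fin 3 ⊕ Fin 3 → V := Sum.elim p p' with hq
  have hqinj : Function.Injective q := by
    rintro (i | i) (j | j) h <;> by_cases hij : i = j
    · rw [hij]
    · exact absurd h (f i j hij).1
    · exact absurd (hij ▸ h) (hne i)
    · exact absurd h (hfar i j hij).1
    · exact absurd (hij ▸ h.symm) (hne i)
    · exact absurd h.symm (hfar j i (Ne.symm hij)).1
    · rw [hij]
    · exact absurd h (f' i j hij).1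
  have hmatch : ∀ s s', G.Adj (q s) (q s') →
      ∃ k, (s = .inl k ∧ s' = .inr k) ∨ (s = .inr k ∧ s' = .inl k) := by
    rintro (i | i) (j | j) h <;> by_cases hij : i = j
    · subst hij; exact absurd h (G.irrefl)
    · exact absurd h (f i j hij).2
    · exact ⟨i, Or.inl ⟨rfl, hij ▸ rfl⟩⟩
    · exact absurd (hle h) (hfar i j hij).2
    · exact ⟨i, Or.inr ⟨rfl, hij ▸ rfl⟩⟩
    · exact absurd (hle h.symm) (hfar j i (Ne.symm hij)).2
    · subst hij; exact absurd h (G.irrefl)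
    · exact absurd h (f' i j hij).2
  set F : V → ℕ := fun y => (Finset.univ.filter fun s => G.Adj y (q s)).card with hF
  have bound : ∀ y, F y + (if y ∈ Finset.univ.image q then 1 else 0) ≤
      2 + (pairCount L y + pairCount M y) := by
    intro y
    by_cases hy : y ∈ Finset.univ.image q
    · rw [if_pos hy]
      obtain ⟨s, -, rfl⟩ := Finset.mem_image.1 hy
      have : F (q s) ≤ 1 := by
        rw [hF, Finset.card_le_one]
        intro s₁ h₁ s₂ h₂
        simp only [Finset.mem_filter, Finset.mem_univ, true_and] at h₁ h₂
        obtain ⟨k, ⟨rfl, rfl⟩ | ⟨rfl, rfl⟩⟩ := hmatch s s₁ h₁ <;>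
          obtain ⟨k', h | h⟩ := hmatch _ s₂ h₂ <;> simp_all
      omega
    · rw [if_neg hy, Nat.add_zero]
      -- A vertex seeing such an adjacent pair lies in `L k = M k` and off `A` and `B`, so it sees
      -- `p i` only if it is in `L i`, and `p' i` only if it is in `M i`. Otherwise its neighbours
      -- among the six are independent, hence at most two.
      by_cases hmt : ∃ k, G.Adj y (p k) ∧ G.Adj y (p' k) ∧ G.Adj (p k) (p' k)
      · obtain ⟨k, h1, h2, h3⟩ := hmt
        have hN := isLine_edgeNode (hle h3)
        have hyN : y ∈ edgeNode (hle h3) := Or.inr (Or.inr ⟨hle h1, hle h2⟩)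
        have e1 : edgeNode (hle h3) = L k := by
          rcases lA k _ hN (left_mem_edgeNode _) with h | h
          · rcases lB k _ hN (right_mem_edgeNode _) with h' | h'
            · exact absurd (h.symm.trans h') hAB
            · exact absurd (h.symm.trans h' ▸ hB.L_mem k) (hA.A_notMem k)
          · exact h
        have e2 : edgeNode (hle h3) = M k := by
          rcases lB k _ hN (right_mem_edgeNode _) with h | h
          · exact absurd (h.symm.trans e1 ▸ hA.L_mem k) (hB.A_notMem k)
          · exact h
        have hyA : y ∉ A := fun hyA => hA.A_ne_L k
          (Node.eq_of_mem hD hyA (mA k) (e1 ▸ hyN) (e1 ▸ left_mem_edgeNode _) h1.ne)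
        have hyB : y ∉ B := fun hyB => hB.A_ne_L k
          (Node.eq_of_mem hD hyB (mB k) (e2 ▸ hyN) (e2 ▸ right_mem_edgeNode _) h2.ne)
        have g1 : ∀ i, G.Adj y (p i) → y ∈ L i := by
          intro i hi
          rcases lA i _ (isLine_edgeNode (hle hi)) (right_mem_edgeNode _) with h | h
          · exact absurd (h ▸ left_mem_edgeNode (hle hi)) hyA
          · exact h ▸ left_mem_edgeNode (hle hi)
        have g2 : ∀ i, G.Adj y (p' i) → y ∈ M i := by
          intro i hi
          rcases lB i _ (isLine_edgeNode (hle hi)) (right_mem_edgeNode _) with h | h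
          · exact absurd (h ▸ left_mem_edgeNode (hle hi)) hyB
          · exact h ▸ left_mem_edgeNode (hle hi)
        have s1 : (∑ i, if G.Adj y (p i) then 1 else 0) ≤ ∑ i, if y ∈ L i then 1 else 0 :=
          Finset.sum_le_sum fun i _ => by
            by_cases h : G.Adj y (p i)
            · simp [h, g1 i h]
            · simp [h]
        have s2 : (∑ i, if G.Adj y (p' i) then 1 else 0) ≤ ∑ i, if y ∈ M i then 1 else 0 :=
          Finset.sum_le_sum fun i _ => by
            by_cases h : G.Adj y (p' i)
            · simp [h, g2 i h]
            · simp [h]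
        have t1 := bits_le fun i => y ∈ L i
        have t2 := bits_le fun i => y ∈ M i
        have e : F y = (∑ i, if G.Adj y (p i) then 1 else 0) +
            ∑ i, if G.Adj y (p' i) then 1 else 0 := by
          rw [hF]
          simp only [Finset.card_filter, Fintype.sum_sum_type, hq, Sum.elim_inl, Sum.elim_inr]
          congr!
        simp only [pairCount]
        omega
      · have : F y ≤ 2 := by
          by_contra hcon
          rw [hF] at hcon
          push Not at hcon
          obtain ⟨s₁, h₁, s₂, h₂, s₃, h₃, h12, h13, h23⟩ := Finset.two_lt_card.1 hcon
          simp only [Finset.mem_filter, Finset.mem_univ, true_and] at h₁ h₂ h₃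
          have key : ∀ s s', G.Adj y (q s) → G.Adj y (q s') → ¬ G.Adj (q s) (q s') := by
            intro s s' h h' hss
            obtain ⟨k, ⟨rfl, rfl⟩ | ⟨rfl, rfl⟩⟩ := hmatch s s' hss
            · exact hmt ⟨k, h, h', hss⟩
            · exact hmt ⟨k, h', h, hss.symm⟩
          rcases hG y _ _ _ h₁ h₂ h₃ (hqinj.ne h12) (hqinj.ne h23) (hqinj.ne h13) with h | h | h
          exacts [key _ _ h₁ h₂ h, key _ _ h₂ h₃ h, key _ _ h₁ h₃ h]
        omega
  have hsum := Finset.sum_le_sum fun y (_ : y ∈ (Finset.univ : Finset V)) => bound y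
  simp only [Finset.sum_add_distrib] at hsum
  have hI : ∑ y, (if y ∈ Finset.univ.image q then 1 else 0) = 6 := by
    rw [← Finset.card_filter]
    have : (Finset.univ.filter fun y => y ∈ Finset.univ.image q) = Finset.univ.image q := by
      ext; simp
    rw [this, Finset.card_image_of_injective _ hqinj]
    rfl
  have hFsum : ∑ y, F y = ∑ s, (G.neighborSet (q s)).ncard := by
    have := Finset.sum_card_bipartiteAbove_eq_sum_card_bipartiteBelow
      (s := (Finset.univ : Finset V)) (t := (Finset.univ : Finset (Fin 3 ⊕ Fin 3)))
      (fun y s => G.Adj y (q s))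
    simp only [Finset.bipartiteAbove, Finset.bipartiteBelow] at this
    rw [hF, this]
    refine Finset.sum_congr rfl fun s _ => ?_
    rw [← Set.ncard_coe_finset]
    congr 1
    ext y
    simp [G.adj_comm]
  have hheavy : ∀ s, Fintype.card V + 3 ≤ 3 * (G.neighborSet (q s)).ncard := by
    rintro (i | i)
    exacts [w i, w' i]
  have h6 := Finset.sum_le_sum fun s (_ : s ∈ (Finset.univ : Finset (Fin 3 ⊕ Fin 3))) => hheavy s
  rw [← Finset.mul_sum, ← hFsum] at h6
  simp only [Finset.sum_const, Finset.card_univ, Fintype.card_sum, Fintype.card_fin,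
    smul_eq_mul] at h6 hsum
  have k1 := sum_pairCount_le hD hA.L_ne_L
  have k2 := sum_pairCount_le hD hB.L_ne_L
  omega

end ClawFree

/-! ### Long induced paths through a theta, and lifts of single edges. -/

namespace ClawFree

variable {V : Type*}

open List

/-- Consecutive edges of a path of the root graph share a node and are adjacent in `D`; the others
share none and are far. -/
theorem indPath_edgeList {D : SimpleGraph V} (hD : DiamondFree D) (hc : NoClaw D)
    (hdeg : ∀ v, ∃ u, D.Adj v u) {e : Node D → Node D → V}
    (he : ∀ K L, (nodeGraph D).Adj K L → e K L ∈ K ∧ e K L ∈ L) {l : List (Node D)} {K : Node D}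
    (hn : (K :: l).Nodup) (hch : List.IsChain (nodeGraph D).Adj (K :: l)) :
    IndPath D (edgeList e K l) := by
  induction l generalizing K with
  | nil => trivial
  | cons L l ih =>
    have hn' := List.nodup_cons.1 hn
    have hch' := List.isChain_cons_cons.1 hch
    obtain ⟨hKL, hLl⟩ := hch'
    have hlines := linesIn_of_two hD hc hdeg (he K L hKL).1 (he K L hKL).2 hKL.1 (Q := {K, L})
      (Or.inl rfl) (Or.inr rfl)
    rw [edgeList]
    have hfar : ∀ p q, p ≠ K → p ≠ L → q ≠ K → q ≠ L → (nodeGraph D).Adj p q →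
        Far D (e K L) (e p q) := by
      intro p q h1 h2 h3 h4 hpq
      refine hlines.far hdeg (linesIn_of_two hD hc hdeg (he p q hpq).1 (he p q hpq).2 hpq.1
        (Q := {p, q}) (Or.inl rfl) (Or.inr rfl)) ?_
      rintro N (rfl | rfl) (h | h)
      exacts [h1 h.symm, h3 h.symm, h2 h.symm, h4 h.symm]
    rcases l with _ | ⟨M, l⟩
    · exact ⟨by simp [edgeList], by simp [edgeList], trivial⟩
    have hLM := (List.isChain_cons_cons.1 hLl).1
    have hchM := (List.isChain_cons_cons.1 hLl).2
    have hn2 := List.nodup_cons.1 hn'.2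
    have hhead : D.Adj (e K L) (e L M) := by
      refine L.adj hD (he K L hKL).2 (he L M hLM).1 fun h => ?_
      rcases Node.eq_or_eq hD hc hdeg (he K L hKL).1 (he K L hKL).2 hKL.1 (h ▸ (he L M hLM).2)
        with h' | h'
      · exact hn'.1 (by simp [← h'])
      · exact hLM.1 h'.symm
    have hrest : ∀ v ∈ edgeList e M l, Far D (e K L) v := by
      intro v hv
      obtain ⟨p, hp, q, hq, hpq, rfl⟩ := exists_of_mem_edgeList e hchM hv
      have hK : ∀ p ∈ M :: l, p ≠ K := fun p hp h => hn'.1 (List.mem_cons_of_mem _ (h ▸ hp))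
      have hL : ∀ p ∈ M :: l, p ≠ L := fun p hp h => hn2.1 (h ▸ hp)
      exact hfar p q (hK p hp) (hL p hp) (hK q hq) (hL q hq) hpq
    refine ⟨?_, ?_, ih hn'.2 hLl⟩
    · rw [edgeList, List.mem_cons, not_or]
      exact ⟨hhead.ne, fun h => (hrest _ h).1 rfl⟩
    · intro b hb
      rw [edgeList, List.mem_cons] at hb
      rw [edgeList, List.head?_cons, Option.some.injEq]
      rcases hb with rfl | hb
      · simp [hhead]
      · refine ⟨fun h => absurd h (hrest b hb).2, fun h => ?_⟩
        exact h ▸ hhead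
theorem length_edgeList {X : Type*} (e : X → X → V) (a : X) (l : List X) :
    (edgeList e a l).length = l.length := by
  induction l generalizing a with
  | nil => rfl
  | cons b l ih => simp [edgeList, ih]

theorem nodup_of_legs {X : Type*} {x y A B : X} {s t : List X} {Q₁ Q₂ Q₃ : Set X} (hxy : x ≠ y)
    (hx : x ∈ Q₁) (hy : y ∈ Q₁) (hs : ∀ v ∈ s, v ∈ Q₂) (ht : ∀ v ∈ t, v ∈ Q₃) (ns : s.Nodup)
    (nt : t.Nodup) (hAB : A ≠ B) (A1 : A ∉ Q₁) (A2 : A ∉ Q₂) (A3 : A ∉ Q₃) (B1 : B ∉ Q₁)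
    (B2 : B ∉ Q₂) (B3 : B ∉ Q₃) (h12 : ∀ v ∈ Q₁, v ∉ Q₂) (h13 : ∀ v ∈ Q₁, v ∉ Q₃)
    (h23 : ∀ v ∈ Q₂, v ∉ Q₃) : (x :: y :: A :: (s ++ B :: t)).Nodup := by
  have key : ∀ z ∈ Q₁, z ∉ A :: (s ++ B :: t) := by
    intro z hz h
    simp only [List.mem_cons, List.mem_append] at h
    rcases h with rfl | h | rfl | h
    exacts [A1 hz, h12 z hz (hs z h), B1 hz, h13 z hz (ht z h)]
  rw [List.nodup_cons, List.nodup_cons, List.nodup_cons, List.nodup_append, List.nodup_cons]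
  refine ⟨?_, key y hy, ?_, ns, ⟨fun h => B3 (ht B h), nt⟩, ?_⟩
  · rw [List.mem_cons, not_or]
    exact ⟨hxy, key x hx⟩
  · intro h
    simp only [List.mem_cons, List.mem_append] at h
    rcases h with h | h | h
    exacts [A2 (hs A h), hAB h, A3 (ht A h)]
  · rintro a ha b hb rfl
    rcases List.mem_cons.1 hb with rfl | hb
    · exact B2 (hs a ha)
    · exact h23 a (hs a ha) (ht a hb)

variable [Fintype V] {G D : SimpleGraph V} (hG : NoClaw G)
  (hst : Relation.ReflTransGen CompletionStep G D) (hD : DiamondFree D)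
  (hc : NoClaw D) (hdeg : ∀ v, ∃ u, D.Adj v u) (hham : ¬ HasHamCyc D)

include hst hD hc hdeg in
-- The path of nodes enters along arm `i`, passes `A`, runs through leg `j` to `B` and returns along
-- leg `k`. It has at least six edges, the first being `c i`, and lifting keeps the first vertex.
theorem EndsHeavy.heavy_of_theta (hP : EndsHeavy (SimpleGraph.pathGraph 6) G) {U : Set (Node D)}
    {A B : Node D} {α : Fin 3 → List (Node D)} (h : IsTheta (nodeGraph D) U A B α)
    {L Z : Fin 3 → Node D} {a c : Fin 3 → V}
    (hS : Spider D A L Z (fun i => legSet (nodeGraph D) U (α i)) a c)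
    (hα : ∀ i, (α i = [L i] ∧ Z i ∉ U) ∨ ∃ s, α i = L i :: Z i :: s) (i : Fin 3) :
    Heavy G (c i) := by
  have : Nonempty V := ⟨c i⟩
  obtain ⟨e, he⟩ := exists_edgeMap (D := D)
  obtain ⟨j, k, hij, hik, hjk⟩ := (by decide : ∀ i : Fin 3, ∃ j k, i ≠ j ∧ i ≠ k ∧ j ≠ k) i
  have hsub : ∀ i, ∀ v ∈ α i, v ∈ legSet (nodeGraph D) U (α i) := fun i v hv => Or.inl hv
  have hrev := ((h.leg k).reverse).chain
  have hpos : ∀ i, 1 ≤ (α i).length := by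
    intro i
    rcases hα i with ⟨h', -⟩ | ⟨s, h'⟩ <;> simp [h']
  -- A leg `k` with a single node is prolonged by `Z k`; this is needed to reach six edges when leg
  -- `j` is a single node too.
  obtain ⟨tail, t1, t2, t3, t4⟩ : ∃ tail : List (Node D),
      ((α k).reverse ++ tail).Nodup ∧ List.IsChain (nodeGraph D).Adj (B :: ((α k).reverse ++ tail)) ∧
      (∀ v ∈ (α k).reverse ++ tail, v ∈ legSet (nodeGraph D) U (α k)) ∧
      3 ≤ (α j).length + ((α k).reverse ++ tail).length := by
    rcases hα k with ⟨hk, hZ⟩ | ⟨s, hk⟩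
    · refine ⟨[Z k], ?_, ?_, ?_, ?_⟩
      · rw [hk]; simpa using hS.L_ne_Z k
      · rw [hk] at hrev ⊢
        simp only [List.reverse_singleton, List.cons_append, List.nil_append,
          List.isChain_cons_cons] at hrev ⊢
        exact ⟨hrev.1, ⟨hS.L_ne_Z k, c k, hS.c_mem_L k, hS.c_mem_Z k⟩, by simp⟩
      · intro v hv
        rcases List.mem_append.1 hv with hv | hv
        · exact Or.inl (by simpa using hv)
        · obtain rfl : v = Z k := by simpa using hv
          exact hS.Z_mem k
      · have := hpos j
        simp [hk]; omega
    · refine ⟨[], ?_, ?_, ?_, ?_⟩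
      · simpa using (h.leg k).nodup
      · rw [List.append_nil]
        have e' : B :: ((α k).reverse ++ [A]) = (B :: (α k).reverse) ++ [A] := rfl
        rw [e'] at hrev
        exact (List.isChain_append.1 hrev).1
      · intro v hv
        exact Or.inl (by simpa using hv)
      · have := hpos j
        simp [hk]; omega
  have hnd : (Z i :: L i :: A :: (α j ++ B :: ((α k).reverse ++ tail))).Nodup :=
    nodup_of_legs (hS.L_ne_Z i).symm (hS.Z_mem i) (hS.L_mem i) (hsub j) t3 (h.leg j).nodup t1 h.ne
      (h.left_notMem i) (h.left_notMem j) (h.left_notMem k) (h.right_notMem i) (h.right_notMem j)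
      (h.right_notMem k) (hS.disj i j hij) (hS.disj i k hik) (hS.disj j k hjk)
  have hch : List.IsChain (nodeGraph D).Adj
      (Z i :: L i :: A :: (α j ++ B :: ((α k).reverse ++ tail))) := by
    rw [List.isChain_cons_cons, List.isChain_cons_cons]
    refine ⟨⟨(hS.L_ne_Z i).symm, c i, hS.c_mem_Z i, hS.c_mem_L i⟩,
      ⟨(hS.A_ne_L i).symm, a i, hS.a_mem_L i, hS.a_mem_A i⟩, ?_⟩
    have := (List.isChain_split (R := (nodeGraph D).Adj) (c := B) (l₁ := A :: α j)
      (l₂ := (α k).reverse ++ tail)).2 ⟨by simpa using (h.leg j).chain, t2⟩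
    simpa using this
  have hind := indPath_edgeList hD hc hdeg he hnd hch
  have hlen := length_edgeList e (Z i) (L i :: A :: (α j ++ B :: ((α k).reverse ++ tail)))
  obtain ⟨l', h1, h2, -, h4, -⟩ := hind.lift hst (S := Set.univ) (fun _ _ _ _ _ _ _ _ _ => trivial)
    (fun _ _ => trivial)
  rw [hlen] at h4
  have hZL : (nodeGraph D).Adj (Z i) (L i) := ⟨(hS.L_ne_Z i).symm, c i, hS.c_mem_Z i, hS.c_mem_L i⟩
  have hci : e (Z i) (L i) = c i := by
    by_contra hne
    exact hZL.1 (Node.eq_of_mem hD (he _ _ hZL).1 (hS.c_mem_Z i) (he _ _ hZL).2 (hS.c_mem_L i) hne)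
  have h6 : 6 ≤ l'.length := by
    refine le_trans ?_ h4
    simp only [List.length_cons, List.length_append] at t4 ⊢
    omega
  rw [edgeList, List.head?_cons, hci] at h2
  rcases l' with _ | ⟨v₀, _ | ⟨v₁, _ | ⟨v₂, _ | ⟨v₃, _ | ⟨v₄, _ | ⟨v₅, l⟩⟩⟩⟩⟩⟩ <;>
    try (simp at h6; done)
  obtain rfl : v₀ = c i := by simpa using h2
  exact hP.path h1

omit [Fintype V] in
include hst hD hc hdeg in
/-- An edge inside a node lifts to an induced path with interior vertices simplicial in it. -/
theorem exists_edge_lift {K : Node D} {p q : V} (hp : p ∈ K) (hq : q ∈ K) (hpq : p ≠ q) :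
    ∃ x w, IndPath G (p :: x :: w) ∧ (x :: w).getLast? = some q ∧
      ∀ v ∈ x :: w, v = q ∨ ∀ Q : Set (Node D), K ∈ Q → LinesIn D v Q := by
  obtain ⟨l', h1, h2, h3, h4, h5⟩ := IndPath.lift hst
    (S := {v | v = p ∨ v = q ∨ (Simplicial D v ∧ v ∈ K)}) (l := [p, q]) (by
      intro x u v hs hu hv huv hxu hxv
      have hmem : ∀ u, (u = p ∨ u = q ∨ (Simplicial D u ∧ u ∈ K)) → u ∈ K := by
        rintro u (rfl | rfl | h)
        exacts [hp, hq, h.2]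
      obtain ⟨N, hN, hxN, huN, hvN⟩ := exists_line_of_simplicial hs hxu hxv
      obtain rfl := Node.eq_of_mem hD huN hvN (hmem u hu) (hmem v hv) huv
      exact Or.inr (Or.inr ⟨hs, hxN⟩))
    ⟨by simpa using hpq, by simpa using K.adj hD hp hq hpq, by simp, by simp, trivial⟩ (by
      intro v hv
      simp only [List.mem_cons, List.not_mem_nil, or_false] at hv
      rcases hv with rfl | rfl
      · exact Or.inl rfl
      · exact Or.inr (Or.inl rfl))
  rcases l' with _ | ⟨p', _ | ⟨x, w⟩⟩
  · simp at h4
  · simp at h4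
  obtain rfl : p' = p := by simpa using h2
  refine ⟨x, w, h1, by simpa using h3, fun v hv => ?_⟩
  rcases h5 v (List.mem_cons_of_mem _ hv) with rfl | rfl | ⟨hs, hvK⟩
  · exact absurd hv h1.1
  · exact Or.inl rfl
  · exact Or.inr fun Q hQ =>
      linesIn_of_simplicial hD hc hdeg hs hvK (Node.isLine_of_ne hp hq hpq) hQ

end ClawFree

/-! ### Heavy triples from nets and from wounded copies. -/

namespace ClawFree

variable {V : Type*}

open List

variable [Fintype V] {G D : SimpleGraph V} (hG : NoClaw G)
  (hst : Relation.ReflTransGen CompletionStep G D) (hD : DiamondFree D)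
  (hc : NoClaw D) (hdeg : ∀ v, ∃ u, D.Adj v u) (hham : ¬ HasHamCyc D)
  {A : Node D} {L Z : Fin 3 → Node D} {Q : Fin 3 → Set (Node D)} {a c : Fin 3 → V}

omit [Fintype V] in
theorem IsNet.far {G : SimpleGraph V} {t : Fin 3 → V} {r : Fin 3 → List V} (h : IsNet G t r)
    {i j : Fin 3} (hij : i ≠ j) {p q : V} (hp : p ∈ t i :: r i) (hq : q ∈ r j) : Far G p q :=
  ⟨(h.cross i j hij p hp q (List.mem_cons_of_mem _ hq)).1, fun h' =>
    h.notMem hq (h.adj_imp hij hp (List.mem_cons_of_mem _ hq) h').2⟩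

omit [Fintype V] in
theorem IsNet.adj_head {G : SimpleGraph V} {t : Fin 3 → V} {r : Fin 3 → List V} (h : IsNet G t r)
    {i : Fin 3} {n : V} {s : List V} (hr : r i = n :: s) : G.Adj (t i) n := by
  have := h.path i
  rw [hr] at this
  exact (this.2.1 n (by simp)).2 rfl

/-- The triangle, one vertex of leg `j` and two of leg `k` induce a wounded. -/
theorem EndsHeavy.heavy_of_isNet (hW : EndsHeavy woundedGraph G) {t : Fin 3 → V}
    {r : Fin 3 → List V} (h : IsNet G t r) {i j k : Fin 3} (hij : i ≠ j) (hik : i ≠ k) (hjk : j ≠ k)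
    {n n' m : V} {s s' : List V} (hj : r j = n :: s) (hk : r k = n' :: m :: s') :
    Heavy G n ∧ Heavy G m := by
  have hp := h.path k
  rw [hk] at hp
  have hn : n ∈ r j := by rw [hj]; simp
  have hn' : n' ∈ r k := by rw [hk]; simp
  have hm : m ∈ r k := by rw [hk]; simp
  have htm : Far G (t k) m := by
    refine ⟨(h.notMem hm).symm, fun hadj => ?_⟩
    have := (hp.2.1 m (by simp)).1 hadj
    have he : n' = m := by simpa using this
    exact hp.2.2.1 (he ▸ by simp)
  exact hW.wounded (h.adj hij) (h.adj hik) (h.adj hjk) (h.adj_head hj) (h.adj_head hk)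
    ((hp.2.2.2.1 m (by simp)).2 rfl) (h.far hij (by simp) hn) (h.far hik (by simp) hn')
    (h.far hik (by simp) hm) (h.far hjk (by simp) hn') (h.far hjk (by simp) hm)
    (h.far hjk.symm (by simp) hn) htm (h.far hjk (List.mem_cons_of_mem _ hn) hn')
    (h.far hjk (List.mem_cons_of_mem _ hn) hm)

omit [Fintype V] in
include hst hD hc hdeg in
-- The edge to another triangle vertex puts `t i` in `A`, and the edge to `c i` puts it in `L i`;
-- these nodes share only `a i`.
theorem Spider.top_eq (h : Spider D A L Z Q a c) {t : Fin 3 → V} {r : Fin 3 → List V}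
    (hn : IsNet G t r) (hr : ∀ i, r i = [c i]) (hmem : ∀ i, t i ∈ armSet D A L a c i) (i : Fin 3) :
    t i = a i := by
  have hle := le_of_steps hst
  obtain ⟨j, hij⟩ := (by decide : ∀ i : Fin 3, ∃ j, i ≠ j) i
  have hadj := hle (hn.adj hij)
  have hN := isLine_edgeNode hadj
  have hA : edgeNode hadj = A := by
    rcases h.linesIn hD hc hdeg (hmem i) _ hN (left_mem_edgeNode _) with h1 | h1
    · exact h1
    rcases h.linesIn hD hc hdeg (hmem j) _ hN (right_mem_edgeNode _) with h2 | h2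
    · exact h2
    exact absurd h2 (h.disj i j hij _ h1)
  have hiA : t i ∈ A := hA ▸ left_mem_edgeNode hadj
  have hic := hle (hn.adj_head (hr i))
  have hiL : t i ∈ L i := by
    rcases h.linesIn_of_mem hD hc hdeg (hmem i) hiA _ (isLine_edgeNode hic) (left_mem_edgeNode _)
      with h1 | h1
    · exact absurd (h1 ▸ right_mem_edgeNode hic) (h.c_notMem_A hD hc hdeg i)
    · exact h1 ▸ left_mem_edgeNode hic
  by_contra hne
  exact h.A_ne_L i (Node.eq_of_mem hD hiA (h.a_mem_A i) hiL (h.a_mem_L i) hne)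

/-- Some arm continues beyond its second node, to a node `Y` off the other arms. -/
def HasLongArm (A : Node D) (L Z : Fin 3 → Node D) (Q : Fin 3 → Set (Node D)) : Prop :=
  ∃ j e Y, e ∈ Z j ∧ e ∈ Y ∧ Y ≠ Z j ∧ Y ≠ L j ∧ Y ≠ A ∧ ∀ i, i ≠ j → Y ∉ Q i

/-- All nodes `L i` meet a node `B` other than `A`. -/
def HasShortArms (A : Node D) (L : Fin 3 → Node D) (Q : Fin 3 → Set (Node D)) : Prop :=
  ∃ (B : Node D) (b : Fin 3 → V), B ≠ A ∧ (∀ i, B ∉ Q i) ∧ ∀ i, b i ∈ B ∧ b i ∈ L i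

include hst hD hc hdeg hham in
-- Lifting the edge beyond `c j` provides a neighbour `x` of `c j` in `G` off the rest of the net.
-- The two wounded copies with long tail `c j`, `x` make `x` and both other pendant vertices heavy,
-- and these are pairwise far.
theorem Spider.false_of_hasLongArm (hW : EndsHeavy woundedGraph G) (h : Spider D A L Z Q a c)
    (hn : IsNet G a fun i => [c i]) (hlong : HasLongArm A L Z Q) : False := by
  have hle := le_of_steps hst
  obtain ⟨j, e, Y, heZ, heY, hYZ, hYL, hYA, hYQ⟩ := hlong
  obtain ⟨i, k, hji, hjk, hik⟩ := (by decide : ∀ j : Fin 3, ∃ i k, j ≠ i ∧ j ≠ k ∧ i ≠ k) j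
  have hce : c j ≠ e := by
    rintro rfl
    exact (Node.eq_or_eq hD hc hdeg (h.c_mem_L j) heZ (h.L_ne_Z j) heY).elim hYL hYZ
  obtain ⟨x, w, hp, -, hx⟩ := exists_edge_lift hst hD hc hdeg (h.c_mem_Z j) heZ hce
  have hxl : LinesIn D x {Z j, Y} := by
    rcases hx x (by simp) with rfl | hx
    · exact linesIn_of_two hD hc hdeg heZ heY hYZ.symm (Or.inl rfl) (Or.inr rfl)
    · exact hx _ (Or.inl rfl)
  have hxa : ∀ i, Far D (a i) x := by
    intro i
    refine (h.linesIn_a hD hc hdeg i).far hdeg hxl ?_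
    rintro N (rfl | rfl) (h' | h')
    · exact h.A_ne_Z j h'
    · exact hYA h'.symm
    · by_cases hij : i = j
      · exact h.L_ne_Z j (hij ▸ h')
      · exact h.disj i j hij _ (h.L_mem i) (h' ▸ h.Z_mem j)
    · by_cases hij : i = j
      · exact hYL (hij ▸ h'.symm)
      · exact hYQ i hij (h' ▸ h.L_mem i)
  have hQ : ∀ i, i ≠ j → ∀ N ∈ Q i, N ∉ ({Z j, Y} : Set (Node D)) := by
    rintro i hij N hN (rfl | rfl)
    · exact h.disj i j hij _ hN (h.Z_mem j)
    · exact hYQ i hij hN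
  have hxc : ∀ i, i ≠ j → Far D (c i) x := fun i hij =>
    (h.linesIn_c hD hc hdeg i).far hdeg hxl (hQ i hij)
  have hcx : G.Adj (c j) x := (hp.2.1 x (by simp)).2 rfl
  have main : ∀ i k, i ≠ j → k ≠ j → i ≠ k → Heavy G (c i) ∧ Heavy G x := by
    intro i k hij hkj hik
    exact hW.wounded (v₀ := a k) (v₁ := a i) (v₂ := a j) (v₄ := c j) (hn.adj hik.symm)
      (hn.adj hkj) (hn.adj hij) (hn.adj_head rfl) (hn.adj_head rfl) hcx
      (hn.far hik.symm (by simp) (by simp)) (hn.far hkj (by simp) (by simp)) ((hxa k).anti hle)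
      (hn.far hij (by simp) (by simp)) ((hxa i).anti hle) (hn.far hij.symm (by simp) (by simp))
      ((hxa j).anti hle) (hn.far hij (by simp) (by simp)) ((hxc i hij).anti hle)
  exact not_three_heavy_of_linesIn hle hD hc hdeg hham (h.linesIn_c hD hc hdeg i)
    (h.linesIn_c hD hc hdeg k) hxl (h.disj i k hik) (hQ i hji.symm) (hQ k hjk.symm)
    (main i k hji.symm hjk.symm hik).1 (main k i hjk.symm hji.symm hik.symm).1
    (main i k hji.symm hjk.symm hik).2

include hG hst hD hc hdeg hham in
-- Here `G` contains the triangles `a i`, `b i`, `c i`. A wounded on such a triangle, with its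
-- pendant edge going into `B` and its tail running through `a m` to `c m`, makes `c m` heavy; doing
-- this for every `m` gives three far heavy vertices.
theorem Spider.false_of_hasShortArms (hW : EndsHeavy woundedGraph G) (h : Spider D A L Z Q a c)
    (hn : IsNet G a fun i => [c i]) (hshort : HasShortArms A L Q) : False := by
  have hle := le_of_steps hst
  obtain ⟨B, b, hBA, hBQ, hb⟩ := hshort
  have hLB : ∀ i, L i ≠ B := fun i he => hBQ i (he ▸ h.L_mem i)
  have hab : ∀ i, a i ≠ b i := by
    intro i he
    rcases Node.eq_or_eq hD hc hdeg (h.a_mem_A i) (h.a_mem_L i) (h.A_ne_L i)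
      (he ▸ (hb i).1 : a i ∈ B) with h' | h'
    · exact hBA h'
    · exact hLB i h'.symm
  have hbl : ∀ i, LinesIn D (b i) {L i, B} := fun i =>
    linesIn_of_two hD hc hdeg (hb i).2 (hb i).1 (hLB i) (Or.inl rfl) (Or.inr rfl)
  have dA : ∀ i j, i ≠ j → ∀ N ∈ ({A, L i} : Set (Node D)), N ∉ ({L j, B} : Set (Node D)) := by
    rintro i j hij N (rfl | rfl) (h' | h')
    · exact h.A_ne_L j h'
    · exact hBA h'.symm
    · exact h.L_ne_L i j hij h'
    · exact hLB i h'
  have dQ : ∀ i j, i ≠ j → ∀ N ∈ Q i, N ∉ ({L j, B} : Set (Node D)) := by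
    rintro i j hij N hN (rfl | rfl)
    · exact h.disj i j hij _ hN (h.L_mem j)
    · exact hBQ i hN
  -- If the edge of `D` lifted to a longer path, its first two new vertices would form the tail of
  -- wounded copies, again with three far heavy vertices.
  have hadj : ∀ j, G.Adj (a j) (b j) := by
    intro j
    obtain ⟨i, k, hji, hjk, hik⟩ := (by decide : ∀ j : Fin 3, ∃ i k, j ≠ i ∧ j ≠ k ∧ i ≠ k) j
    obtain ⟨x, w, hp, hlast, hx⟩ :=
      exists_edge_lift hst hD hc hdeg (h.a_mem_L j) (hb j).2 (hab j)
    have hxl : ∀ v ∈ x :: w, LinesIn D v {L j, B} := by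
      intro v hv
      rcases hx v hv with rfl | hx
      · exact hbl j
      · exact hx _ (Or.inl rfl)
    have hax : G.Adj (a j) x := (hp.2.1 x (by simp)).2 rfl
    rcases w with _ | ⟨y, w⟩
    · obtain rfl : x = b j := by simpa using hlast
      exact hax
    exfalso
    have hxy : G.Adj x y := (hp.2.2.2.1 y (by simp)).2 rfl
    have hay : Far G (a j) y := by
      refine ⟨fun he => hp.1 (by simp [he]), fun hadj => ?_⟩
      have := (hp.2.1 y (by simp)).1 hadj
      have he : x = y := by simpa using this
      exact hp.2.2.1 (by simp [he])
    have far1 : ∀ i, i ≠ j → ∀ v ∈ x :: y :: w, Far G (a i) v := fun i hij v hv =>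
      ((h.linesIn_a hD hc hdeg i).far hdeg (hxl v hv) (dA i j hij)).anti hle
    have far2 : ∀ i, i ≠ j → ∀ v ∈ x :: y :: w, Far G (c i) v := fun i hij v hv =>
      ((h.linesIn_c hD hc hdeg i).far hdeg (hxl v hv) (dQ i j hij)).anti hle
    have main : ∀ i k, i ≠ j → k ≠ j → i ≠ k → Heavy G (c i) ∧ Heavy G y := by
      intro i k hij hkj hik
      exact hW.wounded (v₀ := a k) (v₁ := a i) (v₂ := a j) (v₄ := x) (hn.adj hik.symm)
        (hn.adj hkj) (hn.adj hij) (hn.adj_head rfl) hax hxy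
        (hn.far hik.symm (by simp) (by simp)) (far1 k hkj x (by simp)) (far1 k hkj y (by simp))
        (far1 i hij x (by simp)) (far1 i hij y (by simp)) (hn.far hij.symm (by simp) (by simp))
        hay (far2 i hij x (by simp)) (far2 i hij y (by simp))
    exact not_three_heavy_of_linesIn hle hD hc hdeg hham (h.linesIn_c hD hc hdeg i)
      (h.linesIn_c hD hc hdeg k) (hxl y (by simp)) (h.disj i k hik) (dQ i j hji.symm)
      (dQ k j hjk.symm) (main i k hji.symm hjk.symm hik).1 (main k i hjk.symm hji.symm hik.symm).1
      (main i k hji.symm hjk.symm hik).2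
  have hbc : ∀ i, G.Adj (b i) (c i) := by
    intro i
    obtain ⟨m, him⟩ := (by decide : ∀ i : Fin 3, ∃ j, i ≠ j) i
    have hbc : b i ≠ c i := by
      intro he
      rcases Node.eq_or_eq hD hc hdeg (h.c_mem_L i) (h.c_mem_Z i) (h.L_ne_Z i)
        (he ▸ (hb i).1 : c i ∈ B) with h' | h'
      · exact hLB i h'.symm
      · exact hBQ i (h' ▸ h.Z_mem i)
    have f1 : Far G (a m) (b i) :=
      ((h.linesIn_a hD hc hdeg m).far hdeg (hbl i) (dA m i him.symm)).anti hle
    have f2 : Far G (a m) (c i) := hn.far him.symm (by simp) (by simp)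
    rcases hG (a i) (a m) (b i) (c i) (hn.adj him) (hadj i) (hn.adj_head rfl) f1.1 hbc f2.1
      with h' | h' | h'
    · exact absurd h' f1.2
    · exact h'
    · exact absurd h' f2.2
  have hheavy : ∀ m, Heavy G (c m) := by
    intro m
    obtain ⟨i, k, hmi, hmk, hik⟩ := (by decide : ∀ j : Fin 3, ∃ i k, j ≠ i ∧ j ≠ k ∧ i ≠ k) m
    have hbb : b i ≠ b k := by
      intro he
      rcases Node.eq_or_eq hD hc hdeg (hb i).1 (hb i).2 (hLB i).symm (he ▸ (hb k).2 : b i ∈ L k)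
        with h' | h'
      · exact hLB k h'
      · exact h.L_ne_L i k hik h'.symm
    obtain ⟨u, w, hp, -, hu⟩ := exists_edge_lift hst hD hc hdeg (hb i).1 (hb k).1 hbb
    have hul : LinesIn D u {L k, B} := by
      rcases hu u (by simp) with rfl | hu
      · exact hbl k
      · exact hu _ (Or.inr rfl)
    have hbu : G.Adj (b i) u := (hp.2.1 u (by simp)).2 rfl
    have dB : ∀ N ∈ Q m, N ∉ ({L i, B} : Set (Node D)) := dQ m i hmi
    exact (hW.wounded (v₀ := c i) (v₁ := b i) (v₂ := a i) (v₃ := u) (v₄ := a m) (v₅ := c m)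
      (hbc i).symm (hn.adj_head rfl).symm (hadj i).symm hbu (hn.adj hmi.symm) (hn.adj_head rfl)
      (((h.linesIn_c hD hc hdeg i).far hdeg hul (dQ i k hik)).anti hle)
      (hn.far hmi (by simp) (by simp)).symm (hn.far hmi.symm (by simp) (by simp))
      (((h.linesIn_a hD hc hdeg m).far hdeg (hbl i) (dA m i hmi)).anti hle).symm
      (((h.linesIn_c hD hc hdeg m).far hdeg (hbl i) dB).anti hle).symm
      (((h.linesIn_a hD hc hdeg i).far hdeg hul (dA i k hik)).anti hle)
      (hn.far hmi.symm (by simp) (by simp))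
      (((h.linesIn_a hD hc hdeg m).far hdeg hul (dA m k hmk)).anti hle).symm
      (((h.linesIn_c hD hc hdeg m).far hdeg hul (dQ m k hmk)).anti hle).symm).2
  exact not_three_heavy_of_linesIn hle hD hc hdeg hham (h.linesIn_c hD hc hdeg 0)
    (h.linesIn_c hD hc hdeg 1) (h.linesIn_c hD hc hdeg 2) (h.disj 0 1 (by decide))
    (h.disj 0 2 (by decide)) (h.disj 1 2 (by decide)) (hheavy 0) (hheavy 1) (hheavy 2)

include hG hst hD hc hdeg hham in
-- If the lifted net has two long legs, wounded copies make the first vertices of all legs heavy.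
-- One long leg gives three far heavy vertices, and none means that the net of `D` is induced in
-- `G`, where `harm` applies.
theorem Spider.exists_heavy_of_wounded (hW : EndsHeavy woundedGraph G) (h : Spider D A L Z Q a c)
    (harm : HasLongArm A L Z Q ∨ HasShortArms A L Q) :
    ∃ p : Fin 3 → V, (∀ i, p i ∈ armSet D A L a c i) ∧ (∀ i, Heavy G (p i)) ∧
      ∀ i j, i ≠ j → Far G (p i) (p j) := by
  have hle := le_of_steps hst
  obtain ⟨t, r, hn, hr, hlast, hmem⟩ := h.lift hD hc hdeg hG hst
  choose n s hns using fun i => List.exists_cons_of_ne_nil (hr i)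
  have hnr : ∀ i, n i ∈ r i := fun i => by rw [hns]; simp
  have hfar : ∀ i j, i ≠ j → Far G (n i) (n j) := fun i j hij =>
    hn.far hij (List.mem_cons_of_mem _ (hnr i)) (hnr j)
  have hshort : ∀ i, s i = [] → r i = [c i] := by
    intro i hs
    have := hlast i
    rw [hns, hs] at this
    have he : n i = c i := by simpa using this
    rw [hns, hs, he]
  by_cases hall : ∀ i, s i = []
  · have hr' : r = fun i => [c i] := funext fun i => hshort i (hall i)
    have ht : t = a := funext fun i => h.top_eq hst hD hc hdeg hn (fun i => hshort i (hall i))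
      (fun i => hmem i _ (by simp)) i
    rw [hr', ht] at hn
    rcases harm with h' | h'
    · exact (h.false_of_hasLongArm hst hD hc hdeg hham hW hn h').elim
    · exact (h.false_of_hasShortArms hG hst hD hc hdeg hham hW hn h').elim
  push Not at hall
  obtain ⟨k, hk⟩ := hall
  have hlong : ∀ k, s k ≠ [] → ∃ m ∈ r k, ∀ j, j ≠ k → Heavy G (n j) ∧ Heavy G m := by
    intro k hk
    obtain ⟨m, s', hs'⟩ := List.exists_cons_of_ne_nil hk
    refine ⟨m, by rw [hns, hs']; simp, fun j hj => ?_⟩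
    obtain ⟨i, hij, hik⟩ := (by decide : ∀ j k : Fin 3, j ≠ k → ∃ i, i ≠ j ∧ i ≠ k) j k hj
    exact hW.heavy_of_isNet hn hij hik hj (hns j) (by rw [hns, hs'])
  obtain ⟨m, hm, hmh⟩ := hlong k hk
  by_cases htwo : ∃ k', k' ≠ k ∧ s k' ≠ []
  · obtain ⟨k', hkk, hk'⟩ := htwo
    obtain ⟨m', -, hmh'⟩ := hlong k' hk'
    refine ⟨n, fun i => hmem i _ (List.mem_cons_of_mem _ (hnr i)), fun i => ?_, hfar⟩
    by_cases hi : i = k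
    · exact (hmh' i fun h => hkk (h.symm.trans hi)).1
    · exact (hmh i hi).1
  · push Not at htwo
    obtain ⟨i, j, hki, hkj, hij⟩ := (by decide : ∀ j : Fin 3, ∃ i k, j ≠ i ∧ j ≠ k ∧ i ≠ k) k
    have hci : ∀ i, i ≠ k → LinesIn D (n i) (Q i) := by
      intro i hi
      have h1 := hshort i (htwo i hi)
      rw [hns, htwo i hi] at h1
      have h2 : n i = c i := by simpa using h1
      rw [h2]
      exact h.linesIn_c hD hc hdeg i
    refine (not_three_heavy_of_linesIn hle hD hc hdeg hham (hci i hki.symm) (hci j hkj.symm)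
      (h.linesIn hD hc hdeg (hmem k m (List.mem_cons_of_mem _ hm))) (h.disj i j hij) ?_ ?_
      (hmh i hki.symm).1 (hmh j hkj.symm).1 (hmh i hki.symm).2).elim
    · rintro N hN (rfl | hN')
      · exact h.A_notMem i hN
      · exact h.disj i k hki.symm N hN hN'
    · rintro N hN (rfl | hN')
      · exact h.A_notMem j hN
      · exact h.disj j k hkj.symm N hN hN'

include hG hst hD hc hdeg in
theorem Spider.exists_heavy_of_net (hN : EndsHeavy netGraph G) (h : Spider D A L Z Q a c) :
    ∃ p : Fin 3 → V, (∀ i, p i ∈ armSet D A L a c i) ∧ (∀ i, Heavy G (p i)) ∧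
      ∀ i j, i ≠ j → Far G (p i) (p j) := by
  obtain ⟨t, r, hn, hr, -, hmem⟩ := h.lift hD hc hdeg hG hst
  choose n s hns using fun i => List.exists_cons_of_ne_nil (hr i)
  have hnr : ∀ i, n i ∈ r i := fun i => by rw [hns]; simp
  exact ⟨n, fun i => hmem i _ (List.mem_cons_of_mem _ (hnr i)),
    hN.net hn hnr fun i => hn.adj_head (hns i), fun i j hij =>
    hn.far hij (List.mem_cons_of_mem _ (hnr i)) (hnr j)⟩

omit [Fintype V] in
-- If all legs are single nodes, `B` meets every `L i`. Otherwise a leg with two nodes goes on, to a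
-- third node or to `B`.
theorem IsTheta.arms {U : Set (Node D)} {B : Node D} {α : Fin 3 → List (Node D)}
    (h : IsTheta (nodeGraph D) U A B α) (hJ : OuterSparse (nodeGraph D) U)
    (hα : ∀ i, (α i = [L i] ∧ Z i ∉ U) ∨ ∃ s, α i = L i :: Z i :: s) :
    HasLongArm A L Z (fun i => legSet (nodeGraph D) U (α i)) ∨
      HasShortArms A L (fun i => legSet (nodeGraph D) U (α i)) := by
  by_cases hs : ∀ i, α i = [L i]
  · right
    have : ∀ i, ∃ b, b ∈ B ∧ b ∈ L i := by
      intro i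
      have hch := (h.leg i).chain
      rw [hs i] at hch
      simp only [List.cons_append, List.nil_append, List.isChain_cons_cons] at hch
      obtain ⟨-, ⟨-, b, hb, hb'⟩, -⟩ := hch
      exact ⟨b, hb', hb⟩
    choose b hb using this
    exact ⟨B, b, h.ne.symm, h.right_notMem, hb⟩
  · left
    push Not at hs
    obtain ⟨j, hj⟩ := hs
    obtain ⟨s, hs⟩ := (hα j).resolve_left fun h' => hj h'.1
    have hch := (h.leg j).chain
    have hnd := (h.leg j).nodup
    have hA := (h.leg j).left
    have hB := (h.leg j).right
    rcases s with _ | ⟨Y, s⟩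
    · rw [hs] at hch hB
      simp only [List.cons_append, List.nil_append, List.isChain_cons_cons] at hch
      obtain ⟨-, -, ⟨hne, e, he, he'⟩, -⟩ := hch
      exact ⟨j, e, B, he, he', hne.symm, fun h' => hB (by simp [h']), h.ne.symm,
        fun i _ => h.right_notMem i⟩
    · have hYj : Y ∈ α j := by rw [hs]; simp
      rw [hs] at hch hnd hA
      simp only [List.cons_append, List.isChain_cons_cons] at hch
      obtain ⟨-, -, ⟨hne, e, he, he'⟩, -⟩ := hch
      refine ⟨j, e, Y, he, he', hne.symm, ?_, fun h' => hA (by simp [h']),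
        fun i hij => h.disj_legSet hJ (Ne.symm hij) (Or.inl hYj)⟩
      rintro rfl
      simp at hnd

end ClawFree

/-! ### The three cases combined. -/

theorem theorem3 {V : Type*} [Fintype V] [DecidableEq V] (G : SimpleGraph V) [DecidableRel G.Adj]
    (H : SimpleGraph (Fin 6))
    (hH : H = SimpleGraph.pathGraph 6 ∨ H = netGraph ∨ H = woundedGraph)
    (hconn : IsKConnected G 2) (hclaw : IsClawFree G) (hPhi : SatisfiesPhi H 3 G) :
    G.IsHamiltonian := by
  have hG := ClawFree.noClaw_of_isClawFree hclaw
  have hends := ClawFree.endsHeavy_of_satisfiesPhi hPhi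
  obtain ⟨D, hst, hc, hD⟩ := ClawFree.exists_closure hG
  have hle := ClawFree.le_of_steps hst
  have hcutG := ClawFree.cutFree_of_isKConnected hconn
  have h3 : 3 ≤ Fintype.card V := hconn.1
  have hdeg : ∀ v, ∃ u, D.Adj v u := by
    intro v
    by_contra hv
    push Not at hv
    obtain ⟨x, hx, y, hy, hxy⟩ := Finset.one_lt_card.1
      (show 1 < (Finset.univ.erase v).card by
        rw [Finset.card_erase_of_mem (Finset.mem_univ v), Finset.card_univ]; omega)
    -- An isolated `v` would be cut off from `y` by deleting a third vertex `x`.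
    have := (hcutG.mono hle) x {v} (by
      rintro p rfl q hpq
      exact absurd hpq (hv q)) v rfl (Finset.ne_of_mem_erase hx).symm y hxy.symm
    exact Finset.ne_of_mem_erase hy this
  refine ClawFree.HasHamCyc.isHamiltonian (ClawFree.hasHamCyc_of_steps hG hst ?_)
  by_contra hham
  obtain ⟨U, A, B, α, hJ, ht⟩ :=
    ClawFree.exists_theta_of_not_hasHamCyc hD hc (hcutG.mono hle) hdeg h3 hham
  obtain ⟨L, Z, a, c, hS, hα⟩ := ht.exists_spider hJ
  obtain ⟨M, Z', b, c', hS', hα'⟩ := ht.reverse.exists_spider hJ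
  have harm := ht.arms hJ hα
  have harm' := ht.reverse.arms hJ hα'
  -- The spiders at `A` and `B` use the same three legs, so they are confined to the same sets of
  -- nodes.
  simp only [ClawFree.legSet_reverse] at hS' harm'
  rcases hH with rfl | rfl | rfl
  · have hheavy := hends.heavy_of_theta hst hD hc hdeg ht hS hα
    exact ClawFree.not_three_heavy_of_linesIn hle hD hc hdeg hham (hS.linesIn_c hD hc hdeg 0)
      (hS.linesIn_c hD hc hdeg 1) (hS.linesIn_c hD hc hdeg 2) (hS.disj 0 1 (by decide))
      (hS.disj 0 2 (by decide)) (hS.disj 1 2 (by decide)) (hheavy 0) (hheavy 1) (hheavy 2)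
  · obtain ⟨p, hp, w, f⟩ := hS.exists_heavy_of_net hG hst hD hc hdeg hends
    obtain ⟨p', hp', w', f'⟩ := hS'.exists_heavy_of_net hG hst hD hc hdeg hends
    exact hS.false_of_heavy hG hle hD hc hdeg hham hS' ht.ne hp hp' w w' f f'
  · obtain ⟨p, hp, w, f⟩ := hS.exists_heavy_of_wounded hG hst hD hc hdeg hham hends harm
    obtain ⟨p', hp', w', f'⟩ := hS'.exists_heavy_of_wounded hG hst hD hc hdeg hham hends harm'
    exact hS.false_of_heavy hG hle hD hc hdeg hham hS' ht.ne hp hp' w w' f f'
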